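/- **Setting.** Let $d\in\{2,3\}$, let $\Omega\subset\mathbb R^d$ be a cube identified with the $d$-dimensional torus (all functions are periodic), let $\gamma>0$, and let $b,\eta\in C^2(\mathbb R)$ be bounded above and below by positive constants, with bounded first and second derivatives. Let $f\in C^4(\mathbb R)$ satisfy $f\ge 0$, $f''\ge -f_1$ for some $f_1\ge 0$, and $|f^{(k)}(s)|\le f_2^{(k)}+f_3^{(k)}|s|^{4-k}$ for $0\le k\le 4$ and all $s\in\mathbb R$. Let $\mathcal T_h$ be a geometrically conforming partition of $\Omega$ into finitely many simplices whose periodic extension is also geometrically conforming, with $h=\max_K h_K$, quasi-uniform in the sense that $\sigma h\le\rho_K\le h_K\le h$ for all $K\in\mathcal T_h$ and some $\sigma>0$ ($h_K$ is the diameter and $\rho_K$ the inner radius of $K$). Let $T>0$, $N\ge 1$, $\tau=T/N$, $t^n=n\tau$ for $0\le n\le N$. Set $$\mathcal V_h=\{v\in H^1(\Omega): v|_K\in P_2(K)\ \forall K\in\mathcal T_h\},\qquad \mathcal Q_h=\{q\in H^1(\Omega): \textstyle\int_\Omega q\,dx=0,\ q|_K\in P_1(K)\ \forall K\in\mathcal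 T_h\},$$ $$\mathcal Z_h=\{v\in\mathcal V_h^d:\langle \operatorname{div}v,q\rangle=0\ \forall q\in\mathcal Q_h\},$$ with $\langle\cdot,\cdot\rangle$ the $L^2(\Omega)$ scalar product. For a space $X$ let $P_0(X)$ and $P_1^c(X)$ be the $X$-valued functions on $[0,T]$ that are constant on each interval $(t^{n-1},t^n)$, respectively continuous and affine on each of these intervals. Let $\bar w$ denote the $L^2(0,T)$-orthogonal projection of $w$ to piecewise constants, i.e. its mean value on each interval $(t^{n-1},t^n)$, write $\langle a,b\rangle^n=\int_{t^{n-1}}^{t^n}\langle a(s),b(s)\rangle\,ds$, and let $\langle a\cdot\nabla b,c\rangle_{\rm skw}=\tfrac12\big(\langle a\cdot\nabla b,c\rangle-\langle b,a\cdot\nabla c\rangle\big)$, with $\langle a\cdot\nabla b,c\rangle_{\rm skw}^n$ its integral over $(t^{n-1},t^n)$. **Scheme.** Seek $\phi_h\in P_1^c(\mathcal V_h)$, $\bar\mu_h\in P_0(\mathcal V_h)$, $u_h\in P_1^c(\mathcal V_h^d)$, $\bar p_h\in P_0(\mathcal Q_h)$ such that, for all $\bar\psi,\bar\xi\in P_0(\mathcal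 V_h)$, $\bar v\in P_0(\mathcal V_h^d)$, $\bar q\in P_0(\mathcal Q_h)$ and all $1\le n\le N$, $$\langle\partial_t\phi_h,\bar\psi\rangle^n=\langle\phi_h\bar u_h,\nabla\bar\psi\rangle^n-\langle b(\bar\phi_h)\nabla\bar\mu_h,\nabla\bar\psi\rangle^n,$$ $$\langle\bar\mu_h,\bar\xi\rangle^n=\gamma\langle\nabla\phi_h,\nabla\bar\xi\rangle^n+\langle f'(\phi_h),\bar\xi\rangle^n,$$ $$\langle\partial_t u_h,\bar v\rangle^n=-\langle u_h\cdot\nabla\bar u_h,\bar v\rangle_{\rm skw}^n-\langle\eta(\bar\phi_h)\nabla\bar u_h,\nabla\bar v\rangle^n+\langle\bar p_h,\operatorname{div}\bar v\rangle^n-\langle\phi_h\bar v,\nabla\bar\mu_h\rangle^n,$$ $$\langle\operatorname{div}u_h,\bar q\rangle^n=0.$$ **Theorem.** For all $\phi(0)\in H^1(\Omega)$ and $u(0)\in H^1(\Omega)^d$, the scheme has at least one solution $(\phi_h,\bar\mu_h,u_h,\bar p_h)$ such that $\phi_h(0)$ is the $H^1$-orthogonal projection of $\phi(0)$ to $\mathcal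 V_h$ and $u_h(0)$ is the $H^1$-orthogonal projection of $u(0)$ to $\mathcal Z_h$. Moreover, every solution of the scheme (with arbitrary initial values) satisfies, for all $0\le m\le n\le N$, $$\int_\Omega\phi_h(t^n)\,dx=\int_\Omega\phi_h(t^m)\,dx,$$ $$\mathcal E(\phi_h(t^n),u_h(t^n))+\int_{t^m}^{t^n}\mathcal D_{\bar\phi_h}(\bar\mu_h,\bar u_h)\,ds=\mathcal E(\phi_h(t^m),u_h(t^m)),$$ where $\mathcal E(\phi,u)=\int_\Omega\frac\gamma2|\nabla\phi|^2+f(\phi)+\frac12|u|^2\,dx$ and $\mathcal D_\phi(\mu,u)=\int_\Omega b(\phi)|\nabla\mu|^2+\eta(\phi)|\nabla u|^2\,dx$. -/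

import Mathlib

open MeasureTheory Set
open scoped ContDiff

noncomputable section

namespace CHNS

/-! ### The periodic cell and periodic Sobolev functions -/

/-- Euclidean space of dimension `d`. -/
abbrev Pt (d : ℕ) : Type := EuclideanSpace ℝ (Fin d)

/-- The closed cube with lower corner `a` and side length `L`. -/
def cube {d : ℕ} (a : Pt d) (L : ℝ) : Set (Pt d) :=
  {x | ∀ i, a i ≤ x i ∧ x i ≤ a i + L}

theorem isCompact_cube {d : ℕ} (a : Pt d) (L : ℝ) : IsCompact (cube a L) := by
  have h : cube a L = (PiLp.homeomorph 2 (fun _ : Fin d => ℝ)) ⁻¹'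
      (Set.pi Set.univ fun i => Set.Icc (a i) (a i + L)) := by
    ext x
    simp only [cube, mem_preimage, Set.mem_pi, Set.mem_univ, true_implies, Set.mem_Icc]
    rfl
  rw [h, Homeomorph.isCompact_preimage]
  exact isCompact_univ_pi fun i => isCompact_Icc

instance isFiniteMeasure_cube {d : ℕ} (a : Pt d) (L : ℝ) :
    IsFiniteMeasure (volume.restrict (cube a L)) :=
  ⟨by simpa using (isCompact_cube a L).measure_lt_top⟩

/-- The lattice vector `L k`, for `k` an integer vector. -/
def latticeVec {d : ℕ} (L : ℝ) (k : Fin d → ℤ) : Pt d :=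
  WithLp.toLp 2 fun i => L * (k i : ℝ)

/-- Smooth functions with period `L` in every coordinate (smooth functions on the torus). -/
def IsPeriodicTest {d : ℕ} (L : ℝ) (ψ : Pt d → ℝ) : Prop :=
  ContDiff ℝ ∞ ψ ∧ ∀ (x : Pt d) (k : Fin d → ℤ), ψ (x + latticeVec L k) = ψ x

/-- The partial derivative in direction `i` of a smooth function. -/
def partialDeriv {d : ℕ} (i : Fin d) (ψ : Pt d → ℝ) (x : Pt d) : ℝ :=
  fderiv ℝ ψ x (EuclideanSpace.single i 1)

/-- Pairs of a square integrable scalar function and a square integrable vector field on the cube. -/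
abbrev L2Pair {d : ℕ} (a : Pt d) (L : ℝ) : Type :=
  Lp ℝ 2 (volume.restrict (cube a L)) × Lp (Pt d) 2 (volume.restrict (cube a L))

theorem integrable_mul_of_continuous {d : ℕ} {a : Pt d} {L : ℝ} {u ψ : Pt d → ℝ}
    (hu : MemLp u 2 (volume.restrict (cube a L))) (hψ : Continuous ψ) :
    Integrable (fun x => u x * ψ x) (volume.restrict (cube a L)) := by
  have h1 : IntegrableOn u (cube a L) := hu.integrable (by norm_num)
  exact h1.mul_continuousOn hψ.continuousOn (isCompact_cube a L)

theorem memLp_coord {d : ℕ} {a : Pt d} {L : ℝ} (g : Lp (Pt d) 2 (volume.restrict (cube a L)))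
    (i : Fin d) : MemLp (fun x => g x i) 2 (volume.restrict (cube a L)) :=
  (EuclideanSpace.proj i : Pt d →L[ℝ] ℝ).comp_memLp' (Lp.memLp g)

theorem IsPeriodicTest.continuous {d : ℕ} {L : ℝ} {ψ : Pt d → ℝ} (h : IsPeriodicTest L ψ) :
    Continuous ψ := h.1.continuous

theorem IsPeriodicTest.continuous_partialDeriv {d : ℕ} {L : ℝ} {ψ : Pt d → ℝ}
    (h : IsPeriodicTest L ψ) (i : Fin d) : Continuous (partialDeriv i ψ) :=
  (h.1.continuous_fderiv (by simp)).clm_apply continuous_const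

/-- The periodic Sobolev space `H¹(Ω)`. An element is a pair `w = (u, ∇u)` consisting of a square
integrable function and its (unique) weak gradient on the torus, which is square integrable. -/
def H1per {d : ℕ} (a : Pt d) (L : ℝ) : Submodule ℝ (L2Pair a L) where
  carrier := {w | ∀ ψ : Pt d → ℝ, IsPeriodicTest L ψ → ∀ i : Fin d,
    ∫ x in cube a L, w.1 x * partialDeriv i ψ x = - ∫ x in cube a L, w.2 x i * ψ x}
  zero_mem' := by
    intro ψ _ i
    have h1 : ∫ x in cube a L, ((0 : L2Pair a L).1 : Pt d → ℝ) x * partialDeriv i ψ x = 0 := by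
      refine integral_eq_zero_of_ae ?_
      filter_upwards [Lp.coeFn_zero ℝ 2 (volume.restrict (cube a L))] with x hx
      have hx' : ((0 : L2Pair a L).1 : Pt d → ℝ) x = 0 := hx
      simp only [hx', zero_mul, Pi.zero_apply]
    have h2 : ∫ x in cube a L, ((0 : L2Pair a L).2 : Pt d → Pt d) x i * ψ x = 0 := by
      refine integral_eq_zero_of_ae ?_
      filter_upwards [Lp.coeFn_zero (Pt d) 2 (volume.restrict (cube a L))] with x hx
      have hx' : ((0 : L2Pair a L).2 : Pt d → Pt d) x = 0 := hx
      simp only [hx', PiLp.zero_apply, zero_mul, Pi.zero_apply]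
    rw [h1, h2, neg_zero]
  add_mem' := by
    intro v w hv hw ψ hψ i
    have h1 : ∫ x in cube a L, ((v + w).1 : Pt d → ℝ) x * partialDeriv i ψ x
        = (∫ x in cube a L, v.1 x * partialDeriv i ψ x)
          + ∫ x in cube a L, w.1 x * partialDeriv i ψ x := by
      rw [← integral_add
        (integrable_mul_of_continuous (Lp.memLp v.1) (hψ.continuous_partialDeriv i))
        (integrable_mul_of_continuous (Lp.memLp w.1) (hψ.continuous_partialDeriv i))]
      refine integral_congr_ae ?_
      filter_upwards [Lp.coeFn_add v.1 w.1] with x hx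
      have hx' : ((v + w).1 : Pt d → ℝ) x = v.1 x + w.1 x := hx
      simp only [hx', add_mul]
    have h2 : ∫ x in cube a L, ((v + w).2 : Pt d → Pt d) x i * ψ x
        = (∫ x in cube a L, v.2 x i * ψ x) + ∫ x in cube a L, w.2 x i * ψ x := by
      rw [← integral_add
        (integrable_mul_of_continuous (memLp_coord v.2 i) hψ.continuous)
        (integrable_mul_of_continuous (memLp_coord w.2 i) hψ.continuous)]
      refine integral_congr_ae ?_
      filter_upwards [Lp.coeFn_add v.2 w.2] with x hx
      have hx' : ((v + w).2 : Pt d → Pt d) x = v.2 x + w.2 x := hx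
      simp only [hx', PiLp.add_apply, add_mul]
    rw [h1, h2, hv ψ hψ i, hw ψ hψ i]
    ring
  smul_mem' := by
    intro c v hv ψ hψ i
    have h1 : ∫ x in cube a L, ((c • v).1 : Pt d → ℝ) x * partialDeriv i ψ x
        = c * ∫ x in cube a L, v.1 x * partialDeriv i ψ x := by
      rw [← integral_const_mul]
      refine integral_congr_ae ?_
      filter_upwards [Lp.coeFn_smul c v.1] with x hx
      simp [hx, mul_assoc]
    have h2 : ∫ x in cube a L, ((c • v).2 : Pt d → Pt d) x i * ψ x
        = c * ∫ x in cube a L, v.2 x i * ψ x := by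
      rw [← integral_const_mul]
      refine integral_congr_ae ?_
      filter_upwards [Lp.coeFn_smul c v.2] with x hx
      simp [hx, mul_assoc]
    rw [h1, h2, hv ψ hψ i]
    ring

/-- The function `u` of a pair `(u, ∇u)`. -/
def val {d : ℕ} {a : Pt d} {L : ℝ} (w : L2Pair a L) : Pt d → ℝ := w.1

/-- The gradient `∇u` of a pair `(u, ∇u)`. -/
def grad {d : ℕ} {a : Pt d} {L : ℝ} (w : L2Pair a L) : Pt d → Pt d := w.2

/-! ### Meshes -/

/-- A geometrically conforming partition of the cube into finitely many simplices (given by their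
vertex sets), such that its `L`-periodic extension is geometrically conforming as well: a simplex
and a translate of a simplex by a lattice vector (in particular, by zero) meet in the convex hull
of their common vertices. -/
structure PeriodicMesh (d : ℕ) (a : Pt d) (L : ℝ) where
  cells : Finset (Finset (Pt d))
  card_vertices : ∀ K ∈ cells, K.card = d + 1
  affineIndependent : ∀ K ∈ cells, AffineIndependent ℝ (fun x : K => (x : Pt d))
  cover : ⋃ K ∈ cells, convexHull ℝ (K : Set (Pt d)) = cube a L
  conforming : ∀ K ∈ cells, ∀ K' ∈ cells, ∀ k : Fin d → ℤ,
    convexHull ℝ (K : Set (Pt d)) ∩ convexHull ℝ ((· + latticeVec L k) '' (K' : Set (Pt d)))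
      = convexHull ℝ ((K : Set (Pt d)) ∩ (· + latticeVec L k) '' (K' : Set (Pt d)))

/-- The radius of the largest ball contained in a set. -/
def innerRadius {d : ℕ} (s : Set (Pt d)) : ℝ :=
  sSup {r | 0 ≤ r ∧ ∃ c, Metric.closedBall c r ⊆ s}

/-- `h` is the maximal diameter of the cells, and `σ h ≤ ρ_K ≤ h_K ≤ h` for every cell `K`. -/
def PeriodicMesh.IsQuasiUniform {d : ℕ} {a : Pt d} {L : ℝ} (M : PeriodicMesh d a L)
    (σ h : ℝ) : Prop :=
  0 < σ ∧
  (∃ K ∈ M.cells, Metric.diam (convexHull ℝ (K : Set (Pt d))) = h) ∧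
  ∀ K ∈ M.cells,
    σ * h ≤ innerRadius (convexHull ℝ (K : Set (Pt d))) ∧
    innerRadius (convexHull ℝ (K : Set (Pt d))) ≤ Metric.diam (convexHull ℝ (K : Set (Pt d))) ∧
    Metric.diam (convexHull ℝ (K : Set (Pt d))) ≤ h

/-! ### Finite element spaces -/

/-- Functions in `H¹(Ω)` which are polynomials of degree at most `k` on every cell. -/
def FE {d : ℕ} {a : Pt d} {L : ℝ} (M : PeriodicMesh d a L) (k : ℕ) :
    Submodule ℝ (L2Pair a L) where
  carrier := {w | w ∈ H1per a L ∧ ∀ K ∈ M.cells, ∃ P : MvPolynomial (Fin d) ℝ,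
    P.totalDegree ≤ k ∧ ∀ᵐ x ∂(volume.restrict (convexHull ℝ (K : Set (Pt d)))),
      val w x = MvPolynomial.eval (fun i => x i) P}
  zero_mem' := by
    refine ⟨(H1per a L).zero_mem, fun K hK => ⟨0, by simp, ?_⟩⟩
    have hsub : convexHull ℝ (K : Set (Pt d)) ⊆ cube a L := by
      rw [← M.cover]
      exact Set.subset_biUnion_of_mem (u := fun K : Finset (Pt d) => convexHull ℝ (K : Set (Pt d))) hK
    filter_upwards [ae_mono (Measure.restrict_mono hsub le_rfl)
      (Lp.coeFn_zero ℝ 2 (volume.restrict (cube a L)))] with x hx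
    simpa [val] using hx
  add_mem' := by
    rintro v w ⟨hv, hv'⟩ ⟨hw, hw'⟩
    refine ⟨(H1per a L).add_mem hv hw, fun K hK => ?_⟩
    obtain ⟨P, hP, hP'⟩ := hv' K hK
    obtain ⟨Q, hQ, hQ'⟩ := hw' K hK
    have hsub : convexHull ℝ (K : Set (Pt d)) ⊆ cube a L := by
      rw [← M.cover]
      exact Set.subset_biUnion_of_mem (u := fun K : Finset (Pt d) => convexHull ℝ (K : Set (Pt d))) hK
    refine ⟨P + Q, (MvPolynomial.totalDegree_add P Q).trans (max_le hP hQ), ?_⟩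
    filter_upwards [hP', hQ', ae_mono (Measure.restrict_mono hsub le_rfl)
      (Lp.coeFn_add v.1 w.1)] with x h1 h2 h3
    simp only [val] at h1 h2 ⊢
    rw [map_add, ← h1, ← h2]
    simpa using h3
  smul_mem' := by
    rintro c v ⟨hv, hv'⟩
    refine ⟨(H1per a L).smul_mem c hv, fun K hK => ?_⟩
    obtain ⟨P, hP, hP'⟩ := hv' K hK
    have hsub : convexHull ℝ (K : Set (Pt d)) ⊆ cube a L := by
      rw [← M.cover]
      exact Set.subset_biUnion_of_mem (u := fun K : Finset (Pt d) => convexHull ℝ (K : Set (Pt d))) hK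
    refine ⟨c • P, (MvPolynomial.totalDegree_smul_le c P).trans hP, ?_⟩
    filter_upwards [hP', ae_mono (Measure.restrict_mono hsub le_rfl)
      (Lp.coeFn_smul c v.1)] with x h1 h3
    simp only [val] at h1 ⊢
    rw [MvPolynomial.smul_eval, ← h1]
    simpa using h3

/-- The space `V_h` of periodic piecewise quadratic functions in `H¹`. -/
abbrev Vh {d : ℕ} {a : Pt d} {L : ℝ} (M : PeriodicMesh d a L) : Submodule ℝ (L2Pair a L) :=
  FE M 2

/-- Pairs whose function has zero average over the cube. -/
def zeroMean {d : ℕ} (a : Pt d) (L : ℝ) : Submodule ℝ (L2Pair a L) where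
  carrier := {w | ∫ x in cube a L, val w x = 0}
  zero_mem' := by
    refine integral_eq_zero_of_ae ?_
    filter_upwards [Lp.coeFn_zero ℝ 2 (volume.restrict (cube a L))] with x hx
    simpa [val] using hx
  add_mem' := by
    intro v w hv hw
    have h : ∫ x in cube a L, val (v + w) x
        = (∫ x in cube a L, val v x) + ∫ x in cube a L, val w x := by
      have hi : ∀ z : L2Pair a L, Integrable (val z) (volume.restrict (cube a L)) :=
        fun z => (Lp.memLp z.1).integrable (by norm_num)
      rw [← integral_add (hi v) (hi w)]
      refine integral_congr_ae ?_
      filter_upwards [Lp.coeFn_add v.1 w.1] with x hx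
      simpa [val] using hx
    simp only [mem_ofPred_eq] at hv hw ⊢
    rw [h, hv, hw, add_zero]
  smul_mem' := by
    intro c v hv
    have h : ∫ x in cube a L, val (c • v) x = c * ∫ x in cube a L, val v x := by
      rw [← integral_const_mul]
      refine integral_congr_ae ?_
      filter_upwards [Lp.coeFn_smul c v.1] with x hx
      simpa [val] using hx
    simp only [mem_ofPred_eq] at hv ⊢
    rw [h, hv, mul_zero]

/-- The space `Q_h` of periodic piecewise linear functions in `H¹` with zero average. -/
abbrev Qh {d : ℕ} {a : Pt d} {L : ℝ} (M : PeriodicMesh d a L) : Submodule ℝ (L2Pair a L) :=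
  FE M 1 ⊓ zeroMean a L

/-! ### Vector fields, scalar products and forms -/

/-- Vector fields, given by their components together with the gradients of the components. -/
abbrev VecPair {d : ℕ} (a : Pt d) (L : ℝ) : Type := Fin d → L2Pair a L

/-- The vector field underlying an element of `VecPair`. -/
def vec {d : ℕ} {a : Pt d} {L : ℝ} (u : VecPair a L) (x : Pt d) : Pt d :=
  WithLp.toLp 2 fun i => val (u i) x

/-- The divergence `∑ i, ∂ᵢ uᵢ`. -/
def divg {d : ℕ} {a : Pt d} {L : ℝ} (u : VecPair a L) (x : Pt d) : ℝ :=
  ∑ i, grad (u i) x i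

/-- The product `∇u : ∇v = ∑ i, ∇uᵢ ⬝ ∇vᵢ`. -/
def gradDot {d : ℕ} {a : Pt d} {L : ℝ} (u v : VecPair a L) (x : Pt d) : ℝ :=
  ∑ i, inner ℝ (grad (u i) x) (grad (v i) x)

/-- The convective derivative `u ⬝ ∇v`, with components `u ⬝ ∇vᵢ`. -/
def convect {d : ℕ} {a : Pt d} {L : ℝ} (u v : VecPair a L) (x : Pt d) : Pt d :=
  WithLp.toLp 2 fun i => inner ℝ (vec u x) (grad (v i) x)

/-- The `L²` scalar product of scalar functions on the cube. -/
def ipS {d : ℕ} (a : Pt d) (L : ℝ) (F G : Pt d → ℝ) : ℝ :=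
  ∫ x in cube a L, F x * G x

/-- The `L²` scalar product of vector fields on the cube. -/
def ipV {d : ℕ} (a : Pt d) (L : ℝ) (F G : Pt d → Pt d) : ℝ :=
  ∫ x in cube a L, inner ℝ (F x) (G x)

/-- The skew-symmetric form `½ (⟨u ⬝ ∇v, w⟩ - ⟨v, u ⬝ ∇w⟩)`. -/
def skw {d : ℕ} {a : Pt d} {L : ℝ} (u v w : VecPair a L) : ℝ :=
  (1 / 2) * (ipV a L (convect u v) (vec w) - ipV a L (vec v) (convect u w))

/-- The free energy. -/
def energy {d : ℕ} {a : Pt d} {L : ℝ} (γ : ℝ) (f : ℝ → ℝ) (φ : L2Pair a L)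
    (u : VecPair a L) : ℝ :=
  ∫ x in cube a L, (γ / 2 * ‖grad φ x‖ ^ 2 + f (val φ x) + 1 / 2 * ‖vec u x‖ ^ 2)

/-- The dissipation functional `D_φ(μ, u)`. -/
def dissipation {d : ℕ} {a : Pt d} {L : ℝ} (b η : ℝ → ℝ) (φ μ : L2Pair a L)
    (u : VecPair a L) : ℝ :=
  ∫ x in cube a L, (b (val φ x) * ‖grad μ x‖ ^ 2 + η (val φ x) * gradDot u u x)

/-! ### Projections of the initial data -/

/-- `w` is the `H¹`-orthogonal projection of `v` to `V_h`. -/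
def IsH1Proj {d : ℕ} {a : Pt d} {L : ℝ} (M : PeriodicMesh d a L) (v w : L2Pair a L) : Prop :=
  w ∈ Vh M ∧ ∀ z ∈ Vh M,
    ipS a L (val (w - v)) (val z) + ipV a L (grad (w - v)) (grad z) = 0

/-- Membership in the space `Z_h` of discretely divergence free fields in `V_h^d`. -/
def IsDiscDivFree {d : ℕ} {a : Pt d} {L : ℝ} (M : PeriodicMesh d a L) (v : VecPair a L) : Prop :=
  (∀ i, v i ∈ Vh M) ∧ ∀ q ∈ Qh M, ipS a L (divg v) (val q) = 0

/-- `w` is the modified Stokes projection of `v`, that is, its `H¹`-orthogonal projection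
to `Z_h`. -/
def IsStokesProj {d : ℕ} {a : Pt d} {L : ℝ} (M : PeriodicMesh d a L) (v w : VecPair a L) : Prop :=
  IsDiscDivFree M w ∧ ∀ z : VecPair a L, IsDiscDivFree M z →
    ipV a L (vec (v - w)) (vec z) + ∫ x in cube a L, gradDot (v - w) z x = 0

/-! ### Time discretization -/

/-- The node `tⁿ = n T / N` of the uniform grid with `N` steps on `[0, T]`. -/
def node (T : ℝ) (N n : ℕ) : ℝ := n * (T / N)

/-- Functions on the time grid with values in `X`, whose restriction to each of the open grid
intervals is a polynomial of degree at most `k`. -/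
def IsPiecewisePoly {X : Type*} [AddCommGroup X] [Module ℝ X] (T : ℝ) (N k : ℕ)
    (w : ℝ → X) : Prop :=
  ∀ n < N, ∃ c : ℕ → X, ∀ t ∈ Ioo (node T N n) (node T N (n + 1)),
    w t = ∑ j ∈ Finset.range (k + 1), t ^ j • c j

/-- Continuous piecewise polynomials of degree at most `k` on the time grid. -/
def IsContPiecewisePoly {X : Type*} [NormedAddCommGroup X] [NormedSpace ℝ X] (T : ℝ) (N k : ℕ)
    (w : ℝ → X) : Prop :=
  IsPiecewisePoly T N k w ∧ ContinuousOn w (Icc 0 T)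

/-- The `L²(0,T)`-orthogonal projection to piecewise constant functions on the time grid: on each
grid interval, the mean value over this interval. -/
def timeProj {X : Type*} [NormedAddCommGroup X] [NormedSpace ℝ X] (T : ℝ) (N : ℕ)
    (w : ℝ → X) (t : ℝ) : X :=
  (T / N)⁻¹ • ∫ s in (⌊t / (T / N)⌋ * (T / N))..((⌊t / (T / N)⌋ + 1) * (T / N)), w s

/-- The integral over the time interval from node `n` to node `n + 1`. -/
def slab (T : ℝ) (N n : ℕ) (F : ℝ → ℝ) : ℝ :=
  ∫ s in (node T N n)..(node T N (n + 1)), F s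

/-- The equations of the space-time Petrov-Galerkin scheme, without initial conditions. The unknowns
are the phase fraction `φ`, chemical potential `μ`, velocity `u` and pressure `p`. -/
structure IsSchemeSolution {d : ℕ} {a : Pt d} {L : ℝ} (M : PeriodicMesh d a L) (T : ℝ) (N : ℕ)
    (γ : ℝ) (b f η : ℝ → ℝ) (φ μ : ℝ → Vh M) (u : ℝ → Fin d → Vh M) (p : ℝ → Qh M) : Prop where
  phi_mem : IsContPiecewisePoly T N 1 φ
  mu_mem : IsPiecewisePoly T N 0 μ
  u_mem : IsContPiecewisePoly T N 1 u
  p_mem : IsPiecewisePoly T N 0 p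
  phase : ∀ ψ : ℝ → Vh M, IsPiecewisePoly T N 0 ψ → ∀ n < N,
    slab T N n (fun s => ipS a L (val ((deriv φ s : Vh M) : L2Pair a L)) (val (ψ s : L2Pair a L)))
      = slab T N n (fun s => ipV a L
          (fun x => val (φ s : L2Pair a L) x
            • vec (timeProj T N (fun r i => (u r i : L2Pair a L)) s) x)
          (grad (ψ s : L2Pair a L)))
        - slab T N n (fun s => ipV a L
          (fun x => b (val (timeProj T N (fun r => (φ r : L2Pair a L)) s) x)
            • grad (μ s : L2Pair a L) x)
          (grad (ψ s : L2Pair a L)))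
  potential : ∀ ξ : ℝ → Vh M, IsPiecewisePoly T N 0 ξ → ∀ n < N,
    slab T N n (fun s => ipS a L (val (μ s : L2Pair a L)) (val (ξ s : L2Pair a L)))
      = γ * slab T N n (fun s => ipV a L (grad (φ s : L2Pair a L)) (grad (ξ s : L2Pair a L)))
        + slab T N n (fun s => ipS a L
          (fun x => deriv f (val (φ s : L2Pair a L) x)) (val (ξ s : L2Pair a L)))
  momentum : ∀ v : ℝ → Fin d → Vh M, IsPiecewisePoly T N 0 v → ∀ n < N,
    slab T N n (fun s => ipV a L
        (vec fun i => ((deriv u s i : Vh M) : L2Pair a L)) (vec fun i => (v s i : L2Pair a L)))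
      = - slab T N n (fun s => skw
          (fun i => (u s i : L2Pair a L))
          (timeProj T N (fun r i => (u r i : L2Pair a L)) s)
          (fun i => (v s i : L2Pair a L)))
        - slab T N n (fun s => ∫ x in cube a L,
          η (val (timeProj T N (fun r => (φ r : L2Pair a L)) s) x)
            * gradDot (timeProj T N (fun r i => (u r i : L2Pair a L)) s)
                (fun i => (v s i : L2Pair a L)) x)
        + slab T N n (fun s => ipS a L (val (p s : L2Pair a L))
          (divg fun i => (v s i : L2Pair a L)))
        - slab T N n (fun s => ipV a L
          (fun x => val (φ s : L2Pair a L) x • vec (fun i => (v s i : L2Pair a L)) x)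
          (grad (μ s : L2Pair a L)))
  incompressible : ∀ q : ℝ → Qh M, IsPiecewisePoly T N 0 q → ∀ n < N,
    slab T N n (fun s => ipS a L
      (divg fun i => (u s i : L2Pair a L)) (val (q s : L2Pair a L))) = 0

/-- Solutions of the discrete problem: the equations of the scheme together with the
initial conditions. -/
structure IsDiscreteSolution {d : ℕ} {a : Pt d} {L : ℝ} (M : PeriodicMesh d a L) (T : ℝ) (N : ℕ)
    (γ : ℝ) (b f η : ℝ → ℝ) (φ₀ : L2Pair a L) (u₀ : VecPair a L)
    (φ μ : ℝ → Vh M) (u : ℝ → Fin d → Vh M) (p : ℝ → Qh M) : Prop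
    extends IsSchemeSolution M T N γ b f η φ μ u p where
  phi_init : IsH1Proj M φ₀ (φ 0 : L2Pair a L)
  u_init : IsStokesProj M u₀ (fun i => (u 0 i : L2Pair a L))

/-! ### Assumptions on the coefficients -/

/-- Assumptions on the mobility and the viscosity: twice continuously differentiable, bounded from
above and below by positive constants, with bounded first and second derivative. -/
def CoefficientAssumption (b : ℝ → ℝ) : Prop :=
  ContDiff ℝ 2 b ∧ ∃ b₁ b₂ b₃ b₄ : ℝ, 0 < b₁ ∧
    ∀ s, b₁ ≤ b s ∧ b s ≤ b₂ ∧ |deriv b s| ≤ b₃ ∧ |iteratedDeriv 2 b s| ≤ b₄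

/-- Assumptions on the potential: four times continuously differentiable, nonnegative, second
derivative bounded from below, and growth of order four. -/
def PotentialAssumption (f : ℝ → ℝ) : Prop :=
  ContDiff ℝ 4 f ∧ (∀ s, 0 ≤ f s) ∧ (∃ f₁ : ℝ, 0 ≤ f₁ ∧ ∀ s, -f₁ ≤ iteratedDeriv 2 f s) ∧
    ∃ f₂ f₃ : ℕ → ℝ, ∀ k ≤ 4, ∀ s, |iteratedDeriv k f s| ≤ f₂ k + f₃ k * |s| ^ (4 - k)

end CHNS

end

open CHNS

/-! On each time slab the test functions are constant in time while the phase fraction and the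
velocity are affine, so the scheme reduces to one nonlinear finite-dimensional system per slab,
`GradientModel.IsStep`. Every integrand except the potential term is constant or affine in time, so
only the nodal values and their midpoint enter. The potential term becomes the mean of f' over the
segment between the two nodal values, `segmentMean`.

Balance laws. Test the phase equation with the chemical potential, the potential equation with the
increment of the phase fraction, and the momentum equation with the midpoint velocity. The mean of
f' times the increment is exactly f(φ₁) - f(φ₀), the gradient and kinetic terms are differences of
squares, the convective form vanishes by skew-symmetry, the transport and capillary terms cancel,
and the pressure meets a discretely divergence-free field. This is `GradientModel.IsStep.energy_eq`.
Testing the phase equation with the constant 1 gives conservation of mass. Both identities are then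
summed over the slabs.

Existence. The unknowns of a step are the increment δ of the phase fraction, the chemical potential
μ and the midpoint velocity v. The same choice of test functions shows that the residual paired with
its own argument is at least a quadratic form minus a constant (`GradientModel.residual_self_ge`),
where f ≥ 0 controls the potential. The quadratic form does not see functions without gradient, so δ
and μ are sought in the mass-orthogonal complement of these, and v among the discretely
divergence-free fields; there the form is positive definite. A continuous coercive map in finite
dimensions has a zero (`exists_dual_eq_zero`, a form of Brouwer's theorem). The missing component of
μ and the pressure are recovered afterwards by linear algebra.

The analytic input is that the finite element space is finite-dimensional and has representatives
depending linearly on the function at every point, with bounded values and square integrable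
gradients (`finiteDimensional_FE`, `exists_gradientModel`). All forms of the scheme are then finite
and continuous in the unknowns. -/

open CHNS

/-! ### Zeros of coercive maps in finite dimensions -/

section Brouwer

variable {E : Type*} [NormedAddCommGroup E] [InnerProductSpace ℝ E] [FiniteDimensional ℝ E]

/-- In a basis this is the determinant of a matrix with entries of degree at most one in t. The
degree bound allows the determinant at t = 1 to be recovered from finitely many small values of t.
-/
theorem exists_polynomial_det_one_add_smul (A : E →L[ℝ] E) :
    ∃ p : Polynomial ℝ, p.natDegree ≤ Module.finrank ℝ E ∧
      ∀ t : ℝ, p.eval t = (1 + t • A).det := by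
  classical
  let b := Module.finBasis ℝ E
  let A' := LinearMap.toMatrix b b A.toLinearMap
  let I : Matrix (Fin (Module.finrank ℝ E)) (Fin (Module.finrank ℝ E)) ℝ := 1
  refine ⟨((Polynomial.X : Polynomial ℝ) • A'.map (Polynomial.C : ℝ →+* Polynomial ℝ)
    + I.map (Polynomial.C : ℝ →+* Polynomial ℝ)).det, ?_, ?_⟩
  · simpa using Polynomial.natDegree_det_X_add_C_le A' I
  · intro t
    rw [← Polynomial.coe_evalRingHom, RingHom.map_det, ContinuousLinearMap.det,
      ← LinearMap.det_toMatrix b]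
    congr 1
    ext i j
    simp [A', I, RingHom.mapMatrix_apply, Matrix.map_apply, Matrix.one_apply, LinearMap.toMatrix_apply,
      Finsupp.single_apply, add_comm, eq_comm]
    by_cases h : i = j <;> simp [h, mul_comm]

/-- A kernel vector of 1 + sA would satisfy ‖v‖ ≤ s‖A‖‖v‖ < ‖v‖, so the determinant has no zero for
s in [0, t]. It equals 1 at s = 0 and is continuous, hence stays positive. -/
theorem det_one_add_smul_pos {A : E →L[ℝ] E} {t : ℝ} (ht : 0 ≤ t) (h : t * ‖A‖ < 1) :
    0 < (1 + t • A).det := by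
  have hne : ∀ s ∈ Icc (0 : ℝ) t, (1 + s • A).det ≠ 0 := by
    intro s hs h0
    have hs1 : s * ‖A‖ < 1 := lt_of_le_of_lt (mul_le_mul_of_nonneg_right hs.2 (norm_nonneg _)) h
    obtain ⟨v, hv0, hv⟩ : ∃ v : E, v ≠ 0 ∧ (1 + s • A) v = 0 := by
      have := LinearMap.bot_lt_ker_of_det_eq_zero (f := (1 + s • A).toLinearMap) h0
      obtain ⟨v, hv, hv0⟩ := Submodule.exists_mem_ne_zero_of_ne_bot this.ne'
      exact ⟨v, hv0, hv⟩
    have h1 : v = -(s • A v) := by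
      have : v + s • A v = 0 := by simpa using hv
      exact eq_neg_of_add_eq_zero_left this
    have h2 : ‖v‖ ≤ s * ‖A‖ * ‖v‖ := by
      calc ‖v‖ = ‖s • A v‖ := by rw [← norm_neg (s • A v), ← h1]
        _ = s * ‖A v‖ := by rw [norm_smul, Real.norm_of_nonneg hs.1]
        _ ≤ s * (‖A‖ * ‖v‖) := mul_le_mul_of_nonneg_left (A.le_opNorm v) hs.1
        _ = _ := by ring
    have : 0 < ‖v‖ := norm_pos_iff.2 hv0
    nlinarith
  obtain ⟨p, -, hp⟩ := exists_polynomial_det_one_add_smul A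
  by_contra hneg
  have hc : ContinuousOn (fun s => p.eval s) (Icc 0 t) := p.continuous.continuousOn
  have h0 : p.eval 0 = 1 := by
    rw [hp]; simp [ContinuousLinearMap.det]
  have hmem : (0 : ℝ) ∈ Icc (p.eval t) (p.eval 0) :=
    ⟨by rw [hp]; exact not_lt.1 hneg, by rw [h0]; exact zero_le_one⟩
  obtain ⟨s, hs, hs0⟩ := intermediate_value_Icc' ht hc hmem
  exact hne s hs (by rw [← hp]; exact hs0)

/-- There is no continuously differentiable retraction of a ball to its boundary. -/
theorem not_exists_retraction_sphere {r : E → E} (hr : ContDiff ℝ 1 r) {R : ℝ} (hR : 0 < R)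
    (hnorm : ∀ x, ‖r x‖ = R) (hfix : ∀ x, ‖x‖ = R → r x = x) : False := by
  classical
  borelize E
  set B := Metric.ball (0 : E) R with hB
  set K := Metric.closedBall (0 : E) R with hK
  -- Deform the identity to r by `F t`, whose derivative is 1 + tD. For small t this maps the ball
  -- bijectively to itself, so the integral of the determinant is the volume of the ball. The
  -- integral is polynomial in t, so the same holds at t = 1, where the derivative is that of r and
  -- is singular everywhere: a contradiction.
  let D : E → E →L[ℝ] E := fun x => fderiv ℝ r x - 1
  have hDc : Continuous D := (hr.continuous_fderiv (by simp)).sub continuous_const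
  have hrd : ∀ x, HasStrictFDerivAt r (fderiv ℝ r x) x := fun x =>
    hr.contDiffAt.hasStrictFDerivAt (by simp)
  obtain ⟨C, hC⟩ : ∃ C, ∀ x ∈ K, ‖D x‖ ≤ C :=
    (isCompact_closedBall (0 : E) R).exists_bound_of_continuousOn hDc.continuousOn
  have hC0 : 0 ≤ C := (norm_nonneg _).trans (hC 0 (by simp [hK, hR.le]))
  let F : ℝ → E → E := fun t x => x + t • (r x - x)
  have hF : ∀ t x, HasStrictFDerivAt (F t) (1 + t • D x) x := fun t x => by
    have := (hasStrictFDerivAt_id x).add (((hrd x).sub (hasStrictFDerivAt_id x)).const_smul t)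
    exact this
  have hFfix : ∀ t x, ‖x‖ = R → F t x = x := fun t x hx => by simp [F, hfix x hx]
  have hlip : LipschitzOnWith ⟨C, hC0⟩ (fun x => r x - x) K := by
    have hd : ∀ x, HasFDerivAt (fun x => r x - x) (D x) x := fun x =>
      ((hrd x).sub (hasStrictFDerivAt_id x)).hasFDerivAt
    refine Convex.lipschitzOnWith_of_nnnorm_fderiv_le (𝕜 := ℝ)
      (fun x _ => (hd x).differentiableAt) (fun x hx => ?_) (convex_closedBall 0 R)
    rw [(hd x).fderiv]
    exact hC x hx
  -- for small `t`, the map `F t` is a diffeomorphism of the ball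
  have hsmall : ∀ t : ℝ, 0 < t → t * (C + 1) < 1 →
      ∫ x in B, (1 + t • D x).det = (volume : Measure E).real B := by
    intro t ht ht1
    have htC : t * C < 1 := by nlinarith
    have ht' : t < 1 := by nlinarith
    have hpos : ∀ x ∈ K, 0 < (1 + t • D x).det := fun x hx =>
      det_one_add_smul_pos ht.le
        (lt_of_le_of_lt (mul_le_mul_of_nonneg_left (hC x hx) ht.le) htC)
    have hinj : InjOn (F t) K := by
      intro x hx y hy hxy
      have h1 : x - y = -(t • ((r x - x) - (r y - y))) := by
        have : x + t • (r x - x) = y + t • (r y - y) := hxy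
        rw [smul_sub t (r x - x), neg_sub, sub_eq_sub_iff_add_eq_add, this, add_comm]
      have h2 : ‖x - y‖ ≤ t * C * ‖x - y‖ := by
        calc ‖x - y‖ = t * ‖(r x - x) - (r y - y)‖ := by
              rw [h1, norm_neg, norm_smul, Real.norm_of_nonneg ht.le]
          _ ≤ t * (C * ‖x - y‖) := by
              refine mul_le_mul_of_nonneg_left ?_ ht.le
              have := hlip.norm_sub_le hx hy
              exact this
          _ = _ := by ring
      by_contra hne
      have : 0 < ‖x - y‖ := norm_pos_iff.2 (sub_ne_zero.2 hne)
      nlinarith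
    have hmaps : ∀ x ∈ B, F t x ∈ B := by
      intro x hx
      have hx' : ‖x‖ < R := by simpa [hB] using hx
      have : F t x = (1 - t) • x + t • r x := by simp only [F]; module
      have h3 : ‖F t x‖ ≤ (1 - t) * ‖x‖ + t * R := by
        rw [this]
        refine (norm_add_le _ _).trans ?_
        rw [norm_smul, norm_smul, hnorm, Real.norm_of_nonneg ht.le,
          Real.norm_of_nonneg (by linarith)]
      have : ‖F t x‖ < R := by nlinarith
      simpa [hB] using this
    have hopen : IsOpen (F t '' B) := by
      rw [isOpen_iff_mem_nhds]
      rintro _ ⟨x, hx, rfl⟩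
      have hsurj : ((1 + t • D x : E →L[ℝ] E) : E →ₗ[ℝ] E).range = ⊤ := by
        have h0 := (hpos x (Metric.ball_subset_closedBall hx)).ne'
        exact LinearMap.range_eq_top.2
          (LinearMap.equivOfDetNeZero ((1 + t • D x : E →L[ℝ] E) : E →ₗ[ℝ] E) h0).surjective
      rw [← (hF t x).map_nhds_eq_of_surj hsurj]
      exact Filter.image_mem_map (Metric.isOpen_ball.mem_nhds hx)
    have hcont : Continuous (F t) := by
      have := hr.continuous
      fun_prop
    -- Surjectivity by connectedness: the image of the open ball is open, and the image of the
    -- closed ball is closed. The two differ inside the open ball by nothing, because points of the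
    -- sphere are fixed.
    have himage : F t '' B = B := by
      refine Subset.antisymm (by rintro _ ⟨x, hx, rfl⟩; exact hmaps x hx) ?_
      have hclosed : IsClosed (F t '' K) := ((isCompact_closedBall _ _).image hcont).isClosed
      have hsub : B ⊆ F t '' B ∪ (F t '' K)ᶜ := by
        intro y hy
        by_cases hyK : y ∈ F t '' K
        · left
          obtain ⟨x, hx, rfl⟩ := hyK
          refine ⟨x, ?_, rfl⟩
          by_contra hxB
          have hxR : ‖x‖ = R := by
            have h1 : ‖x‖ ≤ R := by simpa [hK] using hx
            have h2 : R ≤ ‖x‖ := by simpa [hB] using hxB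
            exact le_antisymm h1 h2
          rw [hFfix t x hxR] at hy
          exact hxB hy
        · exact Or.inr hyK
      refine IsPreconnected.subset_left_of_subset_union hopen hclosed.isOpen_compl ?_ hsub
        ⟨F t 0, hmaps 0 (by simp [hB, hR]), 0, by simp [hB, hR], rfl⟩
        (convex_ball (0 : E) R).isPreconnected
      rw [Set.disjoint_compl_right_iff_subset]
      exact image_mono Metric.ball_subset_closedBall
    have hcv := integral_image_eq_integral_abs_det_fderiv_smul (volume : Measure E)
      (Metric.isOpen_ball (x := (0 : E)) (ε := R)).measurableSet
      (fun x _ => (hF t x).hasFDerivAt.hasFDerivWithinAt)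
      (hinj.mono Metric.ball_subset_closedBall) (fun _ => (1 : ℝ))
    rw [himage] at hcv
    simp only [integral_const, MeasurableSet.univ, measureReal_restrict_apply, univ_inter,
      smul_eq_mul, mul_one] at hcv
    rw [hcv]
    refine setIntegral_congr_fun Metric.isOpen_ball.measurableSet fun x hx => ?_
    rw [abs_of_pos (hpos x (Metric.ball_subset_closedBall hx))]
  -- polynomial identity in `t`
  choose p hpdeg hp using fun x => exists_polynomial_det_one_add_smul (D x)
  set n := Module.finrank ℝ E
  -- Distinct nodes in the range of t covered by `hsmall`. With n + 1 of them, Lagrange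
  -- interpolation is exact for polynomials of degree at most n, in particular at t = 1.
  let v : ℕ → ℝ := fun i => (1 / (C + 1)) * (1 / ((i : ℝ) + 2))
  have hvpos : ∀ i, 0 < v i := fun i => by positivity
  have hv1 : ∀ i, v i * (C + 1) < 1 := fun i => by
    have : v i * (C + 1) = 1 / ((i : ℝ) + 2) := by simp only [v]; field_simp
    rw [this, div_lt_one (by positivity)]
    have : (0 : ℝ) ≤ i := i.cast_nonneg
    linarith
  have hvinj : InjOn v (Finset.range (n + 1) : Set ℕ) := by
    intro i _ j _ hij
    have h1 : (1 : ℝ) / ((i : ℝ) + 2) = 1 / ((j : ℝ) + 2) :=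
      mul_left_cancel₀ (by positivity) hij
    have h2 : (i : ℝ) + 2 = j + 2 := by
      have := congrArg (fun z : ℝ => 1 / z) h1
      simpa using this
    exact_mod_cast add_right_cancel h2
  have hint : ∀ t : ℝ, IntegrableOn (fun x => (1 + t • D x).det) B := by
    intro t
    have hc : Continuous (fun x => (1 + t • D x).det) :=
      ContinuousLinearMap.continuous_det.comp (by fun_prop)
    exact (hc.continuousOn.integrableOn_compact (isCompact_closedBall (0 : E) R)).mono_set
      Metric.ball_subset_closedBall
  have hone : ∫ x in B, (1 + (1 : ℝ) • D x).det = (volume : Measure E).real B := by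
    have hpt : ∀ x, (1 + (1 : ℝ) • D x).det = ∑ i ∈ Finset.range (n + 1),
        (Lagrange.basis (Finset.range (n + 1)) v i).eval 1 * (1 + v i • D x).det := by
      intro x
      have hdeg : (p x).degree < (Finset.range (n + 1)).card := by
        rw [Finset.card_range]
        exact lt_of_le_of_lt Polynomial.degree_le_natDegree
          (by exact_mod_cast Nat.lt_succ_of_le (hpdeg x))
      rw [← hp, Lagrange.eq_interpolate hvinj hdeg, Lagrange.interpolate_apply,
        Polynomial.eval_finsetSum]
      refine Finset.sum_congr rfl fun i _ => ?_
      rw [Polynomial.eval_mul, Polynomial.eval_C, hp, mul_comm]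
    have hsum : ∑ i ∈ Finset.range (n + 1),
        (Lagrange.basis (Finset.range (n + 1)) v i).eval 1 = 1 := by
      rw [← Polynomial.eval_finsetSum, Lagrange.sum_basis hvinj (by simp), Polynomial.eval_one]
    rw [integral_congr_ae (.of_forall hpt),
      integral_finsetSum _ fun i _ => (hint (v i)).const_mul _]
    simp_rw [integral_const_mul, hsmall (v _) (hvpos _) (hv1 _)]
    rw [← Finset.sum_mul, hsum, one_mul]
  -- Since ‖r‖² is constant, the range of the derivative of r at x is orthogonal to r x ≠ 0, so the
  -- derivative is not surjective.
  have hzero : ∀ x, (1 + (1 : ℝ) • D x).det = 0 := by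
    intro x
    by_contra hne
    have hsurj := (LinearMap.equivOfDetNeZero
      ((1 + (1 : ℝ) • D x : E →L[ℝ] E) : E →ₗ[ℝ] E) hne).surjective
    obtain ⟨w, hw⟩ := hsurj (r x)
    have hw' : fderiv ℝ r x w = r x := by
      have : (1 + (1 : ℝ) • D x) w = r x := hw
      simpa [D] using this
    have h1 : HasFDerivAt (fun y => ‖r y‖ ^ 2) (2 • (innerSL ℝ (r x)).comp (fderiv ℝ r x)) x :=
      (hrd x).hasFDerivAt.norm_sq
    have h2 : HasFDerivAt (fun y => ‖r y‖ ^ 2) (0 : E →L[ℝ] ℝ) x := by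
      simp_rw [hnorm]; exact hasFDerivAt_const _ _
    have h3 := congrArg (fun A : E →L[ℝ] ℝ => A w) (h1.unique h2)
    simp only [smul_apply, ContinuousLinearMap.comp_apply, hw',
      innerSL_apply_apply, real_inner_self_eq_norm_sq, hnorm, zero_apply] at h3
    have : (0 : ℝ) < R ^ 2 := by positivity
    simp at h3
    exact hR.ne' h3
  rw [integral_congr_ae (Filter.Eventually.of_forall hzero), integral_zero] at hone
  have : 0 < (volume : Measure E).real B :=
    ENNReal.toReal_pos (Metric.measure_ball_pos _ _ hR).ne' measure_ball_lt_top.ne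
  exact this.ne hone

/-- A continuously differentiable vector field pointing outwards far away has a zero. -/
theorem exists_zero_of_contDiff {F : E → E} (hF : ContDiff ℝ 1 F) {R : ℝ} (hR : 0 < R)
    (hpos : ∀ x, R ≤ ‖x‖ → ‖x‖ ≤ R + 1 → 0 < inner ℝ (F x) x) : ∃ x, ‖x‖ ≤ R ∧ F x = 0 := by
  by_contra! hne
  let χ : ContDiffBump (0 : E) := ⟨R, R + 1, hR, by linarith⟩
  -- `G` is F on the ball of radius R and the identity outside radius R + 1. In between both
  -- summands point outwards, so `G` has no zero if F has none in the ball, and rescaling it to norm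
  -- R + 1 gives a forbidden retraction.
  let G : E → E := fun x => χ x • F x + (1 - χ x) • x
  have hG : ContDiff ℝ 1 G :=
    (χ.contDiff.smul hF).add ((contDiff_const.sub χ.contDiff).smul contDiff_id)
  have hG0 : ∀ x, G x ≠ 0 := by
    intro x
    rcases le_or_gt ‖x‖ R with h | h
    · have h1 : χ x = 1 := χ.one_of_mem_closedBall (by simpa [χ] using h)
      simpa [G, h1] using hne x h
    · have hx : 0 < ‖x‖ := hR.trans h
      intro h0
      have h1 : inner ℝ (G x) x = χ x * inner ℝ (F x) x + (1 - χ x) * ‖x‖ ^ 2 := by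
        simp only [G, inner_add_left, real_inner_smul_left, real_inner_self_eq_norm_sq]
      rw [h0, inner_zero_left] at h1
      rcases le_or_gt ‖x‖ (R + 1) with h2 | h2
      · have h3 := hpos x h.le h2
        have h4 : 0 ≤ χ x := χ.nonneg
        have h5 : χ x ≤ 1 := χ.le_one
        have h6 : 0 < ‖x‖ ^ 2 := by positivity
        rcases eq_or_lt_of_le h4 with h7 | h7
        · rw [← h7] at h1; nlinarith
        · nlinarith [mul_pos h7 h3, mul_nonneg (sub_nonneg.2 h5) h6.le]
      · have h3 : χ x = 0 := χ.zero_of_le_dist (by simpa [χ] using h2.le)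
        rw [h3] at h1
        have h6 : 0 < ‖x‖ ^ 2 := by positivity
        nlinarith
  have hG1 : ∀ x, ‖x‖ = R + 1 → G x = x := by
    intro x hx
    have h3 : χ x = 0 := χ.zero_of_le_dist (by simp [χ, hx])
    simp [G, h3]
  refine not_exists_retraction_sphere (r := fun x => ((R + 1) / ‖G x‖) • G x) ?_
    (show 0 < R + 1 by linarith) ?_ ?_
  · exact (contDiff_const.div (hG.norm ℝ hG0) fun x => norm_ne_zero_iff.2 (hG0 x)).smul hG
  · intro x
    have := norm_ne_zero_iff.2 (hG0 x)
    rw [norm_smul, norm_div, norm_norm, Real.norm_of_nonneg (by linarith), div_mul_cancel₀ _ this]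
  · intro x hx
    simp only [hG1 x hx, hx]
    rw [div_self (by linarith), one_smul]

/-- Smooth approximation. By compactness the outward condition holds with a uniform margin δ on the
shell between R and R + 1, so a close smooth map still points outwards and has a zero y in the ball.
There ‖F y‖ is below the approximation error, which contradicts a positive minimum of ‖F‖ on the
ball. -/
theorem exists_zero_of_continuous {F : E → E} (hF : Continuous F) {R : ℝ} (hR : 0 < R)
    (hpos : ∀ x, R ≤ ‖x‖ → 0 < inner ℝ (F x) x) : ∃ x, F x = 0 := by
  obtain ⟨x, hx, hmin⟩ := (isCompact_closedBall (0 : E) R).exists_isMinOn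
    ⟨0, by simp [hR.le]⟩ hF.norm.continuousOn
  refine ⟨x, ?_⟩
  by_contra hne
  have hS : IsCompact (Metric.closedBall (0 : E) (R + 1) \ Metric.ball 0 R) :=
    (isCompact_closedBall _ _).diff Metric.isOpen_ball
  obtain ⟨δ, hδ, hδle⟩ : ∃ δ > 0, ∀ y, R ≤ ‖y‖ → ‖y‖ ≤ R + 1 → δ ≤ inner ℝ (F y) y := by
    rcases (Metric.closedBall (0 : E) (R + 1) \ Metric.ball 0 R).eq_empty_or_nonempty with h | h
    · refine ⟨1, one_pos, fun y h1 h2 => absurd (show y ∈ (∅ : Set E) from h ▸ ⟨?_, ?_⟩) (by simp)⟩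
      · simpa using h2
      · simpa using h1
    · obtain ⟨z, hz, hzmin⟩ := hS.exists_isMinOn h
        (f := fun y => inner ℝ (F y) y) (by fun_prop)
      refine ⟨inner ℝ (F z) z, hpos z (by simpa using hz.2), fun y h1 h2 => hzmin ⟨?_, ?_⟩⟩
      · simpa using h2
      · simpa using h1
  have hxpos : 0 < ‖F x‖ := norm_pos_iff.2 hne
  let ε : ℝ := min ‖F x‖ (δ / (R + 1))
  have hε : 0 < ε := lt_min hxpos (by positivity)
  obtain ⟨g, hg, hgF, -⟩ := hF.exists_contDiff_approx 1 (ε := fun _ => ε) continuous_const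
    fun _ => hε
  obtain ⟨y, hy, hy0⟩ := exists_zero_of_contDiff (F := g) (by exact_mod_cast hg) hR (by
    intro y h1 h2
    have h3 := hδle y h1 h2
    have h4 : inner ℝ (g y) y = inner ℝ (F y) y + inner ℝ (g y - F y) y := by
      rw [← inner_add_left]; congr 1; abel
    have h5 : |inner ℝ (g y - F y) y| ≤ ‖g y - F y‖ * ‖y‖ := abs_real_inner_le_norm _ _
    have h6 : ‖g y - F y‖ < δ / (R + 1) := by
      rw [← dist_eq_norm]; exact (hgF y).trans_le (min_le_right _ _)
    have h7 : ‖g y - F y‖ * ‖y‖ < δ := by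
      have : 0 < ‖y‖ := hR.trans_le h1
      calc ‖g y - F y‖ * ‖y‖ < δ / (R + 1) * ‖y‖ := by gcongr
        _ ≤ δ / (R + 1) * (R + 1) := by gcongr
        _ = δ := by field_simp
    rw [h4]
    linarith [neg_abs_le (inner ℝ (g y - F y) y)])
  have h1 := hgF y
  rw [hy0, dist_zero_left] at h1
  have h2 : ‖F x‖ ≤ ‖F y‖ := hmin (by simpa using hy)
  linarith [h1.trans_le (min_le_left ‖F x‖ (δ / (R + 1)))]

end Brouwer

/-- A continuous family of functionals on a finite-dimensional space which is coercive on the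
diagonal has a zero. -/
theorem exists_dual_eq_zero {X : Type*} [NormedAddCommGroup X] [NormedSpace ℝ X]
    [FiniteDimensional ℝ X] (F : X → X →ₗ[ℝ] ℝ) (hF : ∀ y, Continuous fun x => F x y) {R : ℝ}
    (hpos : ∀ x, R ≤ ‖x‖ → 0 < F x x) : ∃ x, F x = 0 := by
  let n := Module.finrank ℝ X
  let e : EuclideanSpace ℝ (Fin n) ≃L[ℝ] X :=
    ContinuousLinearEquiv.ofFinrankEq (by simp [n])
  -- The norm of `X` need not come from a scalar product. Euclidean coordinates represent the
  -- functional F (e z) by a vector, and `C` compares the two norms.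
  let G : EuclideanSpace ℝ (Fin n) → EuclideanSpace ℝ (Fin n) := fun z =>
    WithLp.toLp 2 fun i => F (e z) (e (EuclideanSpace.single i 1))
  have hG : Continuous G := by
    refine (PiLp.continuous_toLp 2 _).comp (continuous_pi fun i => ?_)
    exact (hF _).comp e.continuous
  have hGi : ∀ z y, inner ℝ (G z) y = F (e z) (e y) := by
    intro z y
    have hy : y = ∑ i, y i • EuclideanSpace.single i (1 : ℝ) := by
      ext j
      simp [Finset.sum_apply, Pi.single_apply]
    conv_rhs => rw [hy]
    simp [PiLp.inner_apply, G, map_sum]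
  obtain ⟨C, hC⟩ : ∃ C > 0, ∀ z, ‖z‖ ≤ C * ‖e z‖ := by
    refine ⟨‖(e.symm : X →L[ℝ] EuclideanSpace ℝ (Fin n))‖ + 1, by positivity, fun z => ?_⟩
    have := (e.symm : X →L[ℝ] EuclideanSpace ℝ (Fin n)).le_opNorm (e z)
    simp at this
    nlinarith [norm_nonneg (e z)]
  obtain ⟨z, hz⟩ := exists_zero_of_continuous hG (R := C * (|R| + 1)) (mul_pos hC.1 (by positivity)) (by
    intro z hz
    rw [hGi]
    refine hpos _ ?_
    have := le_of_mul_le_mul_left (hz.trans (hC.2 z)) hC.1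
    linarith [le_abs_self R])
  refine ⟨e z, LinearMap.ext fun y => ?_⟩
  have := hGi z (e.symm y)
  rw [hz] at this
  simpa using this.symm

/-! ### Weak gradients on the periodic cell -/

section WeakGradient

variable {d : ℕ} {a : Pt d} {L : ℝ}

/-- The open box with lower corner `a` and side length `L`. -/
def openCube {d : ℕ} (a : Pt d) (L : ℝ) : Set (Pt d) :=
  {x | ∀ i, a i < x i ∧ x i < a i + L}

theorem isOpen_openCube : IsOpen (openCube a L) := by
  simp only [openCube, ofPred_forall, ofPred_and]
  exact isOpen_iInter_of_finite fun i => (isOpen_lt (by fun_prop) (by fun_prop)).inter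
    (isOpen_lt (by fun_prop) (by fun_prop))

theorem openCube_subset_cube : openCube a L ⊆ cube a L :=
  fun _ hx i => ⟨(hx i).1.le, (hx i).2.le⟩

theorem openCube_ae_eq_cube : openCube a L =ᵐ[volume] cube a L := by
  have h := (PiLp.volume_preserving_ofLp (Fin d)).quasiMeasurePreserving.preimage_ae_eq
    (Measure.univ_pi_Ioo_ae_eq_Icc (μ := fun _ : Fin d => (volume : Measure ℝ))
      (f := fun i => a i) (g := fun i => a i + L))
  have h1 : openCube a L = WithLp.ofLp ⁻¹'
      (Set.univ.pi fun i => Ioo (a i) (a i + L)) := by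
    ext x; simp [openCube]
  have h2 : cube a L = WithLp.ofLp ⁻¹' (Icc (fun i => a i) (fun i => a i + L)) := by
    ext x; simp [cube, Pi.le_def, forall_and]
  rw [h1, h2]
  exact h

theorem latticeVec_add (k m : Fin d → ℤ) :
    latticeVec L (k + m) = latticeVec L k + latticeVec L m := by
  ext i; simp [latticeVec, mul_add]

/-- The periodic extension of a function with compact support in the open box. -/
noncomputable def periodize {d : ℕ} (L : ℝ) (g : Pt d → ℝ) (x : Pt d) : ℝ :=
  ∑ᶠ k : Fin d → ℤ, g (x + latticeVec L k)

/-- Near any point only finitely many lattice translates meet the support, so the sum is smooth;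
shifting the summation index gives periodicity. -/
theorem isPeriodicTest_periodize (hL : 0 < L) {g : Pt d → ℝ} (hg : ContDiff ℝ ∞ g)
    (hgU : Function.support g ⊆ openCube a L) : IsPeriodicTest L (periodize L g) := by
  refine ⟨?_, ?_⟩
  · rw [← contMDiff_iff_contDiff]
    refine contMDiff_finsum (fun k => ?_) ?_
    · rw [contMDiff_iff_contDiff]
      exact hg.comp (contDiff_id.add contDiff_const)
    · intro x
      refine ⟨Metric.ball x 1, Metric.ball_mem_nhds x one_pos, ?_⟩
      refine (Set.finite_Icc (fun i => ⌊(a i - x i - 1) / L⌋)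
        (fun i => ⌈(a i + L - x i + 1) / L⌉)).subset ?_
      rintro k ⟨y, hy, hyx⟩
      have hyU := hgU hy
      have hdist : ∀ i, |y i - x i| < 1 := by
        intro i
        have h1 : dist y x < 1 := hyx
        rw [dist_eq_norm] at h1
        have := (PiLp.norm_apply_le (y - x) i).trans_lt h1
        simpa using this
      refine ⟨fun i => ?_, fun i => ?_⟩
      · have h1 := (hyU i).1
        have h2 := abs_lt.1 (hdist i)
        simp only [latticeVec, PiLp.add_apply] at h1
        have : (a i - x i - 1) / L ≤ k i := by
          rw [div_le_iff₀ hL]; nlinarith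
        exact Int.cast_le.1 ((Int.floor_le _).trans this)
      · have h1 := (hyU i).2
        have h2 := abs_lt.1 (hdist i)
        simp only [latticeVec, PiLp.add_apply] at h1
        have : (k i : ℝ) ≤ (a i + L - x i + 1) / L := by
          rw [le_div_iff₀ hL]; nlinarith
        exact Int.cast_le.1 (this.trans (Int.le_ceil _))
  · intro x m
    have := finsum_comp_equiv (Equiv.addLeft m) (f := fun k => g (x + latticeVec L k))
    simp only [Equiv.coe_addLeft, latticeVec_add] at this
    simp only [periodize, add_assoc]
    exact this

theorem periodize_eq (hL : 0 < L) {g : Pt d → ℝ} (hgU : Function.support g ⊆ openCube a L)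
    {x : Pt d} (hx : x ∈ openCube a L) : periodize L g x = g x := by
  rw [periodize, finsum_eq_single _ 0]
  · congr 1; ext i; simp [latticeVec]
  · intro k hk
    by_contra hne
    have hyU := hgU hne
    apply hk
    ext i
    have h1 := hyU i
    have h2 := hx i
    simp only [latticeVec, PiLp.add_apply] at h1
    have h3 : (k i : ℝ) < 1 := by nlinarith
    have h4 : (-1 : ℝ) < k i := by nlinarith
    have h5 : k i < 1 := by exact_mod_cast h3
    have h6 : -1 < k i := by exact_mod_cast h4
    simp only [Pi.zero_apply]
    omega

/-- The weak gradient of the zero function vanishes. -/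
theorem grad_eq_zero_of_val_eq_zero (hL : 0 < L) {w : L2Pair a L} (hw : w ∈ H1per a L)
    (h0 : w.1 = 0) : w.2 = 0 := by
  -- Periodizing turns every bump function in the open cube into an admissible test function with
  -- the same values there. Hence each component of the gradient is orthogonal to all bump
  -- functions.
  have hcomp : ∀ i, ∀ᵐ x ∂(volume : Measure (Pt d)), x ∈ openCube a L → w.2 x i = 0 := by
    intro i
    have hint : IntegrableOn (fun x => w.2 x i) (cube a L) :=
      (memLp_coord w.2 i).integrable (by norm_num)
    refine isOpen_openCube.ae_eq_zero_of_integral_contDiff_smul_eq_zero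
      (hint.mono_set openCube_subset_cube).locallyIntegrableOn fun g hg _ hgU => ?_
    have hsupp : Function.support g ⊆ openCube a L := (subset_tsupport g).trans hgU
    have h1 := hw _ (isPeriodicTest_periodize hL hg hsupp) i
    have h2 : ∫ x in cube a L, w.1 x * partialDeriv i (periodize L g) x = 0 := by
      refine integral_eq_zero_of_ae ?_
      rw [h0]
      filter_upwards [Lp.coeFn_zero ℝ 2 (volume.restrict (cube a L))] with x hx
      simp only [Pi.zero_apply, mul_eq_zero]
      exact Or.inl hx
    rw [h2, eq_comm, neg_eq_zero, ← setIntegral_congr_set openCube_ae_eq_cube] at h1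
    rw [← h1, ← setIntegral_eq_integral_of_forall_compl_eq_zero (s := openCube a L)]
    · refine setIntegral_congr_fun isOpen_openCube.measurableSet fun x hx => ?_
      simp only [periodize_eq hL hsupp hx, smul_eq_mul, mul_comm]
    · intro x hx
      have : g x = 0 := by
        by_contra hne; exact hx (hsupp hne)
      simp [this]
  rw [Lp.eq_zero_iff_ae_eq_zero]
  have hae : ae (volume.restrict (cube a L)) = ae (volume.restrict (openCube a L)) := by
    rw [Measure.restrict_congr_set openCube_ae_eq_cube]
  rw [Filter.EventuallyEq, hae]
  refine (ae_restrict_iff' isOpen_openCube.measurableSet).2 ?_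
  filter_upwards [ae_all_iff.2 hcomp] with x hx hxU
  ext i
  exact hx i hxU

/-- By the divergence theorem only the two faces orthogonal to direction i contribute, and they
cancel by periodicity. This says that the constant 1 has weak gradient zero, which makes it a test
function in the phase equation. -/
theorem setIntegral_partialDeriv_eq_zero (hL : 0 < L) {ψ : Pt d → ℝ} (hψ : IsPeriodicTest L ψ)
    (i : Fin d) : ∫ x in cube a L, partialDeriv i ψ x = 0 := by
  obtain ⟨n, rfl⟩ : ∃ n, d = n + 1 := ⟨d - 1, by have := i.pos; omega⟩
  let e : (Fin (n + 1) → ℝ) ≃L[ℝ] Pt (n + 1) := (EuclideanSpace.equiv (Fin (n + 1)) ℝ).symm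
  have hcube : WithLp.toLp 2 ⁻¹' (cube a L) = Icc (fun i => a i) (fun i => a i + L) := by
    ext x; simp [cube, Pi.le_def, forall_and]
  have hcv := (PiLp.volume_preserving_toLp (Fin (n + 1))).setIntegral_preimage_emb
    (MeasurableEquiv.toLp 2 (Fin (n + 1) → ℝ)).measurableEmbedding (partialDeriv i ψ) (cube a L)
  rw [hcube] at hcv
  rw [← hcv]
  have hder : ∀ x : Fin (n + 1) → ℝ, HasFDerivAt (fun y => ψ (e y))
      ((fderiv ℝ ψ (e x)).comp (e : (Fin (n + 1) → ℝ) →L[ℝ] Pt (n + 1))) x := fun x =>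
    ((hψ.1.differentiable (by simp)).differentiableAt.hasFDerivAt).comp x e.hasFDerivAt
  have hdiv := integral_divergence_of_hasFDerivAt_off_countable' (fun i => a i)
    (fun i => a i + L) (fun i => by simp [hL.le])
    (fun j x => if j = i then ψ (e x) else 0)
    (fun j x => if j = i then (fderiv ℝ ψ (e x)).comp (e : (Fin (n + 1) → ℝ) →L[ℝ] Pt (n + 1))
      else 0) ∅ countable_empty
    (fun j => by
      by_cases hj : j = i
      · simp only [hj, if_true]; exact (hψ.continuous.comp e.continuous).continuousOn
      · simp only [hj, if_false]; exact continuousOn_const)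
    (fun x _ j => by
      by_cases hj : j = i
      · simp only [hj, if_true]; exact hder x
      · simp only [hj, if_false]; exact hasFDerivAt_const _ _)
    (by
      refine ContinuousOn.integrableOn_compact isCompact_Icc (Continuous.continuousOn ?_)
      refine continuous_finsetSum _ fun j _ => ?_
      by_cases hj : j = i
      · simp only [hj, if_true]
        exact ((hψ.1.continuous_fderiv (by simp)).comp e.continuous).clm_apply continuous_const
      · simp only [hj, if_false]; exact continuous_const)
  have hsum : ∀ x : Fin (n + 1) → ℝ, ∑ j, (if j = i then (fderiv ℝ ψ (e x)).comp
      (e : (Fin (n + 1) → ℝ) →L[ℝ] Pt (n + 1)) else 0) (Pi.single j 1)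
      = partialDeriv i ψ (WithLp.toLp 2 x) := by
    intro x
    rw [Finset.sum_eq_single i (fun j _ hj => by simp [hj]) (by simp)]
    simp only [if_true, partialDeriv, ContinuousLinearMap.comp_apply]
    rfl
  simp only [hsum] at hdiv
  rw [hdiv]
  refine Finset.sum_eq_zero fun j _ => ?_
  by_cases hj : j = i
  · subst hj
    simp only [if_true]
    rw [sub_eq_zero]
    refine integral_congr_ae (.of_forall fun x => ?_)
    have h1 : e (j.insertNth (a j + L) x)
        = e (j.insertNth (a j) x) + latticeVec L (Pi.single j 1) := by
      ext k
      refine Fin.succAboveCases j ?_ (fun m => ?_) k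
      · simp [e, latticeVec]
      · simp [e, latticeVec, Fin.succAbove_ne]
    simp only [h1, hψ.2]
  · simp [hj]

/-- The constant function one, as an element of `H¹`. -/
noncomputable def onePair {d : ℕ} (a : Pt d) (L : ℝ) : L2Pair a L := (Lp.const 2 _ 1, 0)

theorem val_onePair : val (onePair a L) =ᵐ[volume.restrict (cube a L)] fun _ => 1 :=
  Lp.coeFn_const _ _ _

theorem grad_onePair : grad (onePair a L) =ᵐ[volume.restrict (cube a L)] fun _ => 0 :=
  Lp.coeFn_zero _ _ _

theorem convexHull_cell_subset (M : PeriodicMesh d a L) {K : Finset (Pt d)} (hK : K ∈ M.cells) :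
    convexHull ℝ (K : Set (Pt d)) ⊆ cube a L := by
  rw [← M.cover]
  exact subset_biUnion_of_mem (u := fun K : Finset (Pt d) => convexHull ℝ (K : Set (Pt d))) hK

theorem onePair_mem_FE (hL : 0 < L) (M : PeriodicMesh d a L) (k : ℕ) :
    onePair a L ∈ FE M k := by
  refine ⟨fun ψ hψ i => ?_, fun K hK => ⟨1, by simp, ?_⟩⟩
  · have h1 : ∫ x in cube a L, (onePair a L).1 x * partialDeriv i ψ x
        = ∫ x in cube a L, partialDeriv i ψ x := by
      refine integral_congr_ae ?_
      filter_upwards [val_onePair (a := a) (L := L)] with x hx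
      simp only [val] at hx
      rw [hx, one_mul]
    have h2 : ∫ x in cube a L, (onePair a L).2 x i * ψ x = 0 := by
      refine integral_eq_zero_of_ae ?_
      filter_upwards [grad_onePair (a := a) (L := L)] with x hx
      simp only [grad] at hx
      simp [hx]
    rw [h1, h2, setIntegral_partialDeriv_eq_zero hL hψ i, neg_zero]
  · filter_upwards [ae_mono (Measure.restrict_mono (convexHull_cell_subset M hK) le_rfl)
      (val_onePair (a := a) (L := L))] with x hx
    simpa using hx

/-! ### Finite element functions -/

/-- Consider the relation between families of polynomials on the cells and the functions they
represent. It projects injectively to the polynomials, because the values determine the weak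
gradient, and surjectively to the finite element space. Using the relation rather than a map avoids
choosing the polynomials linearly. -/
theorem finiteDimensional_FE (hL : 0 < L) (M : PeriodicMesh d a L) (k : ℕ) :
    FiniteDimensional ℝ (FE M k) := by
  let G : Submodule ℝ ((M.cells → MvPolynomial.restrictTotalDegree (Fin d) ℝ k) × FE M k) :=
    { carrier := {z | ∀ K : M.cells, ∀ᵐ x ∂(volume.restrict (convexHull ℝ ((K : Finset (Pt d)) :
          Set (Pt d)))), val (z.2 : L2Pair a L) x
            = MvPolynomial.eval (fun i => x i) (z.1 K : MvPolynomial (Fin d) ℝ)}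
      zero_mem' := fun K => by
        filter_upwards [ae_mono (Measure.restrict_mono (convexHull_cell_subset M K.2) le_rfl)
          (Lp.coeFn_zero ℝ 2 (volume.restrict (cube a L)))] with x hx
        simpa [val] using hx
      add_mem' := fun {v w} hv hw K => by
        filter_upwards [ae_mono (Measure.restrict_mono (convexHull_cell_subset M K.2) le_rfl)
          (Lp.coeFn_add (v.2 : L2Pair a L).1 (w.2 : L2Pair a L).1), hv K, hw K] with x hx h1 h2
        simp only [val] at h1 h2
        have hx' : val ((v + w).2 : L2Pair a L) x
          = (v.2 : L2Pair a L).1 x + (w.2 : L2Pair a L).1 x := hx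
        rw [hx', h1, h2]
        simp
      smul_mem' := fun c v hv K => by
        filter_upwards [ae_mono (Measure.restrict_mono (convexHull_cell_subset M K.2) le_rfl)
          (Lp.coeFn_smul c (v.2 : L2Pair a L).1), hv K] with x hx h1
        simp only [val] at h1
        have hx' : val ((c • v).2 : L2Pair a L) x = c * (v.2 : L2Pair a L).1 x := hx
        rw [hx', h1]
        simp [MvPolynomial.smul_eval] }
  have hinj : Function.Injective ((LinearMap.fst ℝ _ (FE M k)).comp G.subtype) := by
    rw [injective_iff_map_eq_zero]
    rintro ⟨⟨p, w⟩, hw⟩ h0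
    replace h0 : p = 0 := h0
    subst h0
    have hval : (w : L2Pair a L).1 = 0 := by
      rw [Lp.eq_zero_iff_ae_eq_zero]
      have : ∀ᵐ x ∂(volume.restrict (⋃ K ∈ M.cells, convexHull ℝ (K : Set (Pt d)))),
          (w : L2Pair a L).1 x = 0 := by
        rw [ae_restrict_biUnion_finset_iff]
        intro K hK
        filter_upwards [hw ⟨K, hK⟩] with x hx
        simpa [val] using hx
      rw [M.cover] at this
      exact this
    have hgrad := grad_eq_zero_of_val_eq_zero hL w.2.1 hval
    have : w = 0 := Subtype.ext (Prod.ext hval hgrad)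
    subst this
    rfl
  have hG : Module.Finite ℝ G := Module.Finite.of_injective _ hinj
  refine Module.Finite.of_surjective ((LinearMap.snd ℝ _ (FE M k)).comp G.subtype) fun w => ?_
  choose p hp hpe using w.2.2
  exact ⟨⟨(fun K => ⟨p K K.2, (MvPolynomial.mem_restrictTotalDegree _ _ _).2 (hp K K.2)⟩, w),
    fun K => hpe K K.2⟩, rfl⟩

/-- On each of the finitely many compact cells the function is a polynomial. Boundedness makes every
nonlinear function of φ and every product with one or two gradients integrable. -/
theorem exists_bound_val (M : PeriodicMesh d a L) {k : ℕ} {w : L2Pair a L} (hw : w ∈ FE M k) :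
    ∃ C : ℝ, ∀ᵐ x ∂(volume.restrict (cube a L)), |val w x| ≤ C := by
  have hK : ∀ K ∈ M.cells, ∃ C : ℝ,
      ∀ᵐ x ∂(volume.restrict (convexHull ℝ (K : Set (Pt d)))), |val w x| ≤ C := by
    intro K hK
    obtain ⟨p, -, hp⟩ := hw.2 K hK
    have hc : IsCompact (convexHull ℝ (K : Set (Pt d))) := K.finite_toSet.isCompact_convexHull ℝ
    have hcont : Continuous fun x : Pt d => MvPolynomial.eval (fun i => x i) p :=
      (MvPolynomial.continuous_eval p).comp (by fun_prop)
    obtain ⟨C, hC⟩ := hc.exists_bound_of_continuousOn hcont.continuousOn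
    refine ⟨C, ?_⟩
    filter_upwards [hp, ae_restrict_mem hc.measurableSet] with x hx hxK
    rw [hx]
    exact hC x hxK
  choose! C hC using hK
  refine ⟨∑ K ∈ M.cells, |C K|, ?_⟩
  rw [← M.cover, ae_restrict_biUnion_finset_iff]
  intro K hK
  filter_upwards [hC K hK] with x hx
  exact (hx.trans (le_abs_self _)).trans
    (Finset.single_le_sum (f := fun K => |C K|) (fun _ _ => abs_nonneg _) hK)

end WeakGradient

/-! ### Dominated families and their integrals -/

section Dominated

variable {X α F : Type*} [NormedAddCommGroup X] [MeasurableSpace α]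
  [NormedAddCommGroup F] [MeasurableSpace F]

/-- A family of measurable functions which depends continuously on the parameter, and which is
dominated by a multiple of `G ^ n`, locally uniformly in the parameter. -/
structure Dominated (G : α → ℝ) (n : ℕ) (K : X → α → F) : Prop where
  measurable : ∀ p, Measurable (K p)
  continuous : ∀ x, Continuous fun p => K p x
  bound : ∀ ρ : ℝ, ∃ C, 0 ≤ C ∧ ∀ p, ‖p‖ ≤ ρ → ∀ x, ‖K p x‖ ≤ C * G x ^ n

namespace Dominated

variable {G : α → ℝ} {m n : ℕ}

theorem mono (hG : ∀ x, 1 ≤ G x) (hmn : m ≤ n) {K : X → α → F} (hK : Dominated G m K) :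
    Dominated G n K := by
  refine ⟨hK.measurable, hK.continuous, fun ρ => ?_⟩
  obtain ⟨C, hC0, hC⟩ := hK.bound ρ
  exact ⟨C, hC0, fun p hp x => (hC p hp x).trans
    (mul_le_mul_of_nonneg_left (pow_le_pow_right₀ (hG x) hmn) hC0)⟩

theorem mul (hG : ∀ x, 1 ≤ G x) {K K' : X → α → ℝ} (hK : Dominated G m K)
    (hK' : Dominated G n K') : Dominated G (m + n) fun p x => K p x * K' p x := by
  refine ⟨fun p => (hK.measurable p).mul (hK'.measurable p),
    fun x => (hK.continuous x).mul (hK'.continuous x), fun ρ => ?_⟩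
  obtain ⟨C, hC0, hC⟩ := hK.bound ρ
  obtain ⟨C', hC0', hC'⟩ := hK'.bound ρ
  refine ⟨C * C', mul_nonneg hC0 hC0', fun p hp x => ?_⟩
  have h0 : 0 ≤ G x := zero_le_one.trans (hG x)
  calc ‖K p x * K' p x‖ = ‖K p x‖ * ‖K' p x‖ := norm_mul _ _
    _ ≤ (C * G x ^ m) * (C' * G x ^ n) :=
        mul_le_mul (hC p hp x) (hC' p hp x) (norm_nonneg _) (by positivity)
    _ = C * C' * G x ^ (m + n) := by ring

theorem inner {d : ℕ} (hG : ∀ x, 1 ≤ G x) {K K' : X → α → Pt d} (hK : Dominated G m K)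
    (hK' : Dominated G n K') : Dominated G (m + n) fun p x => inner ℝ (K p x) (K' p x) := by
  refine ⟨fun p => (hK.measurable p).inner (hK'.measurable p),
    fun x => (hK.continuous x).inner (hK'.continuous x), fun ρ => ?_⟩
  obtain ⟨C, hC0, hC⟩ := hK.bound ρ
  obtain ⟨C', hC0', hC'⟩ := hK'.bound ρ
  refine ⟨C * C', mul_nonneg hC0 hC0', fun p hp x => ?_⟩
  have h0 : 0 ≤ G x := zero_le_one.trans (hG x)
  calc ‖Inner.inner ℝ (K p x) (K' p x)‖ ≤ ‖K p x‖ * ‖K' p x‖ := norm_inner_le_norm _ _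
    _ ≤ (C * G x ^ m) * (C' * G x ^ n) :=
        mul_le_mul (hC p hp x) (hC' p hp x) (norm_nonneg _) (by positivity)
    _ = C * C' * G x ^ (m + n) := by ring

/-- Order 0 means locally uniformly bounded values. A continuous function is bounded on the compact
ball containing them, so no growth condition is needed. -/
theorem comp_continuous {H : Type*} [NormedAddCommGroup H] [ProperSpace F]
    [MeasurableSpace H] [BorelSpace F] [BorelSpace H] {K : X → α → F} (hK : Dominated G 0 K)
    {k : F → H} (hk : Continuous k) : Dominated G 0 fun p x => k (K p x) := by
  refine ⟨fun p => hk.measurable.comp (hK.measurable p), fun x => hk.comp (hK.continuous x),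
    fun ρ => ?_⟩
  obtain ⟨C, hC0, hC⟩ := hK.bound ρ
  obtain ⟨C', hC'⟩ := (isCompact_closedBall (0 : F) C).exists_bound_of_continuousOn hk.continuousOn
  refine ⟨|C'|, abs_nonneg _, fun p hp x => ?_⟩
  rw [pow_zero, mul_one]
  refine (hC' _ ?_).trans (le_abs_self _)
  simpa using hC p hp x

theorem prodMk {K K' : X → α → ℝ} (hK : Dominated G 0 K) (hK' : Dominated G 0 K') :
    Dominated G 0 fun p x => (K p x, K' p x) := by
  refine ⟨fun p => (hK.measurable p).prodMk (hK'.measurable p),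
    fun x => (hK.continuous x).prodMk (hK'.continuous x), fun ρ => ?_⟩
  obtain ⟨C, hC0, hC⟩ := hK.bound ρ
  obtain ⟨C', hC0', hC'⟩ := hK'.bound ρ
  refine ⟨max C C', le_max_of_le_left hC0, fun p hp x => ?_⟩
  have h1 := hC p hp x
  have h2 := hC' p hp x
  simp only [pow_zero, mul_one] at h1 h2 ⊢
  exact max_le_max h1 h2

theorem sum {ι : Type*} (s : Finset ι) {K : ι → X → α → ℝ}
    (hK : ∀ i, Dominated G n (K i)) : Dominated G n fun p x => ∑ i ∈ s, K i p x := by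
  refine ⟨fun p => Finset.measurable_fun_sum _ fun i _ => (hK i).measurable p,
    fun x => continuous_finsetSum _ fun i _ => (hK i).continuous x, fun ρ => ?_⟩
  choose C hC0 hC using fun i => (hK i).bound ρ
  refine ⟨∑ i ∈ s, C i, Finset.sum_nonneg fun i _ => hC0 i, fun p hp x => ?_⟩
  rw [Finset.sum_mul]
  exact (norm_sum_le _ _).trans (Finset.sum_le_sum fun i _ => hC i p hp x)

theorem integrable {ν : Measure α} (hG : MemLp G 2 ν) {K : X → α → ℝ}
    (hK : Dominated G 2 K) (p : X) : Integrable (K p) ν := by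
  obtain ⟨C, hC0, hC⟩ := hK.bound ‖p‖
  exact (hG.integrable_sq.const_mul C).mono' (hK.measurable p).aestronglyMeasurable
    (.of_forall fun x => hC p le_rfl x)

/-- Dominated convergence, with a majorant valid on the unit ball around the given parameter. -/
theorem continuous_integral {ν : Measure α} (hG : MemLp G 2 ν) {K : X → α → ℝ}
    (hK : Dominated G 2 K) : Continuous fun p => ∫ x, K p x ∂ν := by
  refine continuous_iff_continuousAt.2 fun p₀ => ?_
  obtain ⟨C, hC0, hC⟩ := hK.bound (‖p₀‖ + 1)
  refine continuousAt_of_dominated (bound := fun x => C * G x ^ 2)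
    (.of_forall fun p => (hK.measurable p).aestronglyMeasurable) ?_
    (hG.integrable_sq.const_mul C) (.of_forall fun x => (hK.continuous x).continuousAt)
  filter_upwards [Metric.ball_mem_nhds p₀ one_pos] with p hp
  refine .of_forall fun x => hC p ?_ x
  have h1 : ‖p - p₀‖ < 1 := by rw [← dist_eq_norm]; exact hp
  linarith [norm_sub_norm_le p p₀]

end Dominated

end Dominated

/-! ### Spaces of functions with gradients, and the forms of the scheme -/

theorem Continuous.exists_norm_le_of_norm_le {X V : Type*} [NormedAddCommGroup X] [ProperSpace X]
    [NormedAddCommGroup V] {ℓ : X → V} (hℓ : Continuous ℓ) (ρ : ℝ) :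
    ∃ C, 0 ≤ C ∧ ∀ p, ‖p‖ ≤ ρ → ‖ℓ p‖ ≤ C := by
  obtain ⟨C, hC⟩ := (isCompact_closedBall (0 : X) ρ).exists_bound_of_continuousOn hℓ.continuousOn
  exact ⟨|C|, abs_nonneg _, fun p hp => (hC p (by simpa using hp)).trans (le_abs_self _)⟩

/-- A realization of the elements of a normed space as bounded functions with square integrable
gradients, linear at every point. -/
structure GradientModel (V : Type*) [NormedAddCommGroup V] [NormedSpace ℝ V] {α : Type*}
    [MeasurableSpace α] (ν : Measure α) (d : ℕ) where
  r : V →ₗ[ℝ] α → ℝ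
  g : V →ₗ[ℝ] α → Pt d
  G : α → ℝ
  measurable_r : ∀ v, Measurable (r v)
  measurable_g : ∀ v, Measurable (g v)
  one_le_G : ∀ x, 1 ≤ G x
  memLp_G : MemLp G 2 ν
  bound_r : ∃ C : ℝ, ∀ v x, |r v x| ≤ C * ‖v‖
  bound_g : ∀ v x, ‖g v x‖ ≤ G x * ‖v‖
  eq_zero : ∀ v, r v =ᵐ[ν] 0 → g v =ᵐ[ν] 0 → v = 0

namespace GradientModel

variable {V : Type*} [NormedAddCommGroup V] [NormedSpace ℝ V] {α : Type*}
  [MeasurableSpace α] {ν : Measure α} {d : ℕ} (A : GradientModel V ν d)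
  {X : Type*} [NormedAddCommGroup X] [ProperSpace X]

theorem continuous_r (x : α) : Continuous fun v => A.r v x := by
  obtain ⟨C, hC⟩ := A.bound_r
  exact (LinearMap.mkContinuous ((LinearMap.proj x).comp A.r) C fun v => hC v x).continuous

theorem continuous_g (x : α) : Continuous fun v => A.g v x :=
  (LinearMap.mkContinuous ((LinearMap.proj x).comp A.g) (A.G x) fun v => A.bound_g v x).continuous

/-- Values count with order 0 and gradients with order 1. No integrand of the scheme contains more
than two gradients, so the order never exceeds 2, the integrable one. -/
theorem dominated_r {ℓ : X → V} (hℓ : Continuous ℓ) : Dominated A.G 0 fun p => A.r (ℓ p) := by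
  refine ⟨fun p => A.measurable_r _, fun x => (A.continuous_r x).comp hℓ, fun ρ => ?_⟩
  obtain ⟨C, hC⟩ := A.bound_r
  obtain ⟨C', hC0', hC'⟩ := hℓ.exists_norm_le_of_norm_le ρ
  refine ⟨|C| * C', by positivity, fun p hp x => ?_⟩
  rw [pow_zero, mul_one]
  exact (hC _ x).trans (mul_le_mul (le_abs_self C) (hC' p hp) (norm_nonneg _) (abs_nonneg _))

theorem dominated_g {ℓ : X → V} (hℓ : Continuous ℓ) : Dominated A.G 1 fun p => A.g (ℓ p) := by
  refine ⟨fun p => A.measurable_g _, fun x => (A.continuous_g x).comp hℓ, fun ρ => ?_⟩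
  obtain ⟨C', hC0', hC'⟩ := hℓ.exists_norm_le_of_norm_le ρ
  refine ⟨C', hC0', fun p hp x => ?_⟩
  rw [pow_one, mul_comm]
  exact (A.bound_g _ x).trans (mul_le_mul_of_nonneg_left (hC' p hp)
    (zero_le_one.trans (A.one_le_G x)))

/-- The vector field with the given components. -/
def vec (u : Fin d → V) (x : α) : Pt d := WithLp.toLp 2 fun i => A.r (u i) x

theorem vec_add (u v : Fin d → V) (x : α) : A.vec (u + v) x = A.vec u x + A.vec v x := by
  ext i; simp [vec]

theorem vec_smul (c : ℝ) (u : Fin d → V) (x : α) : A.vec (c • u) x = c • A.vec u x := by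
  ext i; simp [vec]

theorem dominated_vec {u : X → Fin d → V} (hu : Continuous u) :
    Dominated A.G 0 fun p => A.vec (u p) := by
  have h := fun i => A.dominated_r ((continuous_apply i).comp hu)
  refine ⟨fun p => (PiLp.continuous_toLp 2 _).measurable.comp
      (measurable_pi_lambda _ fun i => (h i).measurable p),
    fun x => (PiLp.continuous_toLp 2 _).comp (continuous_pi fun i => (h i).continuous x),
    fun ρ => ?_⟩
  choose C hC0 hC using fun i => (h i).bound ρ
  refine ⟨∑ i, C i, Finset.sum_nonneg fun i _ => hC0 i, fun p hp x => ?_⟩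
  have hsum : A.vec (u p) x = ∑ i, A.r (u p i) x • EuclideanSpace.single i (1 : ℝ) := by
    ext j; simp [vec, Finset.sum_apply, Pi.single_apply]
  rw [hsum, pow_zero, mul_one]
  refine (norm_sum_le _ _).trans (Finset.sum_le_sum fun i _ => ?_)
  simpa [norm_smul] using hC i p hp x

/-- The integrand `c(φ) ∇v ⬝ ∇w`. -/
theorem dominated_stiff {k : ℝ → ℝ} (hk : Continuous k) {φ v w : X → V} (hφ : Continuous φ)
    (hv : Continuous v) (hw : Continuous w) :
    Dominated A.G 2 fun p x => k (A.r (φ p) x) * inner ℝ (A.g (v p) x) (A.g (w p) x) := by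
  have := ((A.dominated_r hφ).comp_continuous hk).mul A.one_le_G
    ((A.dominated_g hv).inner A.one_le_G (A.dominated_g hw))
  simpa using this

theorem dominated_mass {v w : X → V} (hv : Continuous v) (hw : Continuous w) :
    Dominated A.G 2 fun p x => A.r (v p) x * A.r (w p) x :=
  ((A.dominated_r hv).mul A.one_le_G (A.dominated_r hw)).mono A.one_le_G (by norm_num)

theorem dominated_coup {φ w : X → V} {u : X → Fin d → V} (hφ : Continuous φ)
    (hu : Continuous u) (hw : Continuous w) :
    Dominated A.G 2 fun p x => A.r (φ p) x * inner ℝ (A.vec (u p) x) (A.g (w p) x) :=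
  ((A.dominated_r hφ).mul A.one_le_G
    ((A.dominated_vec hu).inner A.one_le_G (A.dominated_g hw))).mono A.one_le_G (by norm_num)

theorem dominated_pot {k : ℝ × ℝ → ℝ} (hk : Continuous k) {φ₀ φ₁ ξ : X → V}
    (hφ₀ : Continuous φ₀) (hφ₁ : Continuous φ₁) (hξ : Continuous ξ) :
    Dominated A.G 2 fun p x => k (A.r (φ₀ p) x, A.r (φ₁ p) x) * A.r (ξ p) x :=
  ((((A.dominated_r hφ₀).prodMk (A.dominated_r hφ₁)).comp_continuous hk).mul A.one_le_G
    (A.dominated_r hξ)).mono A.one_le_G (by norm_num)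

theorem dominated_div {u : X → Fin d → V} {q : X → V} (hu : Continuous u) (hq : Continuous q) :
    Dominated A.G 2 fun p x => (∑ i, A.g (u p i) x i) * A.r (q p) x := by
  have h : ∀ i, Dominated A.G 1 fun p x => A.g (u p i) x i := fun i => by
    have hi := A.dominated_g ((continuous_apply i).comp hu)
    refine ⟨fun p => (measurable_pi_apply i).comp
      ((PiLp.continuous_ofLp 2 _).measurable.comp (hi.measurable p)),
      fun x => (EuclideanSpace.proj (𝕜 := ℝ) i).continuous.comp (hi.continuous x), fun ρ => ?_⟩
    obtain ⟨C, hC0, hC⟩ := hi.bound ρ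
    exact ⟨C, hC0, fun p hp x => (PiLp.norm_apply_le _ i).trans (hC p hp x)⟩
  exact ((Dominated.sum Finset.univ h).mul A.one_le_G
    (A.dominated_r hq)).mono A.one_le_G (by norm_num)

theorem integrable_stiff {k : ℝ → ℝ} (hk : Continuous k) (φ v w : V) :
    Integrable (fun x => k (A.r φ x) * inner ℝ (A.g v x) (A.g w x)) ν :=
  (A.dominated_stiff hk (X := ℝ) (continuous_const (y := φ)) (continuous_const (y := v))
    (continuous_const (y := w))).integrable A.memLp_G 0

theorem integrable_mass (v w : V) : Integrable (fun x => A.r v x * A.r w x) ν :=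
  (A.dominated_mass (X := ℝ) (continuous_const (y := v))
    (continuous_const (y := w))).integrable A.memLp_G 0

theorem integrable_coup (φ : V) (u : Fin d → V) (w : V) :
    Integrable (fun x => A.r φ x * inner ℝ (A.vec u x) (A.g w x)) ν :=
  (A.dominated_coup (X := ℝ) (continuous_const (y := φ)) (continuous_const (y := u))
    (continuous_const (y := w))).integrable A.memLp_G 0

theorem integrable_pot {k : ℝ × ℝ → ℝ} (hk : Continuous k) (φ₀ φ₁ ξ : V) :
    Integrable (fun x => k (A.r φ₀ x, A.r φ₁ x) * A.r ξ x) ν :=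
  (A.dominated_pot hk (X := ℝ) (continuous_const (y := φ₀)) (continuous_const (y := φ₁))
    (continuous_const (y := ξ))).integrable A.memLp_G 0

theorem integrable_div (u : Fin d → V) (q : V) :
    Integrable (fun x => (∑ i, A.g (u i) x i) * A.r q x) ν :=
  (A.dominated_div (X := ℝ) (continuous_const (y := u))
    (continuous_const (y := q))).integrable A.memLp_G 0

theorem integrable_comp {k : ℝ → ℝ} (hk : Continuous k) (φ : V) :
    Integrable (fun x => k (A.r φ x)) ν :=
  (((A.dominated_r (X := ℝ) (continuous_const (y := φ))).comp_continuous hk).mono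
    A.one_le_G (by norm_num : 0 ≤ 2)).integrable A.memLp_G 0

theorem _root_.integral_eq_add {F F₁ F₂ : α → ℝ} (h₁ : Integrable F₁ ν) (h₂ : Integrable F₂ ν)
    (h : ∀ x, F x = F₁ x + F₂ x) : ∫ x, F x ∂ν = (∫ x, F₁ x ∂ν) + ∫ x, F₂ x ∂ν := by
  rw [← integral_add h₁ h₂]
  exact integral_congr_ae (.of_forall h)

theorem _root_.integral_eq_smul {F F₁ : α → ℝ} {c : ℝ} (h : ∀ x, F x = c * F₁ x) :
    ∫ x, F x ∂ν = c • ∫ x, F₁ x ∂ν := by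
  rw [smul_eq_mul, ← integral_const_mul]
  exact integral_congr_ae (.of_forall h)

/-- The form `∫ v w`. -/
noncomputable def mass : V →ₗ[ℝ] V →ₗ[ℝ] ℝ :=
  LinearMap.mk₂ ℝ (fun v w => ∫ x, A.r v x * A.r w x ∂ν)
    (fun _ _ _ => integral_eq_add (A.integrable_mass _ _) (A.integrable_mass _ _)
      fun x => by simp only [map_add, Pi.add_apply]; ring)
    (fun _ _ _ => integral_eq_smul fun x => by simp only [map_smul, Pi.smul_apply, smul_eq_mul]; ring)
    (fun _ _ _ => integral_eq_add (A.integrable_mass _ _) (A.integrable_mass _ _)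
      fun x => by simp only [map_add, Pi.add_apply]; ring)
    (fun _ _ _ => integral_eq_smul fun x => by simp only [map_smul, Pi.smul_apply, smul_eq_mul]; ring)

theorem mass_apply (v w : V) : A.mass v w = ∫ x, A.r v x * A.r w x ∂ν := rfl

/-- The form `∫ k(φ) ∇v ⬝ ∇w`. -/
noncomputable def stiff (k : C(ℝ, ℝ)) (φ : V) : V →ₗ[ℝ] V →ₗ[ℝ] ℝ :=
  LinearMap.mk₂ ℝ (fun v w => ∫ x, k (A.r φ x) * inner ℝ (A.g v x) (A.g w x) ∂ν)
    (fun _ _ _ => integral_eq_add (A.integrable_stiff k.continuous _ _ _)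
      (A.integrable_stiff k.continuous _ _ _)
      fun x => by simp only [map_add, Pi.add_apply, inner_add_left]; ring)
    (fun _ _ _ => integral_eq_smul
      fun x => by simp only [map_smul, Pi.smul_apply, real_inner_smul_left]; ring)
    (fun _ _ _ => integral_eq_add (A.integrable_stiff k.continuous _ _ _)
      (A.integrable_stiff k.continuous _ _ _)
      fun x => by simp only [map_add, Pi.add_apply, inner_add_right]; ring)
    (fun _ _ _ => integral_eq_smul
      fun x => by simp only [map_smul, Pi.smul_apply, real_inner_smul_right]; ring)

theorem stiff_apply (k : C(ℝ, ℝ)) (φ v w : V) :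
    A.stiff k φ v w = ∫ x, k (A.r φ x) * inner ℝ (A.g v x) (A.g w x) ∂ν := rfl

/-- The form `∫ φ u ⬝ ∇w`. -/
noncomputable def coup : V →ₗ[ℝ] (Fin d → V) →ₗ[ℝ] V →ₗ[ℝ] ℝ where
  toFun φ := LinearMap.mk₂ ℝ (fun u w => ∫ x, A.r φ x * inner ℝ (A.vec u x) (A.g w x) ∂ν)
    (fun _ _ _ => integral_eq_add (A.integrable_coup _ _ _) (A.integrable_coup _ _ _)
      fun x => by rw [vec_add, inner_add_left]; ring)
    (fun _ _ _ => integral_eq_smul fun x => by rw [vec_smul, real_inner_smul_left]; ring)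
    (fun _ _ _ => integral_eq_add (A.integrable_coup _ _ _) (A.integrable_coup _ _ _)
      fun x => by simp only [map_add, Pi.add_apply, inner_add_right]; ring)
    (fun _ _ _ => integral_eq_smul
      fun x => by simp only [map_smul, Pi.smul_apply, real_inner_smul_right]; ring)
  map_add' _ _ := LinearMap.ext₂ fun _ _ =>
    integral_eq_add (A.integrable_coup _ _ _) (A.integrable_coup _ _ _)
      fun x => by simp only [map_add, Pi.add_apply]; ring
  map_smul' _ _ := LinearMap.ext₂ fun _ _ => integral_eq_smul
      fun x => by simp only [map_smul, Pi.smul_apply, smul_eq_mul, RingHom.id_apply]; ring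

theorem coup_apply (φ : V) (u : Fin d → V) (w : V) :
    A.coup φ u w = ∫ x, A.r φ x * inner ℝ (A.vec u x) (A.g w x) ∂ν := rfl

/-- The functional `∫ k(φ₀, φ₁) ξ`. -/
noncomputable def pot (k : C(ℝ × ℝ, ℝ)) (φ₀ φ₁ : V) : V →ₗ[ℝ] ℝ where
  toFun ξ := ∫ x, k (A.r φ₀ x, A.r φ₁ x) * A.r ξ x ∂ν
  map_add' _ _ := integral_eq_add (A.integrable_pot k.continuous _ _ _)
    (A.integrable_pot k.continuous _ _ _) fun x => by simp only [map_add, Pi.add_apply]; ring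
  map_smul' _ _ := integral_eq_smul
    fun x => by simp only [map_smul, Pi.smul_apply, smul_eq_mul, RingHom.id_apply]; ring

/-- The form `∫ (div u) q`. -/
noncomputable def div : (Fin d → V) →ₗ[ℝ] V →ₗ[ℝ] ℝ :=
  LinearMap.mk₂ ℝ (fun u q => ∫ x, (∑ i, A.g (u i) x i) * A.r q x ∂ν)
    (fun _ _ _ => integral_eq_add (A.integrable_div _ _) (A.integrable_div _ _)
      fun x => by
        simp only [map_add, Pi.add_apply, PiLp.add_apply, Finset.sum_add_distrib]; ring)
    (fun _ _ _ => integral_eq_smul fun x => by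
        simp only [map_smul, Pi.smul_apply, PiLp.smul_apply, smul_eq_mul, ← Finset.mul_sum]; ring)
    (fun _ _ _ => integral_eq_add (A.integrable_div _ _) (A.integrable_div _ _)
      fun x => by simp only [map_add, Pi.add_apply]; ring)
    (fun _ _ _ => integral_eq_smul
      fun x => by simp only [map_smul, Pi.smul_apply, smul_eq_mul]; ring)

theorem continuous_mass {v w : X → V} (hv : Continuous v) (hw : Continuous w) :
    Continuous fun p => A.mass (v p) (w p) :=
  (A.dominated_mass hv hw).continuous_integral A.memLp_G

theorem continuous_stiff (k : C(ℝ, ℝ)) {φ v w : X → V} (hφ : Continuous φ)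
    (hv : Continuous v) (hw : Continuous w) :
    Continuous fun p => A.stiff k (φ p) (v p) (w p) :=
  (A.dominated_stiff k.continuous hφ hv hw).continuous_integral A.memLp_G

theorem continuous_coup {φ w : X → V} {u : X → Fin d → V} (hφ : Continuous φ)
    (hu : Continuous u) (hw : Continuous w) :
    Continuous fun p => A.coup (φ p) (u p) (w p) :=
  (A.dominated_coup hφ hu hw).continuous_integral A.memLp_G

theorem continuous_pot (k : C(ℝ × ℝ, ℝ)) {φ₀ φ₁ ξ : X → V}
    (hφ₀ : Continuous φ₀) (hφ₁ : Continuous φ₁) (hξ : Continuous ξ) :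
    Continuous fun p => A.pot k (φ₀ p) (φ₁ p) (ξ p) :=
  (A.dominated_pot k.continuous hφ₀ hφ₁ hξ).continuous_integral A.memLp_G

theorem mass_comm (v w : V) : A.mass v w = A.mass w v :=
  integral_congr_ae (.of_forall fun _ => mul_comm _ _)

theorem stiff_comm (k : C(ℝ, ℝ)) (φ v w : V) : A.stiff k φ v w = A.stiff k φ w v :=
  integral_congr_ae (.of_forall fun x => by simp only [real_inner_comm])

end GradientModel

/-! ### Linear algebra in finite dimensions -/

section FiniteDimensional

/-- Definiteness makes B injective into the dual, which has the same dimension. -/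
theorem exists_eq_of_definite {W : Type*} [AddCommGroup W] [Module ℝ W] [FiniteDimensional ℝ W]
    (B : W →ₗ[ℝ] W →ₗ[ℝ] ℝ) (hB : ∀ w, B w w = 0 → w = 0) (ℓ : W →ₗ[ℝ] ℝ) :
    ∃ w, B w = ℓ := by
  have hinj : Function.Injective B := by
    rw [injective_iff_map_eq_zero]
    intro w hw
    exact hB w (by rw [hw, LinearMap.zero_apply])
  exact (LinearMap.injective_iff_surjective_of_finrank_eq_finrank
    (Subspace.dual_finrank_eq (K := ℝ) (V := W)).symm).1 hinj ℓ

/-- The annihilator of ker D is the range of the transpose of D, and Q is reflexive. This yields the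
pressure; as only existence is asked for, no inf-sup condition enters. -/
theorem exists_multiplier {U Q : Type*} [AddCommGroup U] [Module ℝ U] [AddCommGroup Q]
    [Module ℝ Q] [FiniteDimensional ℝ Q] (D : U →ₗ[ℝ] Q →ₗ[ℝ] ℝ) (ℓ : U →ₗ[ℝ] ℝ)
    (hℓ : ∀ u, D u = 0 → ℓ u = 0) : ∃ q, ∀ u, ℓ u = D u q := by
  have hmem : ℓ ∈ (LinearMap.ker D).dualAnnihilator :=
    (Submodule.mem_dualAnnihilator _).2 fun u hu => hℓ u hu
  rw [← LinearMap.range_dualMap_eq_dualAnnihilator_ker] at hmem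
  obtain ⟨θ, hθ⟩ := hmem
  refine ⟨(Module.evalEquiv ℝ Q).symm θ, fun u => ?_⟩
  rw [← hθ, LinearMap.dualMap_apply]
  exact (Module.apply_evalEquiv_symm_apply ℝ Q (D u) θ).symm

/-- The constant is the minimum of q on the unit sphere; homogeneity does the rest. -/
theorem exists_mul_norm_sq_le {X : Type*} [NormedAddCommGroup X] [NormedSpace ℝ X]
    [FiniteDimensional ℝ X] {q : X → ℝ} (hq : Continuous q)
    (hsmul : ∀ (t : ℝ) p, q (t • p) = t ^ 2 * q p) (hpos : ∀ p, p ≠ 0 → 0 < q p) :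
    ∃ m > 0, ∀ p, m * ‖p‖ ^ 2 ≤ q p := by
  rcases subsingleton_or_nontrivial X with h | h
  · refine ⟨1, one_pos, fun p => ?_⟩
    have h0 := hsmul 0 0
    rw [Subsingleton.elim p 0]
    simp at h0
    simp [h0]
  · obtain ⟨z, hz, hmin⟩ := (isCompact_sphere (0 : X) 1).exists_isMinOn
      (NormedSpace.sphere_nonempty.2 zero_le_one) hq.continuousOn
    have hz0 : z ≠ 0 := by
      rintro rfl; simp at hz
    refine ⟨q z, hpos z hz0, fun p => ?_⟩
    rcases eq_or_ne p 0 with rfl | hp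
    · have h0 := hsmul 0 0
      simp at h0
      simp [h0]
    · have hn : ‖p‖ ≠ 0 := norm_ne_zero_iff.2 hp
      have h1 : q z ≤ q (‖p‖⁻¹ • p) := hmin (by simp [norm_smul, hn])
      rw [hsmul] at h1
      calc q z * ‖p‖ ^ 2 ≤ (‖p‖⁻¹ ^ 2 * q p) * ‖p‖ ^ 2 := by gcongr
        _ = q p := by field_simp

end FiniteDimensional

/-! ### One time step of the scheme -/

namespace GradientModel

variable {V : Type*} [NormedAddCommGroup V] [NormedSpace ℝ V] {α : Type*}
  [MeasurableSpace α] {ν : Measure α} {d : ℕ} (A : GradientModel V ν d)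

/-- The form `∫ ∇v ⬝ ∇w`. -/
noncomputable def dir : V →ₗ[ℝ] V →ₗ[ℝ] ℝ := A.stiff 1 0

theorem dir_apply (v w : V) : A.dir v w = ∫ x, inner ℝ (A.g v x) (A.g w x) ∂ν := by
  simp [dir, stiff_apply]

theorem dir_comm (v w : V) : A.dir v w = A.dir w v := A.stiff_comm _ _ _ _

theorem mass_self_nonneg (v : V) : 0 ≤ A.mass v v :=
  integral_nonneg fun _ => mul_self_nonneg _

theorem dir_self_nonneg (v : V) : 0 ≤ A.dir v v := by
  rw [dir_apply]
  exact integral_nonneg fun _ => real_inner_self_nonneg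

theorem integrable_inner_g (v w : V) : Integrable (fun x => inner ℝ (A.g v x) (A.g w x)) ν := by
  simpa using A.integrable_stiff (k := fun _ => 1) continuous_const 0 v w

theorem mul_dir_le_stiff {k : C(ℝ, ℝ)} {c : ℝ} (hc : ∀ s, c ≤ k s) (φ v : V) :
    c * A.dir v v ≤ A.stiff k φ v v := by
  rw [dir_apply, ← integral_const_mul]
  exact integral_mono ((A.integrable_inner_g v v).const_mul c)
    (A.integrable_stiff k.continuous φ v v)
    fun x => mul_le_mul_of_nonneg_right (hc _) real_inner_self_nonneg

theorem r_ae_eq_zero {v : V} (h : A.mass v v = 0) : A.r v =ᵐ[ν] 0 := by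
  have := (integral_eq_zero_iff_of_nonneg (fun _ => mul_self_nonneg _) (A.integrable_mass v v)).1 h
  filter_upwards [this] with x hx
  simpa using hx

theorem g_ae_eq_zero {v : V} (h : A.dir v v = 0) : A.g v =ᵐ[ν] 0 := by
  rw [dir_apply] at h
  have := (integral_eq_zero_iff_of_nonneg (fun _ => real_inner_self_nonneg)
    (A.integrable_inner_g v v)).1 h
  filter_upwards [this] with x hx
  simpa using hx

theorem eq_zero_of_forms {v : V} (h : A.mass v v = 0) (h' : A.dir v v = 0) : v = 0 :=
  A.eq_zero v (A.r_ae_eq_zero h) (A.g_ae_eq_zero h')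

/-- A vanishing Dirichlet energy means that the gradient vanishes almost everywhere. Together with
the next lemma this shows that functions without gradient are invisible to diffusion and transport.
-/
theorem stiff_eq_zero_right (k : C(ℝ, ℝ)) (φ v : V) {w : V} (h : A.dir w w = 0) :
    A.stiff k φ v w = 0 := by
  refine integral_eq_zero_of_ae ?_
  filter_upwards [A.g_ae_eq_zero h] with x hx
  simp [hx]

theorem coup_eq_zero_right (φ : V) (u : Fin d → V) {w : V} (h : A.dir w w = 0) :
    A.coup φ u w = 0 := by
  refine integral_eq_zero_of_ae ?_
  filter_upwards [A.g_ae_eq_zero h] with x hx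
  simp [hx]

/-- The discrete chain rule: `kf` is a difference quotient of f, so tested with the increment it
gives the exact change of the potential energy. -/
theorem pot_sub {f : ℝ → ℝ} (hf : Continuous f) {kf : C(ℝ × ℝ, ℝ)}
    (hkf : ∀ p q, kf (p, q) * (q - p) = f q - f p) (φ₀ φ₁ : V) :
    A.pot kf φ₀ φ₁ (φ₁ - φ₀) = (∫ x, f (A.r φ₁ x) ∂ν) - ∫ x, f (A.r φ₀ x) ∂ν := by
  rw [← integral_sub (A.integrable_comp hf φ₁) (A.integrable_comp hf φ₀)]
  refine integral_congr_ae (.of_forall fun x => ?_)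
  simp only [map_sub, Pi.sub_apply]
  exact hkf _ _

/-- One step of the scheme, with step size `τ`, from `(φ₀, u₀)` to `(φ₁, u₁)`, with chemical
potential `μ` and pressure `p`. -/
structure IsStep (τ γ : ℝ) (kb kη : C(ℝ, ℝ)) (kf : C(ℝ × ℝ, ℝ)) (Q : Submodule ℝ V)
    (φ₀ φ₁ μ : V) (u₀ u₁ : Fin d → V) (p : V) : Prop where
  phase : ∀ ψ, A.mass (φ₁ - φ₀) ψ = τ * A.coup ((1 / 2 : ℝ) • (φ₀ + φ₁)) ((1 / 2 : ℝ) • (u₀ + u₁)) ψ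
    - τ * A.stiff kb ((1 / 2 : ℝ) • (φ₀ + φ₁)) μ ψ
  potential : ∀ ξ, A.mass μ ξ = γ * A.dir ((1 / 2 : ℝ) • (φ₀ + φ₁)) ξ + A.pot kf φ₀ φ₁ ξ
  momentum : ∀ w : Fin d → V, ∑ i, A.mass (u₁ i - u₀ i) (w i)
    = -(τ * (1 / 2 * (∑ i, A.coup (w i) ((1 / 2 : ℝ) • (u₀ + u₁)) (((1 / 2 : ℝ) • (u₀ + u₁)) i)
          - ∑ i, A.coup (((1 / 2 : ℝ) • (u₀ + u₁)) i) ((1 / 2 : ℝ) • (u₀ + u₁)) (w i))))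
      - τ * (∑ i, A.stiff kη ((1 / 2 : ℝ) • (φ₀ + φ₁)) (((1 / 2 : ℝ) • (u₀ + u₁)) i) (w i))
      + τ * A.div w p - τ * A.coup ((1 / 2 : ℝ) • (φ₀ + φ₁)) w μ
  incompressible : ∀ q ∈ Q, A.div ((1 / 2 : ℝ) • (u₀ + u₁)) q = 0

/-- The free energy. -/
noncomputable def energy (γ : ℝ) (f : ℝ → ℝ) (φ : V) (u : Fin d → V) : ℝ :=
  γ / 2 * A.dir φ φ + (∫ x, f (A.r φ x) ∂ν) + 1 / 2 * ∑ i, A.mass (u i) (u i)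

variable {A} in
-- Midpoints paired with increments give half the difference of squares (`h5`, `h6`). The term
-- coup(φ, u, μ) at the midpoints occurs in the phase and the momentum equation and cancels; the two
-- halves of the convective form coincide.
theorem IsStep.energy_eq {τ γ : ℝ} {kb kη : C(ℝ, ℝ)} {kf : C(ℝ × ℝ, ℝ)} {Q : Submodule ℝ V}
    {φ₀ φ₁ μ : V} {u₀ u₁ : Fin d → V} {p : V} (hp : p ∈ Q)
    (h : A.IsStep τ γ kb kη kf Q φ₀ φ₁ μ u₀ u₁ p) {f : ℝ → ℝ} (hf : Continuous f)
    (hkf : ∀ p q, kf (p, q) * (q - p) = f q - f p) :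
    A.energy γ f φ₁ u₁ + τ * (A.stiff kb ((1 / 2 : ℝ) • (φ₀ + φ₁)) μ μ
      + ∑ i, A.stiff kη ((1 / 2 : ℝ) • (φ₀ + φ₁)) (((1 / 2 : ℝ) • (u₀ + u₁)) i)
          (((1 / 2 : ℝ) • (u₀ + u₁)) i)) = A.energy γ f φ₀ u₀ := by
  have h1 := h.phase μ
  have h2 := h.potential (φ₁ - φ₀)
  have h3 := h.momentum ((1 / 2 : ℝ) • (u₀ + u₁))
  have h4 := h.incompressible p hp
  rw [h4] at h3
  rw [A.pot_sub hf hkf, A.mass_comm, h1] at h2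
  have h5 : A.dir ((1 / 2 : ℝ) • (φ₀ + φ₁)) (φ₁ - φ₀)
      = 1 / 2 * (A.dir φ₁ φ₁ - A.dir φ₀ φ₀) := by
    simp only [map_smul, map_add, map_sub, LinearMap.add_apply, LinearMap.smul_apply, smul_eq_mul]
    rw [A.dir_comm φ₁ φ₀]
    ring
  have h6 : ∑ i, A.mass (u₁ i - u₀ i) (((1 / 2 : ℝ) • (u₀ + u₁)) i)
      = 1 / 2 * (∑ i, A.mass (u₁ i) (u₁ i) - ∑ i, A.mass (u₀ i) (u₀ i)) := by
    rw [← Finset.sum_sub_distrib, Finset.mul_sum]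
    refine Finset.sum_congr rfl fun i _ => ?_
    simp only [Pi.smul_apply, Pi.add_apply, map_smul, map_add, map_sub, LinearMap.sub_apply,
      smul_eq_mul]
    rw [A.mass_comm (u₁ i) (u₀ i)]
    ring
  rw [h5] at h2
  rw [h6] at h3
  simp only [energy]
  linarith

/-- The residual of a time step, with the increment `δ` of the phase fraction, the chemical
potential `μ` and the mean velocity `v` as unknowns. -/
noncomputable def residual (τ γ : ℝ) (kb kη : C(ℝ, ℝ)) (kf : C(ℝ × ℝ, ℝ)) (φ₀ : V)
    (u₀ : Fin d → V) (X : V × V × (Fin d → V)) : (V × V × (Fin d → V)) →ₗ[ℝ] ℝ :=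
  (-A.mass X.2.1 + γ • A.dir (φ₀ + (1 / 2 : ℝ) • X.1) + A.pot kf φ₀ (φ₀ + X.1)).comp
      (LinearMap.fst ℝ V (V × (Fin d → V)))
  + (A.mass X.1 - τ • A.coup (φ₀ + (1 / 2 : ℝ) • X.1) X.2.2
        + τ • A.stiff kb (φ₀ + (1 / 2 : ℝ) • X.1) X.2.1).comp
      ((LinearMap.fst ℝ V (Fin d → V)).comp (LinearMap.snd ℝ V (V × (Fin d → V))))
  + (∑ i, ((2 : ℝ) • A.mass (X.2.2 i - u₀ i)
          + (τ / 2) • ((A.coup.flip X.2.2).flip (X.2.2 i) - A.coup (X.2.2 i) X.2.2)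
          + τ • A.stiff kη (φ₀ + (1 / 2 : ℝ) • X.1) (X.2.2 i)).comp (LinearMap.proj i)
        + τ • (A.coup (φ₀ + (1 / 2 : ℝ) • X.1)).flip X.2.1).comp
      ((LinearMap.snd ℝ V (Fin d → V)).comp (LinearMap.snd ℝ V (V × (Fin d → V))))

theorem residual_apply (τ γ : ℝ) (kb kη : C(ℝ, ℝ)) (kf : C(ℝ × ℝ, ℝ)) (φ₀ : V)
    (u₀ : Fin d → V) (X Y : V × V × (Fin d → V)) :
    A.residual τ γ kb kη kf φ₀ u₀ X Y =
      (-A.mass X.2.1 Y.1 + γ * A.dir (φ₀ + (1 / 2 : ℝ) • X.1) Y.1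
        + A.pot kf φ₀ (φ₀ + X.1) Y.1)
      + (A.mass X.1 Y.2.1 - τ * A.coup (φ₀ + (1 / 2 : ℝ) • X.1) X.2.2 Y.2.1
        + τ * A.stiff kb (φ₀ + (1 / 2 : ℝ) • X.1) X.2.1 Y.2.1)
      + (∑ i, (2 * A.mass (X.2.2 i - u₀ i) (Y.2.2 i)
          + (τ / 2) * (A.coup (Y.2.2 i) X.2.2 (X.2.2 i) - A.coup (X.2.2 i) X.2.2 (Y.2.2 i))
          + τ * A.stiff kη (φ₀ + (1 / 2 : ℝ) • X.1) (X.2.2 i) (Y.2.2 i))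
        + τ * A.coup (φ₀ + (1 / 2 : ℝ) • X.1) Y.2.2 X.2.1) := by
  simp [residual, LinearMap.sum_apply, mul_add]

/-- The quadratic form which bounds the residual from below. -/
noncomputable def coercive (c γ : ℝ) (X : V × V × (Fin d → V)) : ℝ :=
  c * A.dir X.2.1 X.2.1 + γ / 4 * A.dir X.1 X.1
    + ∑ i, (A.mass (X.2.2 i) (X.2.2 i) + c * A.dir (X.2.2 i) (X.2.2 i))

/-- The slots of the residual are paired so that on the diagonal mass(μ, δ) and the coupling terms
cancel. What remains is bounded by completing squares: |δ + 2φ₀|² ≥ 0 in the Dirichlet form and |v -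
u₀|² ≥ 0 in the mass form, together with ∫ f(φ₀ + δ) ≥ 0. -/
theorem residual_self_ge {τ γ c : ℝ} (hτ : 0 ≤ τ) (hγ : 0 ≤ γ) {kb kη : C(ℝ, ℝ)}
    {kf : C(ℝ × ℝ, ℝ)} (hkb : ∀ s, c ≤ kb s) (hkη : ∀ s, c ≤ kη s) {f : ℝ → ℝ}
    (hf : Continuous f) (hf0 : ∀ s, 0 ≤ f s) (hkf : ∀ p q, kf (p, q) * (q - p) = f q - f p)
    (φ₀ : V) (u₀ : Fin d → V) (X : V × V × (Fin d → V)) :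
    A.coercive (τ * c) γ X - (γ * A.dir φ₀ φ₀ + (∫ x, f (A.r φ₀ x) ∂ν)
        + ∑ i, A.mass (u₀ i) (u₀ i))
      ≤ A.residual τ γ kb kη kf φ₀ u₀ X X := by
  obtain ⟨δ, μ, v⟩ := X
  rw [residual_apply]
  simp only [coercive]
  have h1 : A.pot kf φ₀ (φ₀ + δ) δ
      = (∫ x, f (A.r (φ₀ + δ) x) ∂ν) - ∫ x, f (A.r φ₀ x) ∂ν := by
    have := A.pot_sub hf hkf φ₀ (φ₀ + δ)
    rwa [add_sub_cancel_left] at this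
  have h2 : 0 ≤ ∫ x, f (A.r (φ₀ + δ) x) ∂ν := integral_nonneg fun _ => hf0 _
  have h3 : 1 / 4 * A.dir δ δ - A.dir φ₀ φ₀ ≤ A.dir (φ₀ + (1 / 2 : ℝ) • δ) δ := by
    have := A.dir_self_nonneg (δ + (2 : ℝ) • φ₀)
    simp only [map_smul, map_add, LinearMap.add_apply, LinearMap.smul_apply,
      smul_eq_mul] at this ⊢
    rw [A.dir_comm δ φ₀] at this
    linarith
  have h3' := mul_le_mul_of_nonneg_left h3 hγ
  have h4 := mul_le_mul_of_nonneg_left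
    (A.mul_dir_le_stiff hkb (φ₀ + (1 / 2 : ℝ) • δ) μ) hτ
  have h5 : ∑ i, (A.mass (v i) (v i) + τ * c * A.dir (v i) (v i)) - ∑ i, A.mass (u₀ i) (u₀ i)
      ≤ ∑ i, (2 * A.mass (v i - u₀ i) (v i)
          + (τ / 2) * (A.coup (v i) v (v i) - A.coup (v i) v (v i))
          + τ * A.stiff kη (φ₀ + (1 / 2 : ℝ) • δ) (v i) (v i)) := by
    rw [← Finset.sum_sub_distrib]
    refine Finset.sum_le_sum fun i _ => ?_
    have h6 := A.mass_self_nonneg (v i - u₀ i)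
    have h7 := mul_le_mul_of_nonneg_left
      (A.mul_dir_le_stiff hkη (φ₀ + (1 / 2 : ℝ) • δ) (v i)) hτ
    simp only [map_sub, LinearMap.sub_apply] at h6 ⊢
    rw [A.mass_comm (v i) (u₀ i)] at h6
    linarith
  rw [h1, A.mass_comm μ δ]
  linarith

variable [FiniteDimensional ℝ V]

theorem continuous_residual (τ γ : ℝ) (kb kη : C(ℝ, ℝ)) (kf : C(ℝ × ℝ, ℝ)) (φ₀ : V)
    (u₀ : Fin d → V) (Y : V × V × (Fin d → V)) :
    Continuous fun X => A.residual τ γ kb kη kf φ₀ u₀ X Y := by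
  simp only [residual_apply]
  refine ((((A.continuous_mass ?_ ?_).neg.add (continuous_const.mul
    (A.continuous_stiff 1 ?_ ?_ ?_))).add (A.continuous_pot kf ?_ ?_ ?_)).add
    (((A.continuous_mass ?_ ?_).sub (continuous_const.mul (A.continuous_coup ?_ ?_ ?_))).add
      (continuous_const.mul (A.continuous_stiff kb ?_ ?_ ?_)))).add
    ((continuous_finsetSum _ fun i _ => ((continuous_const.mul (A.continuous_mass ?_ ?_)).add
      (continuous_const.mul ((A.continuous_coup ?_ ?_ ?_).sub (A.continuous_coup ?_ ?_ ?_)))).add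
      (continuous_const.mul (A.continuous_stiff kη ?_ ?_ ?_))).add
      (continuous_const.mul (A.continuous_coup ?_ ?_ ?_))) <;> fun_prop

/-- Existence for one time step. -/
theorem exists_isStep {τ γ c : ℝ} (hτ : 0 < τ) (hγ : 0 < γ) (hc : 0 < c) {kb kη : C(ℝ, ℝ)}
    {kf : C(ℝ × ℝ, ℝ)} (hkb : ∀ s, c ≤ kb s) (hkη : ∀ s, c ≤ kη s) {f : ℝ → ℝ}
    (hf : Continuous f) (hf0 : ∀ s, 0 ≤ f s) (hkf : ∀ p q, kf (p, q) * (q - p) = f q - f p)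
    (Q : Submodule ℝ V) (φ₀ : V) {u₀ : Fin d → V} (hu₀ : ∀ q ∈ Q, A.div u₀ q = 0) :
    ∃ φ₁ μ u₁, ∃ p ∈ Q, (∀ q ∈ Q, A.div u₁ q = 0) ∧
      A.IsStep τ γ kb kη kf Q φ₀ φ₁ μ u₀ u₁ p := by
  -- `W` consists of the functions without gradient. It need not be identified with the constants:
  -- splitting off its mass-orthogonal complement `S` is enough.
  let W : Submodule ℝ V := LinearMap.ker A.dir
  have hWdir : ∀ w ∈ W, A.dir w w = 0 := fun w hw => by
    have : A.dir w = 0 := hw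
    rw [this, LinearMap.zero_apply]
  have hWmem : ∀ w, A.dir w w = 0 → w ∈ W := fun w hw =>
    LinearMap.ext fun v => by
      rw [dir_comm]; exact A.stiff_eq_zero_right _ _ _ hw
  let S : Submodule ℝ V := LinearMap.ker (A.mass.compl₂ W.subtype)
  have hS : ∀ {s}, s ∈ S → ∀ w ∈ W, A.mass s w = 0 := fun hs w hw =>
    LinearMap.congr_fun hs (⟨w, hw⟩ : W)
  let D : (Fin d → V) →ₗ[ℝ] Q →ₗ[ℝ] ℝ := A.div.compl₂ Q.subtype
  let Z : Submodule ℝ (Fin d → V) := LinearMap.ker D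
  have hZ : ∀ {u}, u ∈ Z → ∀ q ∈ Q, A.div u q = 0 := fun hu q hq =>
    LinearMap.congr_fun hu (⟨q, hq⟩ : Q)
  -- orthogonal projection to the functions without gradient
  have hproj : ∀ ℓ : V →ₗ[ℝ] ℝ, ∃ w ∈ W, ∀ z ∈ W, A.mass w z = ℓ z := by
    intro ℓ
    obtain ⟨w, hw⟩ := exists_eq_of_definite (A.mass.compl₁₂ W.subtype W.subtype)
      (fun w hw => Subtype.ext (A.eq_zero_of_forms hw (hWdir w w.2))) (ℓ.comp W.subtype)
    exact ⟨w, w.2, fun z hz => LinearMap.congr_fun hw (⟨z, hz⟩ : W)⟩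
  have hdecomp : ∀ v, ∃ w ∈ W, v - w ∈ S := by
    intro v
    obtain ⟨w, hw, hwz⟩ := hproj (A.mass v)
    refine ⟨w, hw, LinearMap.ext fun z => ?_⟩
    change A.mass (v - w) z = 0
    rw [map_sub, LinearMap.sub_apply, hwz z z.2, sub_self]
  let J : (S × S × Z) →ₗ[ℝ] V × V × (Fin d → V) :=
    S.subtype.prodMap (S.subtype.prodMap Z.subtype)
  have hJ : Continuous J := J.continuous_of_finiteDimensional
  have hcpos : 0 < τ * c := mul_pos hτ hc
  -- If the form vanishes, then δ and μ have no gradient and so lie in `W`; lying also in `S`, they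
  -- are mass-orthogonal to themselves and vanish. The velocity is controlled directly by its own
  -- mass term.
  obtain ⟨m, hm, hmq⟩ := exists_mul_norm_sq_le (X := S × S × Z)
    (q := fun X => A.coercive (τ * c) γ (J X)) (by
      simp only [coercive]
      exact ((continuous_const.mul (A.continuous_stiff 1 continuous_const (by fun_prop)
        (by fun_prop))).add (continuous_const.mul (A.continuous_stiff 1 continuous_const
        (by fun_prop) (by fun_prop)))).add (continuous_finsetSum _ fun i _ =>
        (A.continuous_mass (by fun_prop) (by fun_prop)).add (continuous_const.mul
        (A.continuous_stiff 1 continuous_const (by fun_prop) (by fun_prop)))))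
    (fun t X => by
      simp only [coercive, map_smul, Prod.smul_fst, Prod.smul_snd, Pi.smul_apply,
        LinearMap.smul_apply, smul_eq_mul, mul_add, Finset.mul_sum]
      congr 1
      · ring
      · exact Finset.sum_congr rfl fun i _ => by ring)
    (fun X hX => by
      have h1 := A.dir_self_nonneg (J X).2.1
      have h2 := A.dir_self_nonneg (J X).1
      have h3 : ∀ i, 0 ≤ A.mass ((J X).2.2 i) ((J X).2.2 i)
          + τ * c * A.dir ((J X).2.2 i) ((J X).2.2 i) := fun i =>
        add_nonneg (A.mass_self_nonneg _) (mul_nonneg hcpos.le (A.dir_self_nonneg _))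
      have h4 := Finset.sum_nonneg fun i (_ : i ∈ Finset.univ) => h3 i
      have h5 := mul_nonneg hcpos.le h1
      have h6 := mul_nonneg (show 0 ≤ γ / 4 by positivity) h2
      refine lt_of_le_of_ne (add_nonneg (add_nonneg h5 h6) h4) fun h0 => hX ?_
      simp only [coercive] at h0
      have hμ : A.dir (J X).2.1 (J X).2.1 = 0 := by
        have : τ * c * A.dir (J X).2.1 (J X).2.1 = 0 := by linarith
        exact (mul_eq_zero.1 this).resolve_left hcpos.ne'
      have hδ : A.dir (J X).1 (J X).1 = 0 := by
        have : γ / 4 * A.dir (J X).1 (J X).1 = 0 := by linarith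
        exact (mul_eq_zero.1 this).resolve_left (by positivity)
      have hv : ∀ i, A.mass ((J X).2.2 i) ((J X).2.2 i)
          + τ * c * A.dir ((J X).2.2 i) ((J X).2.2 i) = 0 := fun i =>
        (Finset.sum_eq_zero_iff_of_nonneg fun i _ => h3 i).1 (by linarith) i (Finset.mem_univ i)
      refine Prod.ext (Subtype.ext ?_) (Prod.ext (Subtype.ext ?_) (Subtype.ext (funext fun i => ?_)))
      · exact A.eq_zero_of_forms (hS X.1.2 _ (hWmem _ hδ)) hδ
      · exact A.eq_zero_of_forms (hS X.2.1.2 _ (hWmem _ hμ)) hμ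
      · have h7 := A.mass_self_nonneg ((J X).2.2 i)
        have h8 := mul_nonneg hcpos.le (A.dir_self_nonneg ((J X).2.2 i))
        have h9 : τ * c * A.dir ((J X).2.2 i) ((J X).2.2 i) = 0 := by linarith [hv i]
        exact A.eq_zero_of_forms (by linarith [hv i] : A.mass ((J X).2.2 i) ((J X).2.2 i) = 0)
          ((mul_eq_zero.1 h9).resolve_left hcpos.ne'))
  set C : ℝ := γ * A.dir φ₀ φ₀ + (∫ x, f (A.r φ₀ x) ∂ν) + ∑ i, A.mass (u₀ i) (u₀ i) with hC
  -- For ‖X‖ ≥ |C|/m + 1 one has ‖X‖ ≥ 1, hence m‖X‖² ≥ m‖X‖ ≥ |C| + m > C.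
  obtain ⟨X, hX⟩ := exists_dual_eq_zero (X := S × S × Z)
    (fun X => (A.residual τ γ kb kη kf φ₀ u₀ (J X)).comp J)
    (fun Y => (A.continuous_residual τ γ kb kη kf φ₀ u₀ (J Y)).comp hJ) (R := |C| / m + 1)
    (fun X hX => by
      have h1 := A.residual_self_ge hτ.le hγ.le hkb hkη hf hf0 hkf φ₀ u₀ (J X)
      rw [← hC] at h1
      have h2 := hmq X
      have h3 : 1 ≤ ‖X‖ := le_trans (by linarith [div_nonneg (abs_nonneg C) hm.le]) hX
      have h4 : |C| + m ≤ m * ‖X‖ := by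
        calc |C| + m = m * (|C| / m + 1) := by field_simp
          _ ≤ m * ‖X‖ := by gcongr
      have h5 : m * ‖X‖ ≤ m * ‖X‖ ^ 2 := by
        have : ‖X‖ ≤ ‖X‖ ^ 2 := by nlinarith
        gcongr
      have h6 := le_abs_self C
      change 0 < A.residual τ γ kb kη kf φ₀ u₀ (J X) (J X)
      linarith)
  obtain ⟨⟨δ, hδ⟩, ⟨μ, hμ⟩, ⟨v, hv⟩⟩ := X
  have hres : ∀ δ' ∈ S, ∀ μ' ∈ S, ∀ v' ∈ Z,
      A.residual τ γ kb kη kf φ₀ u₀ (δ, μ, v) (δ', μ', v') = 0 := fun δ' h1 μ' h2 v' h3 =>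
    LinearMap.congr_fun hX ((⟨δ', h1⟩, ⟨μ', h2⟩, ⟨v', h3⟩) : S × S × Z)
  simp only [residual_apply] at hres
  -- The component of the chemical potential in `W`, fixed by testing the potential equation with
  -- `W`. Adding it changes neither the diffusion nor the coupling terms, which contain only the
  -- gradient of μ.
  obtain ⟨κ, hκ, hκz⟩ := hproj (A.pot kf φ₀ (φ₀ + δ))
  have hφm : (1 / 2 : ℝ) • (φ₀ + (φ₀ + δ)) = φ₀ + (1 / 2 : ℝ) • δ := by module
  have hum : (1 / 2 : ℝ) • (u₀ + ((2 : ℝ) • v - u₀)) = v := by module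
  have hphase : ∀ ψ ∈ S, A.mass δ ψ - τ * A.coup (φ₀ + (1 / 2 : ℝ) • δ) v ψ
      + τ * A.stiff kb (φ₀ + (1 / 2 : ℝ) • δ) μ ψ = 0 := fun ψ hψ => by
    simpa using hres 0 (zero_mem _) ψ hψ 0 (zero_mem _)
  have hpot : ∀ ξ ∈ S, -A.mass μ ξ + γ * A.dir (φ₀ + (1 / 2 : ℝ) • δ) ξ
      + A.pot kf φ₀ (φ₀ + δ) ξ = 0 := fun ξ hξ => by
    simpa using hres ξ hξ 0 (zero_mem _) 0 (zero_mem _)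
  have hmom : ∀ w ∈ Z, _ := fun w hw => hres 0 (zero_mem _) 0 (zero_mem _) w hw
  simp only [map_zero, mul_zero, neg_zero, add_zero, sub_zero, zero_add] at hmom
  -- the pressure
  let ℓ : (Fin d → V) →ₗ[ℝ] ℝ :=
    ∑ i, ((2 : ℝ) • A.mass (v i - u₀ i)
          + (τ / 2) • ((A.coup.flip v).flip (v i) - A.coup (v i) v)
          + τ • A.stiff kη (φ₀ + (1 / 2 : ℝ) • δ) (v i)).comp (LinearMap.proj i)
        + τ • (A.coup (φ₀ + (1 / 2 : ℝ) • δ)).flip μ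
  have hℓ : ∀ w, ℓ w = ∑ i, (2 * A.mass (v i - u₀ i) (w i)
          + (τ / 2) * (A.coup (w i) v (v i) - A.coup (v i) v (w i))
          + τ * A.stiff kη (φ₀ + (1 / 2 : ℝ) • δ) (v i) (w i))
        + τ * A.coup (φ₀ + (1 / 2 : ℝ) • δ) w μ := fun w => by
    simp [ℓ, LinearMap.sum_apply]
  obtain ⟨p, hp⟩ := exists_multiplier D ℓ fun w hw => by rw [hℓ]; exact hmom w hw
  have hcoupκ : ∀ φ w, A.coup φ w (μ + κ) = A.coup φ w μ := fun φ w => by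
    rw [map_add, A.coup_eq_zero_right _ _ (hWdir κ hκ), add_zero]
  have hstiffκ : ∀ φ w, A.stiff kb φ (μ + κ) w = A.stiff kb φ μ w := fun φ w => by
    rw [map_add, LinearMap.add_apply, A.stiff_comm _ _ κ,
      A.stiff_eq_zero_right _ _ _ (hWdir κ hκ), add_zero]
  -- The end velocity is the reflection of u₀ in the midpoint v, so it inherits the divergence
  -- constraint from both. The factor τ⁻¹ compensates the τ in front of the pressure term.
  refine ⟨φ₀ + δ, μ + κ, (2 : ℝ) • v - u₀, τ⁻¹ • (p : V), Q.smul_mem _ p.2, fun q hq => ?_,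
    ⟨fun ψ => ?_, fun ξ => ?_, fun w => ?_, fun q hq => ?_⟩⟩
  · simp [hu₀ q hq, hZ hv q hq]
  · rw [hφm, hum, add_sub_cancel_left]
    -- The equation is known for test functions in `S`. For the part ζ in `W` every term vanishes,
    -- the mass term because δ lies in `S`.
    obtain ⟨ζ, hζ, hψ⟩ := hdecomp ψ
    have h1 := hphase _ hψ
    rw [hstiffκ]
    simp only [map_sub] at h1
    rw [hS hδ ζ hζ, A.coup_eq_zero_right _ _ (hWdir ζ hζ),
      A.stiff_eq_zero_right _ _ _ (hWdir ζ hζ)] at h1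
    linarith
  · rw [hφm]
    obtain ⟨ζ, hζ, hξ⟩ := hdecomp ξ
    have h1 := hpot _ hξ
    have h2 := hκz ζ hζ
    have h3 := hS hξ κ hκ
    have h4 : A.dir (φ₀ + (1 / 2 : ℝ) • δ) ζ = 0 :=
      A.stiff_eq_zero_right _ _ _ (hWdir ζ hζ)
    rw [A.mass_comm] at h3
    simp only [map_sub] at h1 h3
    rw [hS hμ ζ hζ, h4] at h1
    rw [map_add, LinearMap.add_apply]
    linarith
  · rw [hφm, hum]
    have h1 := hp w
    have h2 : D w p = A.div w p := rfl
    rw [hℓ, h2] at h1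
    simp only [Finset.sum_add_distrib, ← Finset.mul_sum, Finset.sum_sub_distrib] at h1
    have h3 : ∑ i, A.mass (((2 : ℝ) • v - u₀) i - u₀ i) (w i)
        = 2 * ∑ i, A.mass (v i - u₀ i) (w i) := by
      rw [Finset.mul_sum]
      refine Finset.sum_congr rfl fun i _ => ?_
      have : ((2 : ℝ) • v - u₀) i - u₀ i = (2 : ℝ) • (v i - u₀ i) := by
        simp only [Pi.sub_apply, Pi.smul_apply]; module
      rw [this, map_smul, LinearMap.smul_apply, smul_eq_mul]
    rw [h3, hcoupκ, map_smul, smul_eq_mul, mul_inv_cancel_left₀ hτ.ne']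
    linarith
  · rw [hum]
    exact hZ hv q hq

end GradientModel

/-! ### The finite element spaces as spaces of functions with gradients -/

section Model

variable {d : ℕ} {a : Pt d} {L : ℝ}

theorem inner_toLp_toLp (p q : Fin d → ℝ) :
    inner ℝ (WithLp.toLp 2 p : Pt d) (WithLp.toLp 2 q) = ∑ i, p i * q i := by
  simp [PiLp.inner_apply, mul_comm]

theorem ipV_comm (F F' : Pt d → Pt d) : ipV a L F F' = ipV a L F' F :=
  integral_congr_ae (.of_forall fun _ => real_inner_comm _ _)

theorem val_sum_smul {ι : Type*} (s : Finset ι) (c : ι → ℝ) (z : ι → L2Pair a L) :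
    val (∑ j ∈ s, c j • z j) =ᵐ[volume.restrict (cube a L)]
      fun x => ∑ j ∈ s, c j * val (z j) x := by
  classical
  induction s using Finset.induction_on with
  | empty =>
    filter_upwards [Lp.coeFn_zero ℝ 2 (volume.restrict (cube a L))] with x hx
    simpa [val] using hx
  | insert j s hj ih =>
    rw [Finset.sum_insert hj]
    filter_upwards [ih, Lp.coeFn_add (c j • z j).1 (∑ j ∈ s, c j • z j).1,
      Lp.coeFn_smul (c j) (z j).1] with x h1 h2 h3
    rw [Finset.sum_insert hj, ← h1]
    refine h2.trans ?_
    rw [Pi.add_apply]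
    congr 1

theorem grad_sum_smul {ι : Type*} (s : Finset ι) (c : ι → ℝ) (z : ι → L2Pair a L) :
    grad (∑ j ∈ s, c j • z j) =ᵐ[volume.restrict (cube a L)]
      fun x => ∑ j ∈ s, c j • grad (z j) x := by
  classical
  induction s using Finset.induction_on with
  | empty =>
    filter_upwards [Lp.coeFn_zero (Pt d) 2 (volume.restrict (cube a L))] with x hx
    simpa [grad] using hx
  | insert j s hj ih =>
    rw [Finset.sum_insert hj]
    filter_upwards [ih, Lp.coeFn_add (c j • z j).2 (∑ j ∈ s, c j • z j).2,
      Lp.coeFn_smul (c j) (z j).2] with x h1 h2 h3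
    rw [Finset.sum_insert hj, ← h1]
    refine h2.trans ?_
    rw [Pi.add_apply]
    congr 1

/-- Elements of Lᵖ are classes, so evaluation at a point is not linear. Representatives are fixed
for a basis only and extended by coordinates; the majorant `G` collects the norms of the coordinate
functionals. -/
theorem exists_gradientModel_of_basis {V α n : Type*} [NormedAddCommGroup V] [NormedSpace ℝ V]
    [FiniteDimensional ℝ V] [MeasurableSpace α] [Fintype n] {ν : Measure α} [IsFiniteMeasure ν]
    (b : Module.Basis n ℝ V) {ρ : n → α → ℝ} {σ : n → α → Pt d} (hρ : ∀ j, Measurable (ρ j))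
    {C : n → ℝ} (hρC : ∀ j x, |ρ j x| ≤ C j) (hσ : ∀ j, Measurable (σ j))
    (hσ2 : ∀ j, MemLp (σ j) 2 ν)
    (h0 : ∀ v, (fun x => ∑ j, b.repr v j * ρ j x) =ᵐ[ν] 0 →
      (fun x => ∑ j, b.repr v j • σ j x) =ᵐ[ν] 0 → v = 0) :
    ∃ A : GradientModel V ν d, (∀ v, A.r v = fun x => ∑ j, b.repr v j * ρ j x) ∧
      ∀ v, A.g v = fun x => ∑ j, b.repr v j • σ j x := by
  let r : V →ₗ[ℝ] α → ℝ := ∑ j, (b.coord j).smulRight (ρ j)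
  let g : V →ₗ[ℝ] α → Pt d := ∑ j, (b.coord j).smulRight (σ j)
  have hr : ∀ v, r v = fun x => ∑ j, b.repr v j * ρ j x := fun v => by
    ext x; simp [r, LinearMap.sum_apply, Finset.sum_apply]
  have hg : ∀ v, g v = fun x => ∑ j, b.repr v j • σ j x := fun v => by
    ext x : 1; simp [g, LinearMap.sum_apply, Finset.sum_apply]
  let c : n → ℝ := fun j => ‖(b.coord j).toContinuousLinearMap‖
  have hc : ∀ v j, |b.repr v j| ≤ c j * ‖v‖ := fun v j =>
    (b.coord j).toContinuousLinearMap.le_opNorm v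
  have hc0 : ∀ j, 0 ≤ c j := fun j => norm_nonneg (b.coord j).toContinuousLinearMap
  have hGm : MemLp (fun x => 1 + ∑ j, c j * ‖σ j x‖) 2 ν := by
    have h1 : ∀ j ∈ Finset.univ, MemLp (fun x => c j * ‖σ j x‖) 2 ν := fun j _ =>
      (hσ2 j).norm.const_mul (c j)
    have h2 : MemLp (fun _ : α => (1 : ℝ)) 2 ν := memLp_const 1
    exact h2.add (memLp_finsetSum Finset.univ h1)
  refine ⟨{ r := r
            g := g
            G := fun x => 1 + ∑ j, c j * ‖σ j x‖
            measurable_r := fun v => ?_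
            measurable_g := fun v => ?_
            one_le_G := fun x => ?_
            memLp_G := ?_
            bound_r := ⟨∑ j, c j * C j, fun v x => ?_⟩
            bound_g := fun v x => ?_
            eq_zero := fun v h1 h2 => h0 v (by rwa [hr] at h1) (by rwa [hg] at h2) }, hr, hg⟩
  · rw [hr]
    exact Finset.measurable_fun_sum _ fun j _ => (hρ j).const_mul _
  · rw [hg]
    exact Finset.measurable_fun_sum _ fun j _ => (hσ j).const_smul (b.repr v j)
  · linarith [Finset.sum_nonneg fun j (_ : j ∈ Finset.univ) =>
      mul_nonneg (hc0 j) (norm_nonneg (σ j x))]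
  · exact hGm
  · rw [hr, Finset.sum_mul]
    refine (Finset.abs_sum_le_sum_abs _ _).trans (Finset.sum_le_sum fun j _ => ?_)
    rw [abs_mul]
    calc |b.repr v j| * |ρ j x| ≤ (c j * ‖v‖) * C j :=
          mul_le_mul (hc v j) (hρC j x) (abs_nonneg _) (mul_nonneg (hc0 j) (norm_nonneg _))
      _ = c j * C j * ‖v‖ := by ring
  · rw [hg, add_mul, Finset.sum_mul]
    have h1 : ‖∑ j, b.repr v j • σ j x‖ ≤ ∑ j, c j * ‖σ j x‖ * ‖v‖ := by
      refine (norm_sum_le _ _).trans (Finset.sum_le_sum fun j _ => ?_)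
      rw [norm_smul, Real.norm_eq_abs]
      calc |b.repr v j| * ‖σ j x‖ ≤ (c j * ‖v‖) * ‖σ j x‖ :=
            mul_le_mul_of_nonneg_right (hc v j) (norm_nonneg _)
        _ = _ := by ring
    have : 0 ≤ 1 * ‖v‖ := by positivity
    linarith

/-- Representatives of the functions in a finite-dimensional space, and of their gradients, which
depend linearly on the function at every point. -/
theorem exists_gradientModel (S : Submodule ℝ (L2Pair a L)) [FiniteDimensional ℝ S]
    (hS : ∀ w ∈ S, ∃ C : ℝ, ∀ᵐ x ∂(volume.restrict (cube a L)), |val w x| ≤ C) :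
    ∃ A : GradientModel S (volume.restrict (cube a L)) d,
      (∀ v : S, val (v : L2Pair a L) =ᵐ[volume.restrict (cube a L)] A.r v) ∧
      ∀ v : S, grad (v : L2Pair a L) =ᵐ[volume.restrict (cube a L)] A.g v := by
  let b := Module.finBasis ℝ S
  choose C hC using fun j => hS _ (b j).2
  have hvm : ∀ w : L2Pair a L, Measurable (val w) := fun w => (Lp.stronglyMeasurable w.1).measurable
  have hgm : ∀ w : L2Pair a L, Measurable (grad w) := fun w => (Lp.stronglyMeasurable w.2).measurable
  -- Cutting off on a null set makes the bound hold everywhere, not only almost everywhere.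
  let ρ : Fin (Module.finrank ℝ S) → Pt d → ℝ := fun j =>
    {x | |val (b j : L2Pair a L) x| ≤ C j}.indicator (val (b j : L2Pair a L))
  have hρb : ∀ j x, |ρ j x| ≤ |C j| := fun j x => by
    by_cases hx : |val (b j : L2Pair a L) x| ≤ C j
    · simp only [ρ, indicator_apply, mem_ofPred_eq, hx, if_true]
      exact hx.trans (le_abs_self _)
    · simp [ρ, mem_ofPred_eq, hx]
  have hρe : ∀ j, ρ j =ᵐ[volume.restrict (cube a L)] val (b j : L2Pair a L) := fun j => by
    filter_upwards [hC j] with x hx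
    simp [ρ, mem_ofPred_eq, hx]
  have hcoe : ∀ v : S, (v : L2Pair a L) = ∑ j, b.repr v j • (b j : L2Pair a L) := fun v => by
    have h1 := congrArg S.subtype (b.sum_repr v).symm
    rw [map_sum] at h1
    exact h1
  have hrv : ∀ v : S, val (v : L2Pair a L) =ᵐ[volume.restrict (cube a L)]
      fun x => ∑ j, b.repr v j * ρ j x := fun v => by
    rw [hcoe v]
    filter_upwards [val_sum_smul Finset.univ (fun j => b.repr v j) fun j => (b j : L2Pair a L),
      ae_all_iff.2 hρe] with x h3 h4
    rw [h3]
    exact Finset.sum_congr rfl fun j _ => by rw [h4 j]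
  have hgv : ∀ v : S, grad (v : L2Pair a L) =ᵐ[volume.restrict (cube a L)]
      fun x => ∑ j, b.repr v j • grad (b j : L2Pair a L) x := fun v => by
    rw [hcoe v]
    exact grad_sum_smul Finset.univ (fun j => b.repr v j) fun j => (b j : L2Pair a L)
  obtain ⟨A, hr, hg⟩ := exists_gradientModel_of_basis (ν := volume.restrict (cube a L)) b
    (fun j => (hvm _).indicator (measurableSet_le (hvm _).abs measurable_const)) hρb
    (fun j => hgm (b j : L2Pair a L)) (fun j => Lp.memLp (b j : L2Pair a L).2)
    fun v h1 h2 => Subtype.ext (Prod.ext (Lp.eq_zero_iff_ae_eq_zero.2 ((hrv v).trans h1))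
      (Lp.eq_zero_iff_ae_eq_zero.2 ((hgv v).trans h2)))
  exact ⟨A, fun v => by rw [hr]; exact hrv v, fun v => by rw [hg]; exact hgv v⟩

/-! ### The forms of the scheme in terms of the representatives -/

variable {V : Type*} [NormedAddCommGroup V] [NormedSpace ℝ V]
  {A : GradientModel V (volume.restrict (cube a L)) d} {ι : V → L2Pair a L}

/-- The functions and gradients of the model represent the finite element functions. -/
structure Represents (A : GradientModel V (volume.restrict (cube a L)) d)
    (ι : V → L2Pair a L) : Prop where
  val_eq : ∀ v : V, val (ι v) =ᵐ[volume.restrict (cube a L)] A.r v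
  grad_eq : ∀ v : V, grad (ι v) =ᵐ[volume.restrict (cube a L)] A.g v

namespace Represents

variable (h : Represents A ι)
include h

theorem vec_eq (u : Fin d → V) :
    vec (fun i => ι (u i)) =ᵐ[volume.restrict (cube a L)] A.vec u := by
  filter_upwards [ae_all_iff.2 fun i => h.val_eq (u i)] with x hx
  simp only [vec, GradientModel.vec, hx]

theorem ipS_val (v w : V) :
    ipS a L (val (ι v)) (val (ι w)) = A.mass v w := by
  refine integral_congr_ae ?_
  filter_upwards [h.val_eq v, h.val_eq w] with x h1 h2
  rw [h1, h2]

theorem ipV_grad (v w : V) :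
    ipV a L (grad (ι v)) (grad (ι w)) = A.dir v w := by
  rw [GradientModel.dir_apply]
  refine integral_congr_ae ?_
  filter_upwards [h.grad_eq v, h.grad_eq w] with x h1 h2
  rw [h1, h2]

theorem ipV_smul_grad (k : C(ℝ, ℝ)) (φ v w : V) :
    ipV a L (fun x => k (val (ι φ) x) • grad (ι v) x)
      (grad (ι w)) = A.stiff k φ v w := by
  refine integral_congr_ae ?_
  filter_upwards [h.val_eq φ, h.grad_eq v, h.grad_eq w] with x h1 h2 h3
  simp only [h1, h2, h3, real_inner_smul_left]

theorem ipV_smul_vec (φ : V) (u : Fin d → V) (w : V) :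
    ipV a L (fun x => val (ι φ) x • vec (fun i => ι (u i)) x)
      (grad (ι w)) = A.coup φ u w := by
  refine integral_congr_ae ?_
  filter_upwards [h.val_eq φ, h.vec_eq u, h.grad_eq w] with x h1 h2 h3
  simp only [h1, h2, h3, real_inner_smul_left]

theorem ipV_vec (u v : Fin d → V) :
    ipV a L (vec fun i => ι (u i)) (vec fun i => ι (v i))
      = ∑ i, A.mass (u i) (v i) := by
  simp only [GradientModel.mass_apply]
  rw [← integral_finsetSum _ fun i _ => A.integrable_mass _ _]
  refine integral_congr_ae ?_
  filter_upwards [h.vec_eq u, h.vec_eq v] with x h1 h2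
  rw [h1, h2]
  exact inner_toLp_toLp _ _

theorem ipV_convect_left (u v w : Fin d → V) :
    ipV a L (convect (fun i => ι (u i)) fun i => ι (v i))
      (vec fun i => ι (w i)) = ∑ i, A.coup (w i) u (v i) := by
  simp only [GradientModel.coup_apply]
  rw [← integral_finsetSum _ fun i _ => A.integrable_coup _ _ _]
  refine integral_congr_ae ?_
  filter_upwards [h.vec_eq u, h.vec_eq w, ae_all_iff.2 fun i => h.grad_eq (v i)] with x h1 h2 h3
  rw [convect, h1, h2, GradientModel.vec, inner_toLp_toLp]
  exact Finset.sum_congr rfl fun i _ => by rw [h3 i, mul_comm]; rfl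

theorem skw_eq (u v w : Fin d → V) :
    skw (fun i => ι (u i)) (fun i => ι (v i)) (fun i => ι (w i))
      = 1 / 2 * (∑ i, A.coup (w i) u (v i) - ∑ i, A.coup (v i) u (w i)) := by
  rw [skw, ipV_comm (vec fun i => ι (v i)), h.ipV_convect_left, h.ipV_convect_left]

theorem integral_mul_gradDot (k : C(ℝ, ℝ)) (φ : V) (u w : Fin d → V) :
    ∫ x in cube a L, k (val (ι φ) x)
        * gradDot (fun i => ι (u i)) (fun i => ι (w i)) x
      = ∑ i, A.stiff k φ (u i) (w i) := by
  simp only [GradientModel.stiff_apply]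
  rw [← integral_finsetSum _ fun i _ => A.integrable_stiff k.continuous _ _ _]
  refine integral_congr_ae ?_
  filter_upwards [h.val_eq φ, ae_all_iff.2 fun i => h.grad_eq (u i),
    ae_all_iff.2 fun i => h.grad_eq (w i)] with x h1 h2 h3
  rw [h1, gradDot, Finset.mul_sum]
  exact Finset.sum_congr rfl fun i _ => by rw [h2, h3]

theorem ipS_divg_val (u : Fin d → V) (q : V) :
    ipS a L (divg fun i => ι (u i)) (val (ι q)) = A.div u q := by
  refine integral_congr_ae ?_
  filter_upwards [h.val_eq q, ae_all_iff.2 fun i => h.grad_eq (u i)] with x h1 h2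
  simp only [divg, h1, h2]

theorem ipS_val_divg (u : Fin d → V) (q : V) :
    ipS a L (val (ι q)) (divg fun i => ι (u i)) = A.div u q := by
  rw [← h.ipS_divg_val]
  exact integral_congr_ae (.of_forall fun x => mul_comm _ _)

theorem ipS_comp_val (k : ℝ → ℝ) (φ ξ : V) :
    ipS a L (fun x => k (val (ι φ) x)) (val (ι ξ))
      = ∫ x in cube a L, k (A.r φ x) * A.r ξ x := by
  refine integral_congr_ae ?_
  filter_upwards [h.val_eq φ, h.val_eq ξ] with x h1 h2
  simp only [h1, h2]

theorem energy_eq (γ : ℝ) {f : ℝ → ℝ} (hf : Continuous f) (φ : V) (u : Fin d → V) :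
    CHNS.energy γ f (ι φ) (fun i => ι (u i)) = A.energy γ f φ u := by
  have h1 : ∀ i ∈ (Finset.univ : Finset (Fin d)),
      Integrable (fun x => A.r (u i) x * A.r (u i) x) (volume.restrict (cube a L)) :=
    fun i _ => A.integrable_mass _ _
  simp only [GradientModel.energy, GradientModel.mass_apply, GradientModel.dir_apply]
  rw [← integral_finsetSum _ h1, ← integral_const_mul, ← integral_const_mul,
    ← integral_add' ((A.integrable_inner_g φ φ).const_mul _) (A.integrable_comp hf φ),
    ← integral_add' (((A.integrable_inner_g φ φ).const_mul _).add (A.integrable_comp hf φ))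
      ((integrable_finsetSum _ h1).const_mul _)]
  refine integral_congr_ae ?_
  filter_upwards [h.val_eq φ, h.vec_eq u, h.grad_eq φ] with x h1 h2 h3
  have h4 : ‖A.vec u x‖ ^ 2 = ∑ i, A.r (u i) x * A.r (u i) x := by
    rw [← real_inner_self_eq_norm_sq]
    exact inner_toLp_toLp _ _
  rw [h1, h2, h3, h4]
  simp only [real_inner_self_eq_norm_sq, Pi.add_apply]

theorem dissipation_eq (kb kη : C(ℝ, ℝ)) (φ μ : V) (u : Fin d → V) :
    dissipation kb kη (ι φ) (ι μ) (fun i => ι (u i))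
      = A.stiff kb φ μ μ + ∑ i, A.stiff kη φ (u i) (u i) := by
  simp only [GradientModel.stiff_apply]
  have h1 : ∀ i ∈ (Finset.univ : Finset (Fin d)),
      Integrable (fun x => kη (A.r φ x) * inner ℝ (A.g (u i) x) (A.g (u i) x))
        (volume.restrict (cube a L)) :=
    fun i _ => A.integrable_stiff kη.continuous _ _ _
  rw [← integral_finsetSum _ h1, ← integral_add (A.integrable_stiff kb.continuous _ _ _)
    (integrable_finsetSum _ h1)]
  refine integral_congr_ae ?_
  filter_upwards [h.val_eq φ, h.grad_eq μ, ae_all_iff.2 fun i => h.grad_eq (u i)] with x h1 h2 h3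
  simp only [h1, h2, h3, gradDot, real_inner_self_eq_norm_sq, Finset.mul_sum]

end Represents

end Model

/-! ### Functions on the time grid -/

section Slab

variable {X : Type*} [NormedAddCommGroup X] [NormedSpace ℝ X] {T : ℝ} {N : ℕ}

theorem node_succ (T : ℝ) (N n : ℕ) : node T N (n + 1) = node T N n + T / N := by
  simp only [node]; push_cast; ring

/-- On the slab `n`, the function is affine with the given values at the end points. -/
def SlabAffine (T : ℝ) (N n : ℕ) (w : ℝ → X) (w₀ w₁ : X) : Prop :=
  ∀ θ ∈ Ioo (0 : ℝ) 1, w (node T N n + T / N * θ) = w₀ + θ • (w₁ - w₀)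

/-- On the slab `n`, the function is constant. -/
def SlabConst {X : Type*} (T : ℝ) (N n : ℕ) (w : ℝ → X) (c : X) : Prop :=
  ∀ θ ∈ Ioo (0 : ℝ) 1, w (node T N n + T / N * θ) = c

theorem exists_of_mem_slab (hτ : 0 < T / N) {n : ℕ} {t : ℝ}
    (ht : t ∈ Ioo (node T N n) (node T N (n + 1))) :
    ∃ θ ∈ Ioo (0 : ℝ) 1, t = node T N n + T / N * θ := by
  rw [node_succ] at ht
  refine ⟨(t - node T N n) / (T / N), ⟨div_pos (by linarith [ht.1]) hτ, ?_⟩, ?_⟩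
  · rw [div_lt_one hτ]; linarith [ht.2]
  · rw [mul_div_cancel₀ _ hτ.ne']; ring

theorem mem_slab (hτ : 0 < T / N) (n : ℕ) {θ : ℝ} (hθ : θ ∈ Ioo (0 : ℝ) 1) :
    node T N n + T / N * θ ∈ Ioo (node T N n) (node T N (n + 1)) := by
  rw [node_succ]
  exact ⟨by linarith [mul_pos hτ hθ.1], by nlinarith [hθ.2]⟩

theorem node_mem_Icc (hT : 0 ≤ T) (hN : 0 < N) {n : ℕ} (hn : n ≤ N) :
    node T N n ∈ Icc 0 T := by
  have hN' : (0 : ℝ) < N := by exact_mod_cast hN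
  have hn' : (n : ℝ) ≤ N := by exact_mod_cast hn
  refine ⟨mul_nonneg n.cast_nonneg (div_nonneg hT hN'.le), ?_⟩
  calc node T N n = n * (T / N) := rfl
    _ ≤ N * (T / N) := mul_le_mul_of_nonneg_right hn' (div_nonneg hT hN'.le)
    _ = T := by field_simp

/-- Rescaling to the unit interval. Only interior points matter, as piecewise polynomials are not
constrained at the nodes. -/
theorem slab_congr {n : ℕ} {F F' : ℝ → ℝ}
    (h : ∀ θ ∈ Ioo (0 : ℝ) 1, F (node T N n + T / N * θ) = F' θ) :
    slab T N n F = T / N * ∫ θ in (0 : ℝ)..1, F' θ := by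
  have h1 := intervalIntegral.smul_integral_comp_add_mul (a := 0) (b := 1) F (T / N) (node T N n)
  rw [mul_zero, add_zero, mul_one, ← node_succ] at h1
  rw [slab, ← h1, smul_eq_mul]
  congr 1
  exact intervalIntegral.integral_congr_Ioo_of_le zero_le_one h

theorem slab_of_const {n : ℕ} {F : ℝ → ℝ} {c : ℝ}
    (h : SlabConst T N n F c) : slab T N n F = T / N * c := by
  rw [slab_congr h]; simp

theorem integral_segment [CompleteSpace X] (w₀ w₁ : X) :
    ∫ θ in (0 : ℝ)..1, (w₀ + θ • (w₁ - w₀)) = (1 / 2 : ℝ) • (w₀ + w₁) := by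
  have h1 : IntervalIntegrable (fun θ : ℝ => θ • (w₁ - w₀)) volume 0 1 :=
    Continuous.intervalIntegrable (by fun_prop) _ _
  rw [intervalIntegral.integral_add (by simp) h1, intervalIntegral.integral_smul_const,
    integral_id]
  simp only [intervalIntegral.integral_const, sub_zero, one_smul]
  module

theorem slab_of_affine {n : ℕ} {F : ℝ → ℝ} {c₀ c₁ : ℝ}
    (h : SlabAffine T N n F c₀ c₁) : slab T N n F = T / N * (1 / 2 * (c₀ + c₁)) := by
  rw [slab_congr h, integral_segment, smul_eq_mul]

theorem SlabAffine.deriv_eq {n : ℕ} (hτ : 0 < T / N) {w : ℝ → X} {w₀ w₁ : X}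
    (h : SlabAffine T N n w w₀ w₁) : SlabConst T N n (deriv w) ((T / N)⁻¹ • (w₁ - w₀)) := by
  intro θ hθ
  set t := node T N n + T / N * θ with ht
  have h1 : w =ᶠ[nhds t] fun s => w₀ + ((s - node T N n) / (T / N)) • (w₁ - w₀) := by
    filter_upwards [Ioo_mem_nhds (mem_slab hτ n hθ).1 (mem_slab hτ n hθ).2] with s hs
    obtain ⟨θ', hθ', rfl⟩ := exists_of_mem_slab hτ hs
    rw [h θ' hθ', add_sub_cancel_left, mul_div_cancel_left₀ _ hτ.ne']
  rw [h1.deriv_eq]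
  have h2 : HasDerivAt (fun s => w₀ + ((s - node T N n) / (T / N)) • (w₁ - w₀))
      ((1 / (T / N)) • (w₁ - w₀)) t :=
    ((((hasDerivAt_id t).sub_const _).div_const _).smul_const _).const_add _
  rw [h2.deriv, one_div]

theorem node_add_div (hτ : 0 < T / N) (n : ℕ) (θ : ℝ) :
    (node T N n + T / N * θ) / (T / N) = n + θ := by
  rw [add_div, mul_div_cancel_left₀ _ hτ.ne', node, mul_div_cancel_right₀ _ hτ.ne']

theorem SlabAffine.timeProj_eq [CompleteSpace X] {n : ℕ} (hτ : 0 < T / N) {w : ℝ → X} {w₀ w₁ : X}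
    (h : SlabAffine T N n w w₀ w₁) :
    SlabConst T N n (timeProj T N w) ((1 / 2 : ℝ) • (w₀ + w₁)) := by
  intro θ hθ
  have hfl : ⌊(node T N n + T / N * θ) / (T / N)⌋ = (n : ℤ) := by
    rw [node_add_div hτ, Int.floor_eq_iff]
    push_cast
    exact ⟨by linarith [hθ.1], by linarith [hθ.2]⟩
  have h1 := intervalIntegral.smul_integral_comp_add_mul (a := 0) (b := 1) w (T / N) (node T N n)
  rw [mul_zero, add_zero, mul_one] at h1
  have h2 : ((n : ℤ) + 1 : ℝ) * (T / N) = node T N n + T / N := by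
    rw [node]; push_cast; ring
  have h3 : ∫ θ in (0 : ℝ)..1, w (node T N n + T / N * θ)
      = ∫ θ in (0 : ℝ)..1, (w₀ + θ • (w₁ - w₀)) :=
    intervalIntegral.integral_congr_Ioo_of_le zero_le_one h
  rw [timeProj, hfl, h2]
  change (T / N)⁻¹ • ∫ s in (node T N n)..(node T N n + T / N), w s = _
  rw [← h1, inv_smul_smul₀ hτ.ne', h3, integral_segment]

theorem exists_slabConst (hτ : 0 < T / N) {w : ℝ → X} (hw : IsPiecewisePoly T N 0 w) {n : ℕ}
    (hn : n < N) : ∃ c, SlabConst T N n w c := by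
  obtain ⟨c, hc⟩ := hw n hn
  exact ⟨c 0, fun θ hθ => by simpa using hc _ (mem_slab hτ n hθ)⟩

theorem isPiecewisePoly_const (c : X) : IsPiecewisePoly T N 0 fun _ => c :=
  fun _ _ => ⟨fun _ => c, fun _ _ => by simp⟩

theorem isPiecewisePoly_of_slabConst (hτ : 0 < T / N) {w : ℝ → X}
    (h : ∀ n < N, ∃ c, SlabConst T N n w c) : IsPiecewisePoly T N 0 w := by
  intro n hn
  obtain ⟨c, hc⟩ := h n hn
  refine ⟨fun _ => c, fun t ht => ?_⟩
  obtain ⟨θ, hθ, rfl⟩ := exists_of_mem_slab hτ ht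
  simpa using hc θ hθ

theorem isPiecewisePoly_of_slabAffine (hτ : 0 < T / N) {w : ℝ → X}
    (h : ∀ n < N, ∃ c₀ c₁, SlabAffine T N n w c₀ c₁) : IsPiecewisePoly T N 1 w := by
  intro n hn
  obtain ⟨c₀, c₁, hc⟩ := h n hn
  refine ⟨fun j => if j = 0 then c₀ - (node T N n / (T / N)) • (c₁ - c₀)
    else (T / N)⁻¹ • (c₁ - c₀), fun t ht => ?_⟩
  obtain ⟨θ, hθ, rfl⟩ := exists_of_mem_slab hτ ht
  have h1 : (node T N n + T / N * θ) * (T / N)⁻¹ = node T N n / (T / N) + θ := by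
    rw [← div_eq_mul_inv, add_div, mul_div_cancel_left₀ _ hτ.ne']
  rw [hc θ hθ]
  simp only [Finset.sum_range_succ, Finset.sum_range_zero, pow_zero, pow_one, if_true,
    one_ne_zero, if_false, smul_smul, h1]
  module

/-- The affine formula holds on the open slab and extends to its closure by continuity, which
identifies the coefficients with the nodal values. -/
theorem CHNS.IsContPiecewisePoly.slabAffine (hT : 0 < T) (hN : 0 < N) {w : ℝ → X}
    (hw : IsContPiecewisePoly T N 1 w) {n : ℕ} (hn : n < N) :
    SlabAffine T N n w (w (node T N n)) (w (node T N (n + 1))) := by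
  have hN' : (0 : ℝ) < N := by exact_mod_cast hN
  have hτ : 0 < T / N := div_pos hT hN'
  obtain ⟨c, hc⟩ := hw.1 n hn
  have hlt : node T N n < node T N (n + 1) := by rw [node_succ]; linarith
  have heq : EqOn w (fun t => c 0 + t • c 1) (Icc (node T N n) (node T N (n + 1))) := by
    refine EqOn.of_subset_closure (s := Ioo (node T N n) (node T N (n + 1))) (fun t ht => ?_)
      (hw.2.mono (Icc_subset_Icc (node_mem_Icc hT.le hN hn.le).1 (node_mem_Icc hT.le hN hn).2))
      (by fun_prop) Ioo_subset_Icc_self (by rw [closure_Ioo hlt.ne])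
    rw [hc t ht]
    simp [Finset.sum_range_succ]
  intro θ hθ
  rw [heq (left_mem_Icc.2 hlt.le), heq (right_mem_Icc.2 hlt.le),
    heq (Ioo_subset_Icc_self (mem_slab hτ n hθ))]
  simp only [node_succ]
  module

/-- The mean of `k` over a segment, as a function of the end points. -/
noncomputable def segmentMean (k : C(ℝ, ℝ)) : C(ℝ × ℝ, ℝ) where
  toFun p := ∫ θ in (0 : ℝ)..1, k (p.1 + θ * (p.2 - p.1))
  continuous_toFun := by
    refine intervalIntegral.continuous_parametric_intervalIntegral_of_continuous'
      (f := fun (p : ℝ × ℝ) θ => k (p.1 + θ * (p.2 - p.1))) ?_ 0 1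
    simp only [Function.uncurry_def]
    fun_prop

/-- The fundamental theorem of calculus along the segment from p to q. Exact time integration of
f'(φ) is what makes the energy balance an equality. -/
theorem segmentMean_mul {f : ℝ → ℝ} {k : C(ℝ, ℝ)} (hf : ∀ s, HasDerivAt f (k s) s) (p q : ℝ) :
    segmentMean k (p, q) * (q - p) = f q - f p := by
  have h1 : ∀ θ ∈ uIcc (0 : ℝ) 1, HasDerivAt (fun θ => f (p + θ * (q - p)))
      (k (p + θ * (q - p)) * (q - p)) θ := fun θ _ => by
    have h2 : HasDerivAt (fun θ : ℝ => p + θ * (q - p)) (1 * (q - p)) θ :=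
      ((hasDerivAt_id θ).mul_const _).const_add _
    rw [one_mul] at h2
    exact (hf _).comp θ h2
  have h2 := intervalIntegral.integral_eq_sub_of_hasDerivAt h1
    (by exact Continuous.intervalIntegrable (by fun_prop) _ _)
  rw [intervalIntegral.integral_mul_const] at h2
  simpa [segmentMean] using h2

end Slab

/-! ### The terms of the scheme on one slab -/

namespace Represents

variable {d : ℕ} {a : Pt d} {L : ℝ} {V : Type*} [NormedAddCommGroup V] [NormedSpace ℝ V]
  {A : GradientModel V (volume.restrict (cube a L)) d} {ι : V → L2Pair a L}
  {T : ℝ} {N n : ℕ}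

theorem slab_mass_deriv (h : Represents A ι) (hτ : 0 < T / N) {φ ψ : ℝ → V} {φ₀ φ₁ c : V}
    (hφ : SlabAffine T N n φ φ₀ φ₁) (hψ : SlabConst T N n ψ c) :
    slab T N n (fun s => ipS a L (val (ι (deriv φ s))) (val (ι (ψ s)))) = A.mass (φ₁ - φ₀) c := by
  rw [slab_of_const (c := (T / N)⁻¹ * A.mass (φ₁ - φ₀) c) fun θ hθ => ?_,
    mul_inv_cancel_left₀ hτ.ne']
  simp only [hφ.deriv_eq hτ θ hθ, hψ θ hθ, h.ipS_val, map_smul, LinearMap.smul_apply, smul_eq_mul]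

theorem slab_mass (h : Represents A ι) {μ ψ : ℝ → V} {m c : V}
    (hμ : SlabConst T N n μ m) (hψ : SlabConst T N n ψ c) :
    slab T N n (fun s => ipS a L (val (ι (μ s))) (val (ι (ψ s)))) = T / N * A.mass m c :=
  slab_of_const fun θ hθ => by simp only [hμ θ hθ, hψ θ hθ, h.ipS_val]

theorem slab_dir (h : Represents A ι) {φ ψ : ℝ → V} {φ₀ φ₁ c : V}
    (hφ : SlabAffine T N n φ φ₀ φ₁) (hψ : SlabConst T N n ψ c) :
    slab T N n (fun s => ipV a L (grad (ι (φ s))) (grad (ι (ψ s))))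
      = T / N * A.dir ((1 / 2 : ℝ) • (φ₀ + φ₁)) c := by
  rw [slab_of_affine (c₀ := A.dir φ₀ c) (c₁ := A.dir φ₁ c) fun θ hθ => ?_]
  · simp only [map_smul, map_add, LinearMap.smul_apply, LinearMap.add_apply, smul_eq_mul]
  · simp only [hφ θ hθ, hψ θ hθ, h.ipV_grad, map_smul, map_add, map_sub, LinearMap.smul_apply,
      LinearMap.add_apply, LinearMap.sub_apply]

/-- Velocity and test function are constant on the slab, so the integrand is affine in time and its
mean is the value at the midpoint. -/
theorem slab_coup (h : Represents A ι) {φ ψ : ℝ → V} {φ₀ φ₁ c : V}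
    {u : ℝ → VecPair a L} {v : Fin d → V}
    (hφ : SlabAffine T N n φ φ₀ φ₁) (hu : SlabConst T N n u fun i => ι (v i))
    (hψ : SlabConst T N n ψ c) :
    slab T N n (fun s => ipV a L (fun x => val (ι (φ s)) x • vec (u s) x) (grad (ι (ψ s))))
      = T / N * A.coup ((1 / 2 : ℝ) • (φ₀ + φ₁)) v c := by
  rw [slab_of_affine (c₀ := A.coup φ₀ v c) (c₁ := A.coup φ₁ v c) fun θ hθ => ?_]
  · simp only [map_smul, map_add, LinearMap.smul_apply, LinearMap.add_apply, smul_eq_mul]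
  · simp only [hφ θ hθ, hu θ hθ, hψ θ hθ, h.ipV_smul_vec, map_smul, map_add, map_sub,
      LinearMap.smul_apply, LinearMap.add_apply, LinearMap.sub_apply]

theorem slab_stiff (h : Represents A ι) (k : C(ℝ, ℝ)) {φ : ℝ → L2Pair a L}
    {μ ψ : ℝ → V} {φm m c : V} (hφ : SlabConst T N n φ (ι φm)) (hμ : SlabConst T N n μ m)
    (hψ : SlabConst T N n ψ c) :
    slab T N n (fun s => ipV a L (fun x => k (val (φ s) x) • grad (ι (μ s)) x) (grad (ι (ψ s))))
      = T / N * A.stiff k φm m c :=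
  slab_of_const fun θ hθ => by simp only [hφ θ hθ, hμ θ hθ, hψ θ hθ, h.ipV_smul_grad]

/-- The only term that is nonlinear in time. Fubini moves the time integral inside, where at each x
it averages k over the segment between the two nodal values. -/
theorem slab_pot (h : Represents A ι) (k : C(ℝ, ℝ)) {φ ψ : ℝ → V}
    {φ₀ φ₁ c : V} (hφ : SlabAffine T N n φ φ₀ φ₁) (hψ : SlabConst T N n ψ c) :
    slab T N n (fun s => ipS a L (fun x => k (val (ι (φ s)) x)) (val (ι (ψ s))))
      = T / N * A.pot (segmentMean k) φ₀ φ₁ c := by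
  let K : ℝ → Pt d → ℝ := fun θ x => k (A.r φ₀ x + θ * (A.r φ₁ x - A.r φ₀ x)) * A.r c x
  have hK : ∀ θ x, K θ x = k (A.r (φ₀ + θ • (φ₁ - φ₀)) x) * A.r c x := fun θ x => by
    simp [K]
  have hint : Integrable (Function.uncurry K)
      ((volume.restrict (uIoc (0 : ℝ) 1)).prod (volume.restrict (cube a L))) := by
    have hdom : Dominated A.G 0 K := by
      have h1 := ((A.dominated_r (X := ℝ) (ℓ := fun θ : ℝ => φ₀ + θ • (φ₁ - φ₀))
        (by fun_prop)).comp_continuous k.continuous).mul A.one_le_G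
        (A.dominated_r (X := ℝ) (continuous_const (y := c)))
      have h2 : K = fun θ x => k (A.r (φ₀ + θ • (φ₁ - φ₀)) x) * A.r c x :=
        funext₂ hK
      rw [h2]
      exact h1
    obtain ⟨C, -, hC⟩ := hdom.bound 1
    have hm : Measurable (Function.uncurry K) := by
      have h0 := A.measurable_r φ₀
      have h1 := A.measurable_r φ₁
      have h2 := A.measurable_r c
      have h3 := k.continuous.measurable
      simp only [K, Function.uncurry_def]
      fun_prop
    have : IsFiniteMeasure (volume.restrict (uIoc (0 : ℝ) 1)) := by
      rw [uIoc_of_le zero_le_one]; infer_instance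
    refine Integrable.of_bound hm.aestronglyMeasurable C ?_
    rw [← Measure.restrict_univ (μ := volume.restrict (cube a L)), Measure.prod_restrict]
    refine (ae_restrict_iff' (measurableSet_uIoc.prod MeasurableSet.univ)).2 (.of_forall ?_)
    rintro ⟨θ, x⟩ ⟨hθ, -⟩
    rw [uIoc_of_le zero_le_one] at hθ
    have := hC θ (by rw [Real.norm_eq_abs, abs_of_pos hθ.1]; exact hθ.2) x
    simpa using this
  rw [slab_congr (F' := fun θ => ∫ x in cube a L, K θ x) fun θ hθ => ?_,
    intervalIntegral_integral_swap hint]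
  · congr 1
    refine integral_congr_ae (.of_forall fun x => ?_)
    simp only [K]
    rw [intervalIntegral.integral_mul_const]
    rfl
  · simp only [hφ θ hθ, hψ θ hθ, hK]
    exact h.ipS_comp_val k _ _

theorem slab_vec_deriv (h : Represents A ι) (hτ : 0 < T / N) {u v : ℝ → Fin d → V}
    {u₀ u₁ w : Fin d → V} (hu : SlabAffine T N n u u₀ u₁) (hv : SlabConst T N n v w) :
    slab T N n (fun s => ipV a L (vec fun i => ι (deriv u s i)) (vec fun i => ι (v s i)))
      = ∑ i, A.mass (u₁ i - u₀ i) (w i) := by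
  rw [slab_of_const (c := (T / N)⁻¹ * ∑ i, A.mass (u₁ i - u₀ i) (w i)) fun θ hθ => ?_,
    mul_inv_cancel_left₀ hτ.ne']
  simp only [hu.deriv_eq hτ θ hθ, hv θ hθ, h.ipV_vec, Pi.smul_apply, Pi.sub_apply, map_smul,
    LinearMap.smul_apply, smul_eq_mul, Finset.mul_sum]

theorem slab_skw (h : Represents A ι) {u v : ℝ → Fin d → V}
    {ū : ℝ → VecPair a L} {u₀ u₁ m w : Fin d → V} (hu : SlabAffine T N n u u₀ u₁)
    (hū : SlabConst T N n ū fun i => ι (m i)) (hv : SlabConst T N n v w) :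
    slab T N n (fun s => skw (fun i => ι (u s i)) (ū s) fun i => ι (v s i))
      = T / N * (1 / 2 * (∑ i, A.coup (w i) ((1 / 2 : ℝ) • (u₀ + u₁)) (m i)
          - ∑ i, A.coup (m i) ((1 / 2 : ℝ) • (u₀ + u₁)) (w i))) := by
  rw [slab_of_affine
    (c₀ := 1 / 2 * (∑ i, A.coup (w i) u₀ (m i) - ∑ i, A.coup (m i) u₀ (w i)))
    (c₁ := 1 / 2 * (∑ i, A.coup (w i) u₁ (m i) - ∑ i, A.coup (m i) u₁ (w i))) fun θ hθ => ?_]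
  · simp only [map_smul, map_add, LinearMap.smul_apply, LinearMap.add_apply, smul_eq_mul,
      ← Finset.mul_sum, Finset.sum_add_distrib]
    ring
  · simp only [hu θ hθ, hū θ hθ, hv θ hθ, h.skw_eq, map_smul, map_add, map_sub,
      LinearMap.smul_apply, LinearMap.add_apply, LinearMap.sub_apply, smul_eq_mul,
      Finset.sum_add_distrib, Finset.sum_sub_distrib, ← Finset.mul_sum]
    ring

theorem slab_visc (h : Represents A ι) (k : C(ℝ, ℝ)) {φ : ℝ → L2Pair a L}
    {v : ℝ → Fin d → V} {ū : ℝ → VecPair a L} {φm : V} {m w : Fin d → V}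
    (hφ : SlabConst T N n φ (ι φm)) (hū : SlabConst T N n ū fun i => ι (m i))
    (hv : SlabConst T N n v w) :
    slab T N n (fun s => ∫ x in cube a L, k (val (φ s) x)
        * gradDot (ū s) (fun i => ι (v s i)) x)
      = T / N * ∑ i, A.stiff k φm (m i) (w i) :=
  slab_of_const fun θ hθ => by simp only [hφ θ hθ, hū θ hθ, hv θ hθ, h.integral_mul_gradDot]

theorem slab_pressure (h : Represents A ι) {p : ℝ → L2Pair a L}
    {v : ℝ → Fin d → V} {q : V} {w : Fin d → V}
    (hp : SlabConst T N n p (ι q)) (hv : SlabConst T N n v w) :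
    slab T N n (fun s => ipS a L (val (p s)) (divg fun i => ι (v s i)))
      = T / N * A.div w q :=
  slab_of_const fun θ hθ => by simp only [hp θ hθ, hv θ hθ, h.ipS_val_divg]

theorem slab_div (h : Represents A ι) {p : ℝ → L2Pair a L}
    {u : ℝ → Fin d → V} {q : V} {u₀ u₁ : Fin d → V}
    (hu : SlabAffine T N n u u₀ u₁) (hp : SlabConst T N n p (ι q)) :
    slab T N n (fun s => ipS a L (divg fun i => ι (u s i)) (val (p s)))
      = T / N * A.div ((1 / 2 : ℝ) • (u₀ + u₁)) q := by
  rw [slab_of_affine (c₀ := A.div u₀ q) (c₁ := A.div u₁ q) fun θ hθ => ?_]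
  · simp only [map_smul, map_add, LinearMap.smul_apply, LinearMap.add_apply, smul_eq_mul]
  · simp only [hu θ hθ, hp θ hθ, h.ipS_divg_val, map_smul, map_add, map_sub, LinearMap.smul_apply,
      LinearMap.add_apply, LinearMap.sub_apply]

end Represents

/-! ### The scheme as a sequence of time steps -/

section Scheme

variable {d : ℕ} {a : Pt d} {L : ℝ} {M : PeriodicMesh d a L}

theorem FE_mono {k l : ℕ} (hkl : k ≤ l) : FE M k ≤ FE M l := fun _ hw =>
  ⟨hw.1, fun K hK => (hw.2 K hK).imp fun _ hP => ⟨hP.1.trans hkl, hP.2⟩⟩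

/-- The pressure space as a subspace of the space of piecewise quadratic functions. -/
noncomputable def pressureSpace (M : PeriodicMesh d a L) : Submodule ℝ (Vh M) := (Qh M).comap (Vh M).subtype

/-- A discrete pressure as a piecewise quadratic function. -/
noncomputable def pressureIncl (q : Qh M) : Vh M := ⟨q, FE_mono one_le_two q.2.1⟩

theorem pressureIncl_mem (q : Qh M) : pressureIncl q ∈ pressureSpace M := q.2

/-- The inclusion of the finite element functions. -/
noncomputable def coeVh (M : PeriodicMesh d a L) (v : Vh M) : L2Pair a L := v

variable {A : GradientModel (Vh M) (volume.restrict (cube a L)) d} {T : ℝ} {N n : ℕ}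

theorem slabConst_timeProj_coe (hτ : 0 < T / N) {φ : ℝ → Vh M} {φ₀ φ₁ : Vh M}
    (hφ : SlabAffine T N n φ φ₀ φ₁) :
    SlabConst T N n (timeProj T N fun r => (φ r : L2Pair a L))
      (coeVh M ((1 / 2 : ℝ) • (φ₀ + φ₁))) := by
  have h1 : SlabAffine T N n (fun r => (φ r : L2Pair a L)) (φ₀ : L2Pair a L) (φ₁ : L2Pair a L) :=
    fun θ hθ => congrArg Subtype.val (hφ θ hθ)
  exact h1.timeProj_eq hτ

theorem slabConst_timeProj_coe_pi (hτ : 0 < T / N) {u : ℝ → Fin d → Vh M} {u₀ u₁ : Fin d → Vh M}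
    (hu : SlabAffine T N n u u₀ u₁) :
    SlabConst T N n (timeProj T N fun r i => (u r i : L2Pair a L))
      (fun i => coeVh M (((1 / 2 : ℝ) • (u₀ + u₁)) i)) := by
  have h1 : SlabAffine T N n (fun r i => (u r i : L2Pair a L)) (fun i => (u₀ i : L2Pair a L))
      (fun i => (u₁ i : L2Pair a L)) :=
    fun θ hθ => funext fun i => congrArg Subtype.val (congrFun (hu θ hθ) i)
  exact h1.timeProj_eq hτ

theorem slabConst_const {X : Type*} (c : X) : SlabConst T N n (fun _ : ℝ => c) c := fun _ _ => rfl

theorem mul_mul_add_mul (γ τ x y : ℝ) : γ * (τ * x) + τ * y = τ * (γ * x + y) := by ring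

/-- On every slab, a solution of the scheme performs a time step. -/
theorem CHNS.IsSchemeSolution.exists_isStep (h : Represents A (coeVh M)) (hT : 0 < T)
    {γ : ℝ} {kb kη kf : C(ℝ, ℝ)} {f : ℝ → ℝ} (hkf : deriv f = kf)
    {φ μ : ℝ → Vh M} {u : ℝ → Fin d → Vh M} {p : ℝ → Qh M}
    (hs : IsSchemeSolution M T N γ kb f kη φ μ u p) (hn : n < N) :
    ∃ m, SlabConst T N n μ m ∧ ∃ q ∈ pressureSpace M,
      A.IsStep (T / N) γ kb kη (segmentMean kf) (pressureSpace M) (φ (node T N n))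
        (φ (node T N (n + 1))) m (u (node T N n)) (u (node T N (n + 1))) q := by
  have hN : 0 < N := n.zero_le.trans_lt hn
  have hτ : 0 < T / N := div_pos hT (by exact_mod_cast hN)
  have hφ := hs.phi_mem.slabAffine hT hN hn
  have hu := hs.u_mem.slabAffine hT hN hn
  obtain ⟨m, hm⟩ := exists_slabConst hτ hs.mu_mem hn
  obtain ⟨q, hq⟩ := exists_slabConst hτ hs.p_mem hn
  have hq' : SlabConst T N n (fun s => (p s : L2Pair a L)) (coeVh M (pressureIncl q)) :=
    fun θ hθ => congrArg Subtype.val (hq θ hθ)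
  have hφm := slabConst_timeProj_coe hτ hφ
  have hum := slabConst_timeProj_coe_pi hτ hu
  refine ⟨m, hm, pressureIncl q, pressureIncl_mem q, ⟨fun ψ => ?_, fun ξ => ?_, fun w => ?_,
    fun r hr => ?_⟩⟩
  -- Test functions that are constant in time on all slabs suffice, because only their value on the
  -- current slab matters.
  · have hψ : SlabConst T N n (fun _ : ℝ => ψ) ψ := slabConst_const ψ
    have e := hs.phase (fun _ => ψ) (isPiecewisePoly_const ψ) n hn
    have e1 := h.slab_mass_deriv hτ hφ hψ
    have e2 := h.slab_coup hφ hum hψ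
    have e3 := h.slab_stiff kb hφm hm hψ
    exact e1.symm.trans (e.trans (congrArg₂ (· - ·) e2 e3))
  · have hξ : SlabConst T N n (fun _ : ℝ => ξ) ξ := slabConst_const ξ
    have e := hs.potential (fun _ => ξ) (isPiecewisePoly_const ξ) n hn
    rw [hkf] at e
    have e1 := h.slab_mass hm hξ
    have e2 := h.slab_dir hφ hξ
    have e3 := h.slab_pot kf hφ hξ
    have e4 := e1.symm.trans (e.trans (congrArg₂ (fun x y => γ * x + y) e2 e3))
    exact mul_left_cancel₀ hτ.ne' (e4.trans (mul_mul_add_mul _ _ _ _))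
  · have hw : SlabConst T N n (fun _ : ℝ => w) w := slabConst_const w
    have hw' : SlabConst T N n (fun (_ : ℝ) i => coeVh M (w i)) fun i => coeVh M (w i) :=
      slabConst_const _
    have e := hs.momentum (fun _ => w) (isPiecewisePoly_const w) n hn
    have e1 := h.slab_vec_deriv hτ hu hw
    have e2 := h.slab_skw hu hum hw
    have e3 := h.slab_visc kη hφm hum hw
    have e4 := h.slab_pressure hq' hw
    have e5 := h.slab_coup hφ hw' hm
    exact e1.symm.trans (e.trans (congrArg₂ (· - ·) (congrArg₂ (· + ·)
      (congrArg₂ (fun x y => -x - y) e2 e3) e4) e5))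
  · have e := hs.incompressible (fun _ => ⟨r, hr⟩) (isPiecewisePoly_const _) n hn
    have e1 := h.slab_div hu (slabConst_const (T := T) (N := N) (n := n) (coeVh M r))
    exact (mul_eq_zero.1 (e1.symm.trans e)).resolve_left hτ.ne'

/-- Functions which perform a time step on every slab solve the scheme. -/
theorem isSchemeSolution_of_isStep (h : Represents A (coeVh M)) (hT : 0 < T) (hN : 0 < N)
    {γ : ℝ} {kb kη kf : C(ℝ, ℝ)} {f : ℝ → ℝ} (hkf : deriv f = kf)
    {φ μ : ℝ → Vh M} {u : ℝ → Fin d → Vh M} {p : ℝ → Qh M} (hφc : Continuous φ)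
    (huc : Continuous u) {Φ m : ℕ → Vh M} {U : ℕ → Fin d → Vh M} {q : ℕ → Qh M}
    (hφ : ∀ n < N, SlabAffine T N n φ (Φ n) (Φ (n + 1)))
    (hu : ∀ n < N, SlabAffine T N n u (U n) (U (n + 1)))
    (hm : ∀ n < N, SlabConst T N n μ (m n)) (hq : ∀ n < N, SlabConst T N n p (q n))
    (hstep : ∀ n < N, A.IsStep (T / N) γ kb kη (segmentMean kf) (pressureSpace M) (Φ n)
        (Φ (n + 1)) (m n) (U n) (U (n + 1)) (pressureIncl (q n))) :
    IsSchemeSolution M T N γ kb f kη φ μ u p := by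
  have hτ : 0 < T / N := div_pos hT (by exact_mod_cast hN)
  refine ⟨⟨isPiecewisePoly_of_slabAffine hτ fun n hn => ⟨_, _, hφ n hn⟩, hφc.continuousOn⟩,
    isPiecewisePoly_of_slabConst hτ fun n hn => ⟨_, hm n hn⟩,
    ⟨isPiecewisePoly_of_slabAffine hτ fun n hn => ⟨_, _, hu n hn⟩, huc.continuousOn⟩,
    isPiecewisePoly_of_slabConst hτ fun n hn => ⟨_, hq n hn⟩,
    fun ψ hψp n hn => ?_, fun ξ hξp n hn => ?_, fun v hvp n hn => ?_, fun r hrp n hn => ?_⟩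
  · obtain ⟨c, hψ⟩ := exists_slabConst hτ hψp hn
    have e1 := h.slab_mass_deriv hτ (hφ n hn) hψ
    have e2 := h.slab_coup (hφ n hn) (slabConst_timeProj_coe_pi hτ (hu n hn)) hψ
    have e3 := h.slab_stiff kb (slabConst_timeProj_coe hτ (hφ n hn)) (hm n hn) hψ
    exact e1.trans (((hstep n hn).phase c).trans (congrArg₂ (· - ·) e2 e3).symm)
  · obtain ⟨c, hξ⟩ := exists_slabConst hτ hξp hn
    rw [hkf]
    have e1 := h.slab_mass (hm n hn) hξ
    have e2 := h.slab_dir (hφ n hn) hξ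
    have e3 := h.slab_pot kf (hφ n hn) hξ
    exact e1.trans (((congrArg (T / N * ·) ((hstep n hn).potential c)).trans
      (mul_mul_add_mul _ _ _ _).symm).trans (congrArg₂ (fun x y => γ * x + y) e2 e3).symm)
  · obtain ⟨w, hw⟩ := exists_slabConst hτ hvp hn
    have hw' : SlabConst T N n (fun s i => coeVh M (v s i)) fun i => coeVh M (w i) :=
      fun θ hθ => congrArg (fun (z : Fin d → Vh M) i => coeVh M (z i)) (hw θ hθ)
    have hq' : SlabConst T N n (fun s => (p s : L2Pair a L)) (coeVh M (pressureIncl (q n))) :=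
      fun θ hθ => congrArg Subtype.val (hq n hn θ hθ)
    have e1 := h.slab_vec_deriv hτ (hu n hn) hw
    have e2 := h.slab_skw (hu n hn) (slabConst_timeProj_coe_pi hτ (hu n hn)) hw
    have e3 := h.slab_visc kη (slabConst_timeProj_coe hτ (hφ n hn))
      (slabConst_timeProj_coe_pi hτ (hu n hn)) hw
    have e4 := h.slab_pressure hq' hw
    have e5 := h.slab_coup (hφ n hn) hw' (hm n hn)
    exact e1.trans (((hstep n hn).momentum w).trans (congrArg₂ (· - ·) (congrArg₂ (· + ·)
      (congrArg₂ (fun x y => -x - y) e2 e3) e4) e5).symm)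
  · obtain ⟨c, hr⟩ := exists_slabConst hτ hrp hn
    have hr' : SlabConst T N n (fun s => (r s : L2Pair a L)) (coeVh M (pressureIncl c)) :=
      fun θ hθ => congrArg Subtype.val (hr θ hθ)
    have e1 := h.slab_div (hu n hn) hr'
    exact e1.trans ((congrArg (T / N * ·)
      ((hstep n hn).incompressible _ (pressureIncl_mem c))).trans (mul_zero _))

end Scheme

/-! ### Conservation of mass and energy balance -/

section Balance

variable {T : ℝ} {N n : ℕ}

theorem SlabConst.intervalIntegrable (hτ : 0 < T / N) {F : ℝ → ℝ} {c : ℝ}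
    (h : SlabConst T N n F c) :
    IntervalIntegrable F volume (node T N n) (node T N (n + 1)) := by
  have hle : node T N n ≤ node T N (n + 1) := by rw [node_succ]; linarith
  refine (intervalIntegrable_const (c := c)).congr_uIoo fun t ht => ?_
  rw [uIoo_of_le hle] at ht
  obtain ⟨θ, hθ, rfl⟩ := exists_of_mem_slab hτ ht
  exact (h θ hθ).symm

/-- A balance on every slab between two nodes gives a balance between the nodes. -/
theorem add_integral_node_eq (hτ : 0 < T / N) {F : ℝ → ℝ} {e c : ℕ → ℝ} {m : ℕ} (hmn : m ≤ n)
    (hF : ∀ k < n, SlabConst T N k F (c k)) (he : ∀ k < n, e (k + 1) + T / N * c k = e k) :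
    IntervalIntegrable F volume (node T N m) (node T N n) ∧
      e n + ∫ s in (node T N m)..(node T N n), F s = e m := by
  induction n, hmn using Nat.le_induction with
  | base => simp
  | succ n hmn ih =>
    obtain ⟨h1, h2⟩ := ih (fun k hk => hF k (hk.trans n.lt_succ_self))
      fun k hk => he k (hk.trans n.lt_succ_self)
    have h3 := (hF n n.lt_succ_self).intervalIntegrable hτ
    refine ⟨h1.trans h3, ?_⟩
    have h4 : ∫ s in (node T N n)..(node T N (n + 1)), F s = T / N * c n :=
      slab_of_const (hF n n.lt_succ_self)
    rw [← intervalIntegral.integral_add_adjacent_intervals h1 h3, h4]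
    linarith [he n n.lt_succ_self]

/-- Tested with a function without gradient, the right-hand side of the phase equation vanishes. It
is applied with e = 1. -/
theorem GradientModel.IsStep.mass_eq {V : Type*} [NormedAddCommGroup V] [NormedSpace ℝ V]
    {α : Type*} [MeasurableSpace α] {ν : Measure α} {d : ℕ} {A : GradientModel V ν d} {τ γ : ℝ}
    {kb kη : C(ℝ, ℝ)} {kf : C(ℝ × ℝ, ℝ)} {Q : Submodule ℝ V} {φ₀ φ₁ μ : V} {u₀ u₁ : Fin d → V}
    {p : V} (h : A.IsStep τ γ kb kη kf Q φ₀ φ₁ μ u₀ u₁ p) {e : V} (he : A.dir e e = 0) :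
    A.mass φ₁ e = A.mass φ₀ e := by
  have h1 := h.phase e
  rw [A.coup_eq_zero_right _ _ he, A.stiff_eq_zero_right _ _ _ he, map_sub,
    LinearMap.sub_apply] at h1
  linarith

namespace Represents

variable {d : ℕ} {a : Pt d} {L : ℝ} {V : Type*} [NormedAddCommGroup V] [NormedSpace ℝ V]
  {A : GradientModel V (volume.restrict (cube a L)) d} {ι : V → L2Pair a L}

theorem integral_val (h : Represents A ι) {e : V} (he : ι e = onePair a L) (v : V) :
    ∫ x in cube a L, val (ι v) x = A.mass v e := by
  rw [← h.ipS_val, he]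
  refine integral_congr_ae ?_
  filter_upwards [val_onePair (a := a) (L := L)] with x hx
  rw [hx, mul_one]

theorem dir_self_eq_zero (h : Represents A ι) {e : V} (he : ι e = onePair a L) :
    A.dir e e = 0 := by
  rw [← h.ipV_grad, he]
  refine integral_eq_zero_of_ae ?_
  filter_upwards [grad_onePair (a := a) (L := L)] with x hx
  rw [hx, inner_zero_left, Pi.zero_apply]

theorem slabConst_dissipation (h : Represents A ι) (kb kη : C(ℝ, ℝ)) {φ : ℝ → L2Pair a L}
    {μ : ℝ → V} {u : ℝ → VecPair a L} {φm m : V} {um : Fin d → V}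
    (hφ : SlabConst T N n φ (ι φm)) (hμ : SlabConst T N n μ m)
    (hu : SlabConst T N n u fun i => ι (um i)) :
    SlabConst T N n (fun s => dissipation kb kη (φ s) (ι (μ s)) (u s))
      (A.stiff kb φm m m + ∑ i, A.stiff kη φm (um i) (um i)) := fun θ hθ => by
  simp only [hφ θ hθ, hμ θ hθ, hu θ hθ, h.dissipation_eq]

end Represents

variable {d : ℕ} {a : Pt d} {L : ℝ} {M : PeriodicMesh d a L}
  {A : GradientModel (Vh M) (volume.restrict (cube a L)) d}

theorem CHNS.IsSchemeSolution.integral_eq (h : Represents A (coeVh M)) (hL : 0 < L) (hT : 0 < T)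
    {γ : ℝ} {kb kη kf : C(ℝ, ℝ)} {f : ℝ → ℝ} (hkf : deriv f = kf)
    {φ μ : ℝ → Vh M} {u : ℝ → Fin d → Vh M} {p : ℝ → Qh M}
    (hs : IsSchemeSolution M T N γ kb f kη φ μ u p) {m n : ℕ} (hmn : m ≤ n) (hn : n ≤ N) :
    ∫ x in cube a L, val (φ (node T N n) : L2Pair a L) x
      = ∫ x in cube a L, val (φ (node T N m) : L2Pair a L) x := by
  have he : coeVh M ⟨onePair a L, onePair_mem_FE hL M 2⟩ = onePair a L := rfl
  induction n, hmn using Nat.le_induction with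
  | base => rfl
  | succ n hmn ih =>
    obtain ⟨_, _, q, _, hq⟩ := hs.exists_isStep h hT hkf (Nat.lt_of_succ_le hn)
    refine Eq.trans ?_ (ih (n.le_succ.trans hn))
    exact (h.integral_val he _).trans
      ((hq.mass_eq (h.dir_self_eq_zero he)).trans (h.integral_val he _).symm)

theorem CHNS.IsSchemeSolution.energy_add_eq (h : Represents A (coeVh M)) (hT : 0 < T)
    {γ : ℝ} {kb kη kf : C(ℝ, ℝ)} {f : ℝ → ℝ} (hf : ∀ s, HasDerivAt f (kf s) s)
    {φ μ : ℝ → Vh M} {u : ℝ → Fin d → Vh M} {p : ℝ → Qh M}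
    (hs : IsSchemeSolution M T N γ kb f kη φ μ u p) {m n : ℕ} (hmn : m ≤ n) (hn : n ≤ N) :
    energy γ f (φ (node T N n) : L2Pair a L) (fun i => (u (node T N n) i : L2Pair a L))
        + ∫ s in (node T N m)..(node T N n),
            dissipation kb kη (timeProj T N (fun r => (φ r : L2Pair a L)) s) (μ s : L2Pair a L)
              (timeProj T N (fun r i => (u r i : L2Pair a L)) s)
      = energy γ f (φ (node T N m) : L2Pair a L)
          (fun i => (u (node T N m) i : L2Pair a L)) := by
  rcases Nat.eq_zero_or_pos N with rfl | hN
  · obtain rfl : n = 0 := Nat.le_zero.1 hn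
    obtain rfl : m = 0 := Nat.le_zero.1 hmn
    rw [intervalIntegral.integral_same, add_zero]
  have hτ : 0 < T / N := div_pos hT (by exact_mod_cast hN)
  have hfc : Continuous f := continuous_iff_continuousAt.2 fun s => (hf s).continuousAt
  have hstep : ∀ k, ∃ c, k < n → SlabConst T N k (fun s => dissipation kb kη
        (timeProj T N (fun r => (φ r : L2Pair a L)) s) (μ s : L2Pair a L)
        (timeProj T N (fun r i => (u r i : L2Pair a L)) s)) c ∧
      A.energy γ f (φ (node T N (k + 1))) (u (node T N (k + 1))) + T / N * c
        = A.energy γ f (φ (node T N k)) (u (node T N k)) := fun k => by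
    by_cases hk : k < n
    · have hkN := hk.trans_le hn
      obtain ⟨c, hc, q, hq, hcq⟩ := hs.exists_isStep h hT (funext fun s => (hf s).deriv) hkN
      refine ⟨_, fun _ => ⟨?_, hcq.energy_eq hq hfc (segmentMean_mul hf)⟩⟩
      exact h.slabConst_dissipation kb kη
        (slabConst_timeProj_coe hτ (hs.phi_mem.slabAffine hT hN hkN)) hc
        (slabConst_timeProj_coe_pi hτ (hs.u_mem.slabAffine hT hN hkN))
    · exact ⟨0, fun hk' => (hk hk').elim⟩
  choose c hc using hstep
  have key := (add_integral_node_eq hτ (e := fun k => A.energy γ f (φ (node T N k))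
    (u (node T N k))) hmn (fun k hk => (hc k hk).1) fun k hk => (hc k hk).2).2
  exact (congrArg (· + _) (h.energy_eq γ hfc _ _)).trans
    (key.trans (h.energy_eq γ hfc _ _).symm)

end Balance

/-! ### Functions on the time grid with given nodal values -/

section Interpolation

variable {X : Type*} [NormedAddCommGroup X] [NormedSpace ℝ X] {T : ℝ} {N n : ℕ}

/-- The continuous piecewise affine function with the given nodal values. -/
noncomputable def interpolant (T : ℝ) (N : ℕ) (Φ : ℕ → X) (t : ℝ) : X :=
  Φ 0 + ∑ j ∈ Finset.range N, max 0 (min (t / (T / N) - j) 1) • (Φ (j + 1) - Φ j)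

theorem continuous_interpolant (T : ℝ) (N : ℕ) (Φ : ℕ → X) : Continuous (interpolant T N Φ) := by
  unfold interpolant
  fun_prop

theorem interpolant_zero (T : ℝ) (N : ℕ) (Φ : ℕ → X) : interpolant T N Φ 0 = Φ 0 := by
  simp [interpolant]

/-- On slab n the ramps of earlier slabs equal 1, later ones 0, and the n-th equals θ, so the sum of
increments telescopes to Φ n. -/
theorem slabAffine_interpolant (hτ : 0 < T / N) (Φ : ℕ → X) (hn : n < N) :
    SlabAffine T N n (interpolant T N Φ) (Φ n) (Φ (n + 1)) := by
  intro θ hθ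
  have hlt : ∀ j < n, max 0 (min ((n : ℝ) + θ - j) 1) = 1 := fun j hj => by
    have : (j : ℝ) + 1 ≤ n := by exact_mod_cast hj
    rw [min_eq_right (by linarith [hθ.1]), max_eq_right zero_le_one]
  have hgt : ∀ j, n < j → max 0 (min ((n : ℝ) + θ - j) 1) = 0 := fun j hj => by
    have : (n : ℝ) + 1 ≤ j := by exact_mod_cast hj
    exact max_eq_left ((min_le_left _ _).trans (by linarith [hθ.2]))
  have hself : max 0 (min ((n : ℝ) + θ - n) 1) = θ := by
    rw [add_sub_cancel_left, min_eq_left hθ.2.le, max_eq_right hθ.1.le]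
  rw [interpolant, node_add_div hτ, ← Finset.sum_subset (Finset.range_subset_range.2 hn)
    fun j _ hj => by rw [hgt j (by simpa [Nat.lt_succ_iff] using hj), zero_smul],
    Finset.sum_range_succ, hself, ← add_assoc]
  congr 1
  rw [Finset.sum_congr rfl fun j hj => by rw [hlt j (Finset.mem_range.1 hj), one_smul],
    Finset.sum_range_sub, add_sub_cancel]

theorem slabConst_floor {Y : Type*} (hτ : 0 < T / N) (m : ℕ → Y) (n : ℕ) :
    SlabConst T N n (fun t => m ⌊t / (T / N)⌋₊) (m n) := fun θ hθ => by
  have h : ⌊(n : ℝ) + θ⌋₊ = n :=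
    (Nat.floor_eq_iff (by linarith [hθ.1, n.cast_nonneg (α := ℝ)])).2
      ⟨by linarith [hθ.1], by linarith [hθ.2]⟩
  simp only [node_add_div hτ, h]

end Interpolation

/-- A sequence of time steps from given discretely divergence free initial values. -/
theorem GradientModel.exists_isStep_seq {V : Type*} [NormedAddCommGroup V] [NormedSpace ℝ V]
    [FiniteDimensional ℝ V] {α : Type*} [MeasurableSpace α] {ν : Measure α} [IsFiniteMeasure ν]
    {d : ℕ} (A : GradientModel V ν d) {τ γ c : ℝ} (hτ : 0 < τ) (hγ : 0 < γ) (hc : 0 < c)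
    {kb kη : C(ℝ, ℝ)} {kf : C(ℝ × ℝ, ℝ)} (hkb : ∀ s, c ≤ kb s) (hkη : ∀ s, c ≤ kη s) {f : ℝ → ℝ}
    (hf : Continuous f) (hf0 : ∀ s, 0 ≤ f s) (hkf : ∀ p q, kf (p, q) * (q - p) = f q - f p)
    (Q : Submodule ℝ V) (φ₀ : V) {u₀ : Fin d → V} (hu₀ : ∀ q ∈ Q, A.div u₀ q = 0) :
    ∃ (Φ m : ℕ → V) (U : ℕ → Fin d → V) (p : ℕ → Q), Φ 0 = φ₀ ∧ U 0 = u₀ ∧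
      ∀ n, A.IsStep τ γ kb kη kf Q (Φ n) (Φ (n + 1)) (m n) (U n) (U (n + 1)) (p n) := by
  -- The step constrains only the midpoint velocity, so the divergence constraint at the nodes is
  -- carried along as part of the state.
  let S := {x : V × (Fin d → V) // ∀ q ∈ Q, A.div x.2 q = 0}
  have hS : ∀ x : S, ∃ (y : S) (m : V) (p : Q),
      A.IsStep τ γ kb kη kf Q x.1.1 y.1.1 m x.1.2 y.1.2 p := fun x => by
    obtain ⟨φ₁, m, u₁, p, hp, hu₁, h⟩ :=
      A.exists_isStep hτ hγ hc hkb hkη hf hf0 hkf Q x.1.1 x.2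
    exact ⟨⟨(φ₁, u₁), hu₁⟩, m, ⟨p, hp⟩, h⟩
  choose y m p h using hS
  let x : ℕ → S := fun n => n.rec ⟨(φ₀, u₀), hu₀⟩ fun _ => y
  exact ⟨fun n => (x n).1.1, fun n => m (x n), fun n => (x n).1.2, fun n => p (x n), rfl, rfl,
    fun n => h (x n)⟩

/-! ### Projections of the initial values -/

section Projection

variable {d : ℕ} {a : Pt d} {L : ℝ}

/-- The scalar product of `H¹`, as a bilinear form. -/
noncomputable def h1Form (a : Pt d) (L : ℝ) : L2Pair a L →ₗ[ℝ] L2Pair a L →ₗ[ℝ] ℝ :=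
  (innerₗ (Lp ℝ 2 (volume.restrict (cube a L)))).compl₁₂ (LinearMap.fst ℝ _ _)
      (LinearMap.fst ℝ _ _)
    + (innerₗ (Lp (Pt d) 2 (volume.restrict (cube a L)))).compl₁₂ (LinearMap.snd ℝ _ _)
      (LinearMap.snd ℝ _ _)

theorem h1Form_apply (v w : L2Pair a L) :
    h1Form a L v w = inner ℝ v.1 w.1 + inner ℝ v.2 w.2 := rfl

theorem inner_fst (v w : L2Pair a L) : inner ℝ v.1 w.1 = ipS a L (val v) (val w) := by
  rw [L2.inner_def]
  exact integral_congr_ae (.of_forall fun x => mul_comm _ _)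

theorem inner_snd (v w : L2Pair a L) : inner ℝ v.2 w.2 = ipV a L (grad v) (grad w) :=
  L2.inner_def _ _

theorem h1Form_self_nonneg (v : L2Pair a L) : 0 ≤ h1Form a L v v := by
  rw [h1Form_apply]
  exact add_nonneg real_inner_self_nonneg real_inner_self_nonneg

theorem eq_zero_of_h1Form_self {v : L2Pair a L} (h : h1Form a L v v = 0) : v = 0 := by
  rw [h1Form_apply] at h
  have h1 := real_inner_self_nonneg (x := v.1)
  have h2 := real_inner_self_nonneg (x := v.2)
  exact Prod.ext (inner_self_eq_zero (𝕜 := ℝ).1 (by linarith))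
    (inner_self_eq_zero (𝕜 := ℝ).1 (by linarith))

/-- The H¹ product is definite on pairs, so it represents every functional on the finite-dimensional
space. -/
theorem exists_isH1Proj (M : PeriodicMesh d a L) [FiniteDimensional ℝ (Vh M)] (v : L2Pair a L) :
    ∃ w : Vh M, IsH1Proj M v w := by
  obtain ⟨w, hw⟩ := exists_eq_of_definite
    ((h1Form a L).compl₁₂ (Vh M).subtype (Vh M).subtype)
    (fun w hw => Subtype.ext (eq_zero_of_h1Form_self hw)) ((h1Form a L v).comp (Vh M).subtype)
  refine ⟨w, w.2, fun z hz => ?_⟩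
  rw [← inner_fst, ← inner_snd, ← h1Form_apply, map_sub, LinearMap.sub_apply, sub_eq_zero]
  exact LinearMap.congr_fun hw ⟨z, hz⟩

theorem ipV_vec_add_integral_gradDot (u v : VecPair a L) :
    ipV a L (vec u) (vec v) + ∫ x in cube a L, gradDot u v x = ∑ i, h1Form a L (u i) (v i) := by
  simp only [h1Form_apply, Finset.sum_add_distrib, inner_fst, inner_snd]
  congr 1
  · simp only [ipV, ipS, vec, inner_toLp_toLp]
    exact integral_finsetSum _ fun i _ => by
      simpa [val, mul_comm] using L2.integrable_inner (𝕜 := ℝ) (v i).1 (u i).1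
  · exact integral_finsetSum _ fun i _ => L2.integrable_inner (𝕜 := ℝ) (u i).2 (v i).2

variable {M : PeriodicMesh d a L} {A : GradientModel (Vh M) (volume.restrict (cube a L)) d}

theorem isDiscDivFree_iff (h : Represents A (coeVh M)) (u : Fin d → Vh M) :
    IsDiscDivFree M (fun i => (u i : L2Pair a L)) ↔ ∀ q ∈ pressureSpace M, A.div u q = 0 :=
  ⟨fun hu q hq => (h.ipS_divg_val u q).symm.trans (hu.2 q hq),
    fun hu => ⟨fun i => (u i).2, fun q hq =>
      (h.ipS_divg_val u (pressureIncl ⟨q, hq⟩)).trans (hu _ (pressureIncl_mem ⟨q, hq⟩))⟩⟩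

/-- Orthogonal projection, componentwise, to a subspace of a finite product. -/
theorem exists_sum_sub_eq_zero {E V ι : Type*} [AddCommGroup E] [Module ℝ E] [AddCommGroup V]
    [Module ℝ V] [FiniteDimensional ℝ V] [Fintype ι] (B : E →ₗ[ℝ] E →ₗ[ℝ] ℝ)
    (hB : ∀ e, 0 ≤ B e e) (hB0 : ∀ e, B e e = 0 → e = 0) (j : V →ₗ[ℝ] E)
    (hj : Function.Injective j) (Z : Submodule ℝ (ι → V)) (v : ι → E) :
    ∃ w ∈ Z, ∀ z ∈ Z, ∑ i, B (v i - j (w i)) (j (z i)) = 0 := by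
  let c : ι → Z →ₗ[ℝ] E := fun i => j.comp ((LinearMap.proj i).comp Z.subtype)
  obtain ⟨w, hw⟩ := exists_eq_of_definite (W := Z) (∑ i, B.compl₁₂ (c i) (c i))
    (fun w hw => by
      rw [LinearMap.sum_apply, LinearMap.sum_apply] at hw
      refine Subtype.ext (funext fun i => (map_eq_zero_iff j hj).1 (hB0 _ ?_))
      exact (Finset.sum_eq_zero_iff_of_nonneg fun i _ => hB (c i w)).1 hw i (Finset.mem_univ i))
    (∑ i, (B (v i)).comp (c i))
  refine ⟨w, w.2, fun z hz => ?_⟩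
  have h1 := LinearMap.congr_fun hw ⟨z, hz⟩
  simp only [LinearMap.sum_apply] at h1
  simp only [map_sub, LinearMap.sub_apply, Finset.sum_sub_distrib]
  exact sub_eq_zero.2 h1.symm

/-- The discretely divergence-free fields are the kernel of the divergence form, a subspace of a
finite-dimensional product; the H¹ product of fields is the sum over the components. -/
theorem exists_isStokesProj (h : Represents A (coeVh M)) [FiniteDimensional ℝ (Vh M)]
    (v : VecPair a L) :
    ∃ w : Fin d → Vh M, IsStokesProj M v fun i => (w i : L2Pair a L) := by
  obtain ⟨w, hw, hwz⟩ := exists_sum_sub_eq_zero (h1Form a L) h1Form_self_nonneg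
    (fun _ => eq_zero_of_h1Form_self) (Vh M).subtype (Vh M).subtype_injective
    (LinearMap.ker (A.div.compl₂ (pressureSpace M).subtype)) v
  refine ⟨w, (isDiscDivFree_iff h w).2 fun q hq =>
    LinearMap.congr_fun hw (⟨q, hq⟩ : pressureSpace M), fun z hz => ?_⟩
  rw [ipV_vec_add_integral_gradDot]
  exact hwz (fun i => ⟨z i, hz.1 i⟩) (LinearMap.ext fun q =>
    (isDiscDivFree_iff h fun i => ⟨z i, hz.1 i⟩).1 hz q q.2)

end Projection

/-! ### Existence of discrete solutions, conservation of mass and energy balance -/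

theorem mainTheorem1 (d : ℕ) (hd : d = 2 ∨ d = 3) (a : Pt d) (L : ℝ) (hL : 0 < L)
    (γ : ℝ) (hγ : 0 < γ) (b f η : ℝ → ℝ)
    (hb : CoefficientAssumption b) (hf : PotentialAssumption f) (hη : CoefficientAssumption η)
    (M : PeriodicMesh d a L) (σ h : ℝ) (hM : M.IsQuasiUniform σ h)
    (T : ℝ) (hT : 0 < T) (N : ℕ) (hN : 0 < N)
    (φ₀ : L2Pair a L) (hφ₀ : φ₀ ∈ H1per a L) (u₀ : VecPair a L) (hu₀ : ∀ i, u₀ i ∈ H1per a L) :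
    (∃ (φ μ : ℝ → Vh M) (u : ℝ → Fin d → Vh M) (p : ℝ → Qh M),
      IsDiscreteSolution M T N γ b f η φ₀ u₀ φ μ u p) ∧
    ∀ (φ μ : ℝ → Vh M) (u : ℝ → Fin d → Vh M) (p : ℝ → Qh M),
      IsSchemeSolution M T N γ b f η φ μ u p → ∀ m n : ℕ, m ≤ n → n ≤ N →
        (∫ x in cube a L, val (φ (node T N n) : L2Pair a L) x)
            = ∫ x in cube a L, val (φ (node T N m) : L2Pair a L) x ∧
        energy γ f (φ (node T N n) : L2Pair a L) (fun i => (u (node T N n) i : L2Pair a L))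
          + ∫ s in (node T N m)..(node T N n),
              dissipation b η (timeProj T N (fun r => (φ r : L2Pair a L)) s) (μ s : L2Pair a L)
                (timeProj T N (fun r i => (u r i : L2Pair a L)) s)
          = energy γ f (φ (node T N m) : L2Pair a L)
              (fun i => (u (node T N m) i : L2Pair a L)) := by
  have := finiteDimensional_FE hL M 2
  obtain ⟨A, hr, hg⟩ := exists_gradientModel (Vh M) fun w hw => exists_bound_val M hw
  have hA : Represents A (coeVh M) := ⟨hr, hg⟩
  obtain ⟨hbc, b₁, _, _, _, hb₁, hb⟩ := hb
  obtain ⟨hηc, η₁, _, _, _, hη₁, hη⟩ := hη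
  obtain ⟨hfc, hf0, -⟩ := hf
  let kb : C(ℝ, ℝ) := ⟨b, hbc.continuous⟩
  let kη : C(ℝ, ℝ) := ⟨η, hηc.continuous⟩
  let kf : C(ℝ, ℝ) := ⟨deriv f, hfc.continuous_deriv (by norm_num)⟩
  have hkf : ∀ s, HasDerivAt f (kf s) s := fun s =>
    (hfc.differentiable (by norm_num) s).hasDerivAt
  refine ⟨?_, fun φ μ u p hs m n hmn hn => ⟨hs.integral_eq (kb := kb) (kη := kη) (kf := kf) hA hL
    hT rfl hmn hn, hs.energy_add_eq (kb := kb) (kη := kη) hA hT hkf hmn hn⟩⟩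
  have hτ : 0 < T / N := div_pos hT (by exact_mod_cast hN)
  obtain ⟨φi, hφi⟩ := exists_isH1Proj M φ₀
  obtain ⟨ui, hui⟩ := exists_isStokesProj hA u₀
  -- The smaller of the two lower bounds serves for mobility and viscosity alike. The sequence runs
  -- over all natural numbers, of which the time grid uses the first N steps.
  obtain ⟨Φ, m, U, q, hΦ, hU, hstep⟩ := A.exists_isStep_seq hτ hγ (lt_min hb₁ hη₁)
    (kb := kb) (kη := kη) (fun s => (min_le_left _ _).trans (hb s).1)
    (fun s => (min_le_right _ _).trans (hη s).1) hfc.continuous hf0 (segmentMean_mul hkf)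
    (pressureSpace M) φi ((isDiscDivFree_iff hA ui).1 hui.1)
  refine ⟨interpolant T N Φ, fun t => m ⌊t / (T / N)⌋₊, interpolant T N U,
    fun t => ⟨(q ⌊t / (T / N)⌋₊ : Vh M), (q ⌊t / (T / N)⌋₊).2⟩,
    isSchemeSolution_of_isStep (kb := kb) (kη := kη) (kf := kf)
      (q := fun n => ⟨(q n : Vh M), (q n).2⟩) hA hT hN rfl
      (continuous_interpolant T N Φ) (continuous_interpolant T N U)
      (fun n hn => slabAffine_interpolant hτ Φ hn) (fun n hn => slabAffine_interpolant hτ U hn)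
      (fun n _ => slabConst_floor hτ m n)
      (fun n _ => slabConst_floor hτ (fun n => (⟨(q n : Vh M), (q n).2⟩ : Qh M)) n)
      fun n _ => hstep n, ?_, ?_⟩
  · rw [interpolant_zero, hΦ]
    exact hφi
  · rw [interpolant_zero, hU]
    exact hui
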